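/- **Setting.** All quantities below may depend on the sample size $n$ (triangular array); "universal" constants do not. For each $n$ let $X_1,\dots,X_n$ be i.i.d. random vectors in $\mathbb{R}^d$, let $\Theta\subset\mathbb{R}^p$ be a convex parameter set containing the true parameter $\theta_0$, and let $g=(g_1,\dots,g_{r_1})^{T}$ be $r_1$ estimating functions, with $g(\cdot;\theta)$ measurable for each $\theta\in\Theta$, $g_i(\theta)=g(X_i;\theta)$ and $\mathbb{E}\{g_i(\theta_0)\}=0$; here $d,p,r_1,\Theta,\theta_0,g$ and the law of $X_i$ may vary with $n$. Assume that $\theta_0$ is an interior point of $\Theta$ in the sense that $\Theta$ contains the Euclidean ball of radius $\rho_n$ around $\theta_0$, where $\rho_n/(r_1/n)^{1/2}\to\infty$ (for fixed $\Theta,\theta_0,r_1$ this just says that $\theta_0$ is interior). **Notation.** $\mathbb{E}_n$ is the sample mean, $|\cdot|_\infty$ the largest absolute entry, $B^{\otimes2}=BB^{T}$, $B^{\circ\kappa}$ the matrix with entries $|b_{ij}|^{\kappa}$; $V(\theta)=\mathbb{E}\{g_i(\theta)^{\otimes2}\}$, $\widehat V(\theta)=\mathbb{E}_n\{g_i(\theta)^{\otimes2}\}$,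 $Q=([\mathbb{E}\{\nabla_\theta g_i(\theta_0)\}]^{T})^{\otimes2}$ and $J=([\mathbb{E}\{\nabla_\theta g_i(\theta_0)\}]^{T}V(\theta_0)^{-1/2})^{\otimes2}$. **Estimator.** Fix an open interval $\mathcal V$ with $0\in\mathcal V\subset(-1,\infty)$, not depending on $n$. The empirical likelihood estimator $\hat\theta_{EL}$ is, with probability approaching one, a minimiser over $\theta\in\Theta$ of $\sup_{\lambda\in\hat\Lambda_n(\theta)}\sum_{i=1}^n\log\{1+\lambda^{T}g_i(\theta)\}$, where $\hat\Lambda_n(\theta)=\{\lambda\in\mathbb{R}^{r_1}:\lambda^{T}g_i(\theta)\in\mathcal V\text{ for all }i\le n\}$. **Proposition A.1.** Assume that: (i) there is a universal constant $C_1>0$ with $\inf_{\theta\in\Theta:\,|\theta-\theta_0|_\infty>\varepsilon}|\mathbb{E}\{g_i(\theta)\}|_\infty\ge C_1\varepsilon$ for every $\varepsilon>0$; (ii) there are universal constants $C_2>0$, $C_3>1$, $\gamma>4$ with $\max_{j}\mathbb{E}\{\sup_{\theta\in\Theta}|g_{i,j}(\theta)|^\gamma\}\le C_2$ and $$\mathbb{P}\Big[C_3^{-1}\le\inf_{\theta\in\Theta}\lambda_{\min}\{\widehat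 V(\theta)\}\le\sup_{\theta\in\Theta}\lambda_{\max}\{\widehat V(\theta)\}\le C_3\Big]\to1;$$ (iii) each $g_j(x;\theta)$ is twice continuously differentiable in $\theta\in\Theta$ for every $x$, $$\sup_{\theta\in\Theta}\Big(\big|\mathbb{E}_n[\{\nabla_\theta g_i(\theta)\}^{\circ2}]\big|_\infty+\max_j\big|\mathbb{E}_n[\{\nabla^2_\theta g_{i,j}(\theta)\}^{\circ2}]\big|_\infty+\big|\mathbb{E}_n[\{g_i(\theta)\}^{\circ\gamma}]\big|_\infty\Big)=O_p(1),$$ and, for a universal constant $C_5$, $\big|\mathbb{E}[\{\nabla_\theta g_i(\theta_0)\}^{\circ2}]\big|_\infty\le C_5$; (iv) there is a universal constant $C_4>1$ with $C_4^{-1}<\lambda_{\min}(Q)\le\lambda_{\max}(Q)<C_4$; (v) $r_1^3n^{-1+2/\gamma}=o(1)$ and $r_1^3p^2n^{-1}=o(1)$. Then, for all $\alpha=\alpha_n\in\mathbb{R}^p$ with $|\alpha|_2=1$, $$\sqrt n\,\alpha^{T}J^{1/2}(\hat\theta_{EL}-\theta_0)\xrightarrow{d}\mathcal N(0,1)\qquad(n\to\infty).$$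 -/

import Mathlib

open MeasureTheory ProbabilityTheory Filter Topology Matrix

noncomputable section

namespace EmpLik

/-! ### Matrices -/

/-- Smallest eigenvalue of a (nonempty, symmetric) real matrix. -/
def lamMin {q : ℕ} (M : Matrix (Fin q) (Fin q) ℝ) : ℝ := sInf (spectrum ℝ M)

/-- Largest eigenvalue of a (nonempty, symmetric) real matrix. -/
def lamMax {q : ℕ} (M : Matrix (Fin q) (Fin q) ℝ) : ℝ := sSup (spectrum ℝ M)

/-- The square root of a symmetric positive semidefinite matrix, by functional calculus: the
eigenvectors are kept and each eigenvalue is replaced by its square root. -/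
def matSqrt {q : ℕ} (M : Matrix (Fin q) (Fin q) ℝ) : Matrix (Fin q) (Fin q) ℝ :=
  cfc Real.sqrt M

/-- `B ↦ B Bᵀ`. -/
def outer {a b : ℕ} (B : Matrix (Fin a) (Fin b) ℝ) : Matrix (Fin a) (Fin a) ℝ := B * Bᵀ

/-! ### Stochastic orders along a sequence of probability spaces -/

/-- The events `E n` hold with probability approaching one, i.e. `P n (E n) → 1`
(stated through the complements, so that no measurability is presupposed). -/
def HoldsWPA1 {Ω : ℕ → Type*} [∀ n, MeasurableSpace (Ω n)] (P : ∀ n, Measure (Ω n))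
    (E : ∀ n, Set (Ω n)) : Prop :=
  Tendsto (fun n => P n (E n)ᶜ) atTop (𝓝 0)

/-- `S n = O_p(1)` for nonnegative extended random variables. -/
def IsBigOpOne {Ω : ℕ → Type*} [∀ n, MeasurableSpace (Ω n)] (P : ∀ n, Measure (Ω n))
    (S : ∀ n, Ω n → ENNReal) : Prop :=
  ∀ ε : ENNReal, 0 < ε → ∃ M : NNReal, ∀ᶠ n in atTop, P n {ω | (M : ENNReal) < S n ω} ≤ ε

section Moments

variable {𝒳 : Type*} {p r n : ℕ}

/-- The partial derivative, in the `k`-th coordinate, of a function on the parameter set `Θ`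
(at interior points of `Θ` this is the usual partial derivative). -/
def pderivOn (Θ : Set (Fin p → ℝ)) (f : (Fin p → ℝ) → ℝ) (k : Fin p) (θ : Fin p → ℝ) : ℝ :=
  fderivWithin ℝ f Θ θ (Pi.single k 1)

/-! ### Population quantities; `μ` is the law of one observation -/

/-- `E g(X; θ)`. -/
def popMean [MeasurableSpace 𝒳] (μ : Measure 𝒳) (g : 𝒳 → (Fin p → ℝ) → Fin r → ℝ)
    (θ : Fin p → ℝ) : Fin r → ℝ :=
  fun j => ∫ x, g x θ j ∂μ

/-- `V(θ) = E {g(X; θ) g(X; θ)ᵀ}`. -/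
def popV [MeasurableSpace 𝒳] (μ : Measure 𝒳) (g : 𝒳 → (Fin p → ℝ) → Fin r → ℝ)
    (θ : Fin p → ℝ) : Matrix (Fin r) (Fin r) ℝ :=
  Matrix.of fun j k => ∫ x, g x θ j * g x θ k ∂μ

/-- `E ∇g(X; θ)`, an `r × p` matrix. -/
def popGrad [MeasurableSpace 𝒳] (μ : Measure 𝒳) (Θ : Set (Fin p → ℝ))
    (g : 𝒳 → (Fin p → ℝ) → Fin r → ℝ) (θ : Fin p → ℝ) : Matrix (Fin r) (Fin p) ℝ :=
  Matrix.of fun j k => ∫ x, pderivOn Θ (fun t => g x t j) k θ ∂μ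

/-- `Q = ([E ∇g(X; θ)]ᵀ)^{⊗2}`. -/
def matQ [MeasurableSpace 𝒳] (μ : Measure 𝒳) (Θ : Set (Fin p → ℝ))
    (g : 𝒳 → (Fin p → ℝ) → Fin r → ℝ) (θ : Fin p → ℝ) : Matrix (Fin p) (Fin p) ℝ :=
  outer (popGrad μ Θ g θ)ᵀ

/-- `J = ([E ∇g(X; θ)]ᵀ V(θ)^{-1/2})^{⊗2}`. -/
def matJ [MeasurableSpace 𝒳] (μ : Measure 𝒳) (Θ : Set (Fin p → ℝ))
    (g : 𝒳 → (Fin p → ℝ) → Fin r → ℝ) (θ : Fin p → ℝ) : Matrix (Fin p) (Fin p) ℝ :=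
  outer ((popGrad μ Θ g θ)ᵀ * (matSqrt (popV μ g θ))⁻¹)

/-! ### Sample quantities; `x : Fin n → 𝒳` is the sample -/

/-- The sample mean. -/
def empMean (f : Fin n → ℝ) : ℝ := (n : ℝ)⁻¹ * ∑ i, f i

/-- `V̂(θ) = E_n {g_i(θ) g_i(θ)ᵀ}`. -/
def empV (g : 𝒳 → (Fin p → ℝ) → Fin r → ℝ) (x : Fin n → 𝒳) (θ : Fin p → ℝ) :
    Matrix (Fin r) (Fin r) ℝ :=
  Matrix.of fun j k => empMean fun i => g (x i) θ j * g (x i) θ k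

/-- The supremum over `θ ∈ Θ` of the sum of the sup-norms of `E_n {∇g_i(θ)}^{∘2}`, of
`E_n {∇²g_{i,j}(θ)}^{∘2}` (maximised over `j`), and of `E_n |g_i(θ)|^{∘γ}`. -/
def regSup (Θ : Set (Fin p → ℝ)) (g : 𝒳 → (Fin p → ℝ) → Fin r → ℝ) (γ : ℝ)
    (x : Fin n → 𝒳) : ENNReal :=
  ⨆ θ ∈ Θ,
    ((⨆ (j : Fin r) (k : Fin p),
        ENNReal.ofReal (empMean fun i => (pderivOn Θ (fun t => g (x i) t j) k θ) ^ 2)) +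
     (⨆ (j : Fin r) (k : Fin p) (l : Fin p),
        ENNReal.ofReal (empMean fun i =>
          (pderivOn Θ (fun s => pderivOn Θ (fun t => g (x i) t j) k s) l θ) ^ 2)) +
     (⨆ j : Fin r, ENNReal.ofReal (empMean fun i => |g (x i) θ j| ^ γ)))

/-! ### The empirical likelihood estimator -/

/-- The set of admissible multipliers: all `lam` with `lamᵀ g_i(θ) ∈ V` for every `i`. -/
def multipliers (V : Set ℝ) (g : 𝒳 → (Fin p → ℝ) → Fin r → ℝ) (x : Fin n → 𝒳)
    (θ : Fin p → ℝ) : Set (Fin r → ℝ) :=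
  {lam | ∀ i, lam ⬝ᵥ g (x i) θ ∈ V}

/-- The empirical likelihood criterion: the supremum over the admissible multipliers of
`∑ i, log (1 + lamᵀ g_i(θ))`, as an extended real number. -/
def criterion (V : Set ℝ) (g : 𝒳 → (Fin p → ℝ) → Fin r → ℝ) (x : Fin n → 𝒳)
    (θ : Fin p → ℝ) : EReal :=
  ⨆ lam ∈ multipliers V g x θ, ((∑ i, Real.log (1 + lam ⬝ᵥ g (x i) θ) : ℝ) : EReal)

/-- `θ` is an empirical likelihood estimate: a minimiser of the criterion over `Θ`. -/
def IsELEstimate (V : Set ℝ) (Θ : Set (Fin p → ℝ)) (g : 𝒳 → (Fin p → ℝ) → Fin r → ℝ)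
    (x : Fin n → 𝒳) (θ : Fin p → ℝ) : Prop :=
  θ ∈ Θ ∧ IsMinOn (criterion V g x) Θ θ

end Moments

end EmpLik

end

/-! Write `a = √(r/n)`, `ḡ` for the sample mean of the estimating functions, `G` for the population
mean gradient at `θ₀`, `V` for the population second moment matrix there, and `Δ = θhat - θ₀`. The
aim is the linear expansion `√n αᵀJ^{1/2}Δ = -√n wᵀḡ(θ₀) + o_p(1)`, where `w = V⁻¹Gu` and `u =
J^{-1/2}α`. The summands on the right are centred with variance one, so a central limit theorem for
triangular arrays finishes.

The expansion is deterministic on a good sample (`RegularSample`). If `ḡ(θ)` is `O(a)`, the inner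
maximum is attained in a ball of radius `O(a)`, where all `λᵀg_i` are small and the logarithm lies
between two quadratics. Concavity excludes larger multipliers, and the stationarity equation says
that the sample second moment matrix sends `λ` approximately to `ḡ(θ)` (`exists_multiplier`).
Comparing the criterion at `θhat` with that at `θ₀` gives `ḡ(θhat) = O(a)`. Identification and a
uniform law of large numbers then give the rate `a` in the sup norm, and Taylor expansion with the
lower bound on `G` gives it in the Euclidean norm.

The profile criterion is never differentiated in `θ`. Instead `θhat` is moved to `b = θhat + τu`,
and the optimal multiplier `λ` of `b` is used at both points: the criterion at `θhat` is at most
that at `b`, so the mean value theorem for this fixed `λ` yields `λᵀGu ≳ 0`. Since `λᵀGu = wᵀVλ ≈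
wᵀḡ(b) ≈ wᵀ(ḡ(θ₀) + GΔ)`, this bounds the linear form from below, and the pair `(-u, -w)` bounds it
from above (`RegularSample.first_order_le`, `exists_linearisation`). After multiplication by `√n`
the errors are of order `T√r a + rpa`, with `T` the envelope of `|g_i|₂`; up to constants these are
the square roots of the two quantities in assumption (v).

The uniform law (`measure_uniform_deviation_le`) allows a slack proportional to `‖θ - θ₀‖`, which
identification can absorb. A self-normalised exponential inequality on a grid proves it without
exponential moments. Population facts that are assumed only for the sample, such as bounds on
increments and on `V`, follow because an event of probability above one half meets the event of a
Chebyshev bound. -/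

noncomputable section

namespace EmpLik

/-! ### Euclidean and `ℓ¹` norms of tuples -/

/-- Euclidean norm of a tuple. -/
def l2 {q : ℕ} (v : Fin q → ℝ) : ℝ := √(v ⬝ᵥ v)

/-- `ℓ¹` norm of a tuple. -/
def l1 {q : ℕ} (v : Fin q → ℝ) : ℝ := ∑ k, |v k|

section Norms

variable {q : ℕ} (u v w : Fin q → ℝ)

lemma l2_nonneg : 0 ≤ l2 v := Real.sqrt_nonneg _

lemma l1_nonneg : 0 ≤ l1 v := Finset.sum_nonneg fun _ _ => abs_nonneg _

lemma dotProduct_self_nonneg' : 0 ≤ v ⬝ᵥ v :=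
  Finset.sum_nonneg fun i _ => mul_self_nonneg (v i)

lemma l2_sq : l2 v ^ 2 = v ⬝ᵥ v := Real.sq_sqrt (dotProduct_self_nonneg' v)

lemma l2_eq_norm : l2 v = ‖WithLp.toLp 2 v‖ := by
  rw [l2, EuclideanSpace.norm_eq]
  simp [dotProduct, sq]

lemma l2_add_le : l2 (u + v) ≤ l2 u + l2 v := by
  simp only [l2_eq_norm, WithLp.toLp_add]
  exact norm_add_le _ _

lemma l2_sub_le : l2 (u - v) ≤ l2 u + l2 v := by
  simp only [l2_eq_norm, WithLp.toLp_sub]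
  exact norm_sub_le _ _

lemma l2_smul (a : ℝ) : l2 (a • v) = |a| * l2 v := by
  simp only [l2_eq_norm, WithLp.toLp_smul, norm_smul, Real.norm_eq_abs]

lemma l2_neg : l2 (-v) = l2 v := by
  simp only [l2_eq_norm, WithLp.toLp_neg, norm_neg]

lemma l2_zero : l2 (0 : Fin q → ℝ) = 0 := by simp [l2]

lemma l2_eq_zero {v : Fin q → ℝ} (h : l2 v = 0) : v = 0 := by
  rw [l2_eq_norm, norm_eq_zero] at h
  simpa using h

lemma continuous_l2 : Continuous (l2 : (Fin q → ℝ) → ℝ) := by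
  unfold l2 dotProduct
  fun_prop

lemma abs_dotProduct_le : |u ⬝ᵥ v| ≤ l2 u * l2 v := by
  apply Real.abs_le_sqrt (x := u ⬝ᵥ v) (y := (u ⬝ᵥ u) * (v ⬝ᵥ v)) _ |>.trans
  · rw [Real.sqrt_mul (dotProduct_self_nonneg' u)]; rfl
  · have := Finset.sum_mul_sq_le_sq_mul_sq Finset.univ u v
    simpa [dotProduct, sq] using this

lemma dotProduct_le_l2 : u ⬝ᵥ v ≤ l2 u * l2 v := (le_abs_self _).trans (abs_dotProduct_le u v)

lemma abs_apply_le_l2 (j : Fin q) : |v j| ≤ l2 v := by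
  apply Real.abs_le_sqrt
  rw [dotProduct, sq]
  exact Finset.single_le_sum (f := fun i => v i * v i) (fun i _ => mul_self_nonneg (v i))
    (Finset.mem_univ j)

lemma norm_le_l2 : ‖v‖ ≤ l2 v :=
  (pi_norm_le_iff_of_nonneg (l2_nonneg v)).2 fun j => by
    simpa using abs_apply_le_l2 v j

lemma l1_le_sqrt_mul_l2 : l1 v ≤ √q * l2 v := by
  have h := Finset.sum_mul_sq_le_sq_mul_sq Finset.univ (fun _ : Fin q => (1 : ℝ)) (fun i => |v i|)
  rw [l2, ← Real.sqrt_mul (by positivity)]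
  apply Real.le_sqrt_of_sq_le
  simpa [dotProduct, l1, sq] using h

lemma l1_le_mul_norm : l1 v ≤ q * ‖v‖ := by
  have : l1 v ≤ ∑ _k : Fin q, ‖v‖ := Finset.sum_le_sum fun k _ => norm_le_pi_norm v k
  simpa using this

lemma l1_smul (a : ℝ) : l1 (a • v) = |a| * l1 v := by
  simp [l1, abs_mul, Finset.mul_sum]

lemma l1_add_le : l1 (u + v) ≤ l1 u + l1 v := by
  rw [l1, l1, l1, ← Finset.sum_add_distrib]
  exact Finset.sum_le_sum fun k _ => abs_add_le _ _

lemma l2_le_sqrt_mul {v : Fin q → ℝ} {c : ℝ} (hc : 0 ≤ c) (h : ∀ j, |v j| ≤ c) :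
    l2 v ≤ √q * c := by
  rw [l2]
  apply Real.sqrt_le_iff.2 ⟨by positivity, ?_⟩
  rw [mul_pow, Real.sq_sqrt (by positivity)]
  calc v ⬝ᵥ v ≤ ∑ _j : Fin q, c ^ 2 := Finset.sum_le_sum fun j _ => by
        rw [← sq]; exact sq_le_sq' (by linarith [neg_abs_le (v j), h j]) ((le_abs_self _).trans (h j))
    _ = q * c ^ 2 := by simp

lemma l2_le_of_forall_dotProduct {v : Fin q → ℝ} {c : ℝ} (hc : 0 ≤ c)
    (h : ∀ u, u ⬝ᵥ v ≤ c * l2 u) : l2 v ≤ c := by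
  have h1 := h v
  rw [← l2_sq, sq] at h1
  by_contra hcon
  push Not at hcon
  nlinarith [l2_nonneg v]

/-- The operator norm is at most the Frobenius norm. The hypothesis is in Frobenius form because
Chebyshev's inequality, summed over entries, controls exactly that. -/
lemma abs_dotProduct_mulVec_le {a b : ℕ} (B : Matrix (Fin a) (Fin b) ℝ) {c : ℝ} (hc : 0 ≤ c)
    (hB : ∑ i, ∑ k, B i k ^ 2 ≤ c ^ 2) (x : Fin a → ℝ) (y : Fin b → ℝ) :
    |x ⬝ᵥ (B *ᵥ y)| ≤ l2 x * c * l2 y := by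
  have h1 : l2 (B *ᵥ y) ≤ c * l2 y := by
    rw [l2]
    refine Real.sqrt_le_iff.2 ⟨by have := l2_nonneg y; positivity, ?_⟩
    rw [mul_pow, l2_sq]
    calc (B *ᵥ y) ⬝ᵥ (B *ᵥ y) = ∑ i, (∑ k, B i k * y k) ^ 2 := by
          simp [dotProduct, mulVec, sq]
      _ ≤ ∑ i, (∑ k, B i k ^ 2) * (y ⬝ᵥ y) := Finset.sum_le_sum fun i _ => by
          have := Finset.sum_mul_sq_le_sq_mul_sq Finset.univ (B i) y
          simpa [dotProduct, sq] using this
      _ = (∑ i, ∑ k, B i k ^ 2) * (y ⬝ᵥ y) := by rw [Finset.sum_mul]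
      _ ≤ c ^ 2 * (y ⬝ᵥ y) := mul_le_mul_of_nonneg_right hB (dotProduct_self_nonneg' y)
  calc |x ⬝ᵥ (B *ᵥ y)| ≤ l2 x * l2 (B *ᵥ y) := abs_dotProduct_le _ _
    _ ≤ l2 x * (c * l2 y) := mul_le_mul_of_nonneg_left h1 (l2_nonneg x)
    _ = _ := by ring

end Norms

/-! ### Sample means -/

section EmpMean

variable {n : ℕ} (f h : Fin n → ℝ)

lemma empMean_mono {f h : Fin n → ℝ} (hfh : ∀ i, f i ≤ h i) : empMean f ≤ empMean h :=
  mul_le_mul_of_nonneg_left (Finset.sum_le_sum fun i _ => hfh i) (by positivity)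

lemma empMean_nonneg {f : Fin n → ℝ} (hf : ∀ i, 0 ≤ f i) : 0 ≤ empMean f :=
  mul_nonneg (by positivity) (Finset.sum_nonneg fun i _ => hf i)

lemma empMean_add : empMean (fun i => f i + h i) = empMean f + empMean h := by
  simp [empMean, Finset.sum_add_distrib, mul_add]

lemma empMean_sub : empMean (fun i => f i - h i) = empMean f - empMean h := by
  simp [empMean, Finset.sum_sub_distrib, mul_sub]

lemma empMean_const_mul (a : ℝ) : empMean (fun i => a * f i) = a * empMean f := by
  simp only [empMean, ← Finset.mul_sum]; ring

lemma empMean_sum {ι : Type*} (s : Finset ι) (F : ι → Fin n → ℝ) :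
    empMean (fun i => ∑ k ∈ s, F k i) = ∑ k ∈ s, empMean (F k) := by
  simp only [empMean]
  rw [Finset.sum_comm, Finset.mul_sum]

lemma abs_empMean_le : |empMean f| ≤ empMean fun i => |f i| := by
  rw [empMean, abs_mul, abs_of_nonneg (by positivity : (0 : ℝ) ≤ (n : ℝ)⁻¹)]
  exact mul_le_mul_of_nonneg_left (Finset.abs_sum_le_sum_abs _ _) (by positivity)

lemma empMean_const_le {a : ℝ} (ha : 0 ≤ a) : empMean (fun _ : Fin n => a) ≤ a := by
  rcases Nat.eq_zero_or_pos n with h0 | h0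
  · subst h0; simpa [empMean] using ha
  · have : (n : ℝ) ≠ 0 := by positivity
    simp [empMean, this]

lemma empMean_mul_sq_le :
    empMean (fun i => f i * h i) ^ 2 ≤ empMean (fun i => f i ^ 2) * empMean (fun i => h i ^ 2) := by
  have := Finset.sum_mul_sq_le_sq_mul_sq Finset.univ f h
  simp only [empMean]
  have h2 : 0 ≤ ((n : ℝ)⁻¹) ^ 2 := by positivity
  nlinarith [mul_le_mul_of_nonneg_left this h2]

lemma abs_empMean_mul_le {a b : ℝ} (ha : 0 ≤ a) (hb : 0 ≤ b)
    (hf : empMean (fun i => f i ^ 2) ≤ a ^ 2) (hh : empMean (fun i => h i ^ 2) ≤ b ^ 2) :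
    |empMean (fun i => f i * h i)| ≤ a * b := by
  apply abs_le_of_sq_le_sq _ (by positivity)
  rw [mul_pow]
  exact (empMean_mul_sq_le f h).trans
    (mul_le_mul hf hh (empMean_nonneg fun i => sq_nonneg _) (by positivity))

lemma empMean_abs_mul_le {a b : ℝ} (ha : 0 ≤ a) (hb : 0 ≤ b)
    (hf : empMean (fun i => f i ^ 2) ≤ a ^ 2) (hh : empMean (fun i => h i ^ 2) ≤ b ^ 2) :
    empMean (fun i => |f i| * |h i|) ≤ a * b :=
  (le_abs_self _).trans (abs_empMean_mul_le _ _ ha hb (by simpa using hf) (by simpa using hh))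

lemma empMean_sq_le : empMean f ^ 2 ≤ empMean fun i => f i ^ 2 := by
  have := empMean_mul_sq_le f (fun _ => 1)
  simp only [mul_one, one_pow] at this
  have h1 : empMean (fun _ : Fin n => (1 : ℝ)) ≤ 1 := empMean_const_le (by norm_num)
  have h2 : 0 ≤ empMean fun i => f i ^ 2 := empMean_nonneg fun i => sq_nonneg _
  nlinarith

lemma abs_empMean_le_of_sq {a : ℝ} (ha : 0 ≤ a) (hf : empMean (fun i => f i ^ 2) ≤ a ^ 2) :
    |empMean f| ≤ a :=
  abs_le_of_sq_le_sq ((empMean_sq_le f).trans hf) ha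

/-- Cauchy–Schwarz with weights `|a k|`, so that second moments of the separate coordinates suffice
and the price is the `ℓ¹` norm of `a`. -/
lemma empMean_sum_mul_sq_le {q : ℕ} (a : Fin q → ℝ) (F : Fin q → Fin n → ℝ) {M : ℝ}
    (hF : ∀ k, empMean (fun i => F k i ^ 2) ≤ M) :
    empMean (fun i => (∑ k, a k * F k i) ^ 2) ≤ M * l1 a ^ 2 := by
  have key : ∀ i, (∑ k, a k * F k i) ^ 2 ≤ l1 a * ∑ k, |a k| * F k i ^ 2 := by
    intro i
    have := Finset.sum_mul_sq_le_sq_mul_sq Finset.univ (fun k => √|a k|)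
      (fun k => √|a k| * |F k i|)
    have e1 : ∀ k, √|a k| * (√|a k| * |F k i|) = |a k * F k i| := fun k => by
      rw [← mul_assoc, Real.mul_self_sqrt (abs_nonneg _), abs_mul]
    have e2 : ∀ k, (√|a k| * |F k i|) ^ 2 = |a k| * F k i ^ 2 := fun k => by
      rw [mul_pow, Real.sq_sqrt (abs_nonneg _), sq_abs]
    have e3 : ∀ k, √|a k| ^ 2 = |a k| := fun k => Real.sq_sqrt (abs_nonneg _)
    simp only [e1, e2, e3] at this
    refine le_trans ?_ this
    apply sq_le_sq'
    · linarith [neg_abs_le (∑ k, a k * F k i),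
        Finset.abs_sum_le_sum_abs (fun k => a k * F k i) Finset.univ]
    · exact (le_abs_self _).trans (Finset.abs_sum_le_sum_abs _ _)
  refine (empMean_mono key).trans ?_
  rw [empMean_const_mul, empMean_sum]
  have : ∑ k, empMean (fun i => |a k| * F k i ^ 2) ≤ ∑ k, |a k| * M :=
    Finset.sum_le_sum fun k _ => by
      rw [empMean_const_mul]; exact mul_le_mul_of_nonneg_left (hF k) (abs_nonneg _)
  rw [← Finset.sum_mul] at this
  calc l1 a * ∑ k, empMean (fun i => |a k| * F k i ^ 2) ≤ l1 a * (l1 a * M) :=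
        mul_le_mul_of_nonneg_left this (l1_nonneg a)
    _ = M * l1 a ^ 2 := by ring

lemma dotProduct_empMean {r : ℕ} (v : Fin r → ℝ) (G : Fin n → Fin r → ℝ) :
    v ⬝ᵥ (fun j => empMean fun i => G i j) = empMean fun i => v ⬝ᵥ G i := by
  simp only [dotProduct, empMean_sum, empMean_const_mul]

end EmpMean

/-! ### Mean value estimates on the parameter set -/

section Segment

variable {n p : ℕ} {Θ : Set (Fin p → ℝ)}

lemma fderivWithin_apply_eq_sum (f : (Fin p → ℝ) → ℝ) (θ v : Fin p → ℝ) :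
    fderivWithin ℝ f Θ θ v = ∑ k, v k * pderivOn Θ f k θ := by
  conv_lhs => rw [← Finset.univ_sum_single v]
  rw [map_sum]
  refine Finset.sum_congr rfl fun k _ => ?_
  have : (Pi.single k (v k) : Fin p → ℝ) = v k • Pi.single k (1 : ℝ) := by
    rw [← Pi.single_smul, smul_eq_mul, mul_one]
  rw [this, map_smul, smul_eq_mul]
  rfl

lemma ContDiffOn.pderivOn (hU : UniqueDiffOn ℝ Θ) {f : (Fin p → ℝ) → ℝ}
    (hf : ContDiffOn ℝ 2 f Θ) (k : Fin p) : ContDiffOn ℝ 1 (pderivOn Θ f k) Θ :=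
  (hf.fderivWithin (m := 1) hU (by norm_num)).clm_apply contDiffOn_const

lemma l1_sub_le_of_mem_segment {a b z : Fin p → ℝ} (hz : z ∈ segment ℝ a b) :
    l1 (z - a) ≤ l1 (b - a) := by
  rw [segment_eq_image'] at hz
  obtain ⟨σ, ⟨h0, h1⟩, rfl⟩ := hz
  rw [add_sub_cancel_left, l1_smul, abs_of_nonneg h0]
  exact mul_le_of_le_one_left (l1_nonneg _) h1

/-- Derivative moments are bounded at each `θ` separately, so one intermediate point must serve all
observations. It comes from the mean value theorem for the scalar function `θ ↦ ∑ c i * f i θ` with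
`c` the increments themselves; Cauchy–Schwarz then cancels one factor of their norm. -/
lemma empMean_sq_sub_le (hconv : Convex ℝ Θ) {f : Fin n → (Fin p → ℝ) → ℝ}
    (hf : ∀ i, DifferentiableOn ℝ (f i) Θ) {M : ℝ}
    (hM : ∀ θ ∈ Θ, ∀ k, empMean (fun i => pderivOn Θ (f i) k θ ^ 2) ≤ M)
    {a b : Fin p → ℝ} (ha : a ∈ Θ) (hb : b ∈ Θ) :
    empMean (fun i => (f i b - f i a) ^ 2) ≤ M * l1 (b - a) ^ 2 := by
  set c : Fin n → ℝ := fun i => f i b - f i a with hc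
  obtain ⟨z, hz, hzeq⟩ := domain_mvt (f := fun θ => ∑ i, c i * f i θ)
    (f' := fun θ => ∑ i, c i • fderivWithin ℝ (f i) Θ θ) (s := Θ)
    (fun θ hθ => HasFDerivWithinAt.fun_sum fun i _ =>
      ((hf i θ hθ).hasFDerivWithinAt).const_mul (c i)) hconv ha hb
  have hzΘ : z ∈ Θ := hconv.segment_subset ha hb hz
  set d : Fin n → ℝ := fun i => ∑ k, (b - a) k * pderivOn Θ (f i) k z with hd
  have h1 : empMean (fun i => c i ^ 2) = empMean (fun i => c i * d i) := by
    simp only [empMean]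
    congr 1
    rw [← Finset.sum_sub_distrib] at hzeq
    have e1 : ∀ i, c i * f i b - c i * f i a = c i ^ 2 := fun i => by simp only [hc]; ring
    simp only [e1] at hzeq
    rw [hzeq]
    simp [fderivWithin_apply_eq_sum, hd]
  have h2 : empMean (fun i => d i ^ 2) ≤ M * l1 (b - a) ^ 2 :=
    empMean_sum_mul_sq_le _ _ fun k => hM z hzΘ k
  have h3 := empMean_mul_sq_le c d
  have hc0 : 0 ≤ empMean (fun i => c i ^ 2) := empMean_nonneg fun i => sq_nonneg _
  have hd0 : 0 ≤ empMean (fun i => d i ^ 2) := empMean_nonneg fun i => sq_nonneg _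
  rw [← h1] at h3
  refine le_trans ?_ h2
  by_contra hcon
  push Not at hcon
  nlinarith

lemma abs_empMean_sub_le (hconv : Convex ℝ Θ) {f : Fin n → (Fin p → ℝ) → ℝ}
    (hf : ∀ i, DifferentiableOn ℝ (f i) Θ) {M : ℝ} (hM0 : 0 ≤ M)
    (hM : ∀ θ ∈ Θ, ∀ k, empMean (fun i => pderivOn Θ (f i) k θ ^ 2) ≤ M)
    {a b : Fin p → ℝ} (ha : a ∈ Θ) (hb : b ∈ Θ) :
    |empMean (fun i => f i b) - empMean (fun i => f i a)| ≤ √M * l1 (b - a) := by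
  rw [← empMean_sub]
  apply abs_empMean_le_of_sq _ (mul_nonneg (Real.sqrt_nonneg _) (l1_nonneg _))
  rw [mul_pow, Real.sq_sqrt hM0]
  exact empMean_sq_sub_le hconv hf hM ha hb

/-- The mean value theorem for the averaged function leaves averaged partial derivatives at a point
of the segment; the second-derivative moments bound their change back to `a`. -/
lemma abs_empMean_taylor_le (hconv : Convex ℝ Θ) (hU : UniqueDiffOn ℝ Θ)
    {f : Fin n → (Fin p → ℝ) → ℝ} (hf : ∀ i, ContDiffOn ℝ 2 (f i) Θ) {M : ℝ} (hM0 : 0 ≤ M)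
    (hM : ∀ θ ∈ Θ, ∀ k l,
      empMean (fun i => pderivOn Θ (fun s => pderivOn Θ (f i) k s) l θ ^ 2) ≤ M)
    {a b : Fin p → ℝ} (ha : a ∈ Θ) (hb : b ∈ Θ) :
    |empMean (fun i => f i b) - empMean (fun i => f i a)
      - ∑ k, (b - a) k * empMean (fun i => pderivOn Θ (f i) k a)| ≤ √M * l1 (b - a) ^ 2 := by
  obtain ⟨z, hz, hzeq⟩ := domain_mvt (f := fun θ => (n : ℝ)⁻¹ * ∑ i, f i θ)
    (f' := fun θ => (n : ℝ)⁻¹ • ∑ i, fderivWithin ℝ (f i) Θ θ) (s := Θ)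
    (fun θ hθ => (HasFDerivWithinAt.fun_sum fun i _ =>
      (((hf i).differentiableOn (by norm_num) θ hθ).hasFDerivWithinAt)).const_mul _) hconv ha hb
  have hzΘ : z ∈ Θ := hconv.segment_subset ha hb hz
  have h1 : empMean (fun i => f i b) - empMean (fun i => f i a)
      = ∑ k, (b - a) k * empMean (fun i => pderivOn Θ (f i) k z) := by
    have : empMean (fun i => ∑ k, (b - a) k * pderivOn Θ (f i) k z)
        = ∑ k, (b - a) k * empMean (fun i => pderivOn Θ (f i) k z) := by
      rw [empMean_sum]
      simp only [empMean_const_mul]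
    rw [← this]
    simp only [empMean]
    rw [hzeq]
    simp [fderivWithin_apply_eq_sum]
  rw [h1, ← Finset.sum_sub_distrib]
  calc |∑ k, ((b - a) k * empMean (fun i => pderivOn Θ (f i) k z)
          - (b - a) k * empMean (fun i => pderivOn Θ (f i) k a))|
      ≤ ∑ k, |(b - a) k| * (√M * l1 (b - a)) := by
        refine (Finset.abs_sum_le_sum_abs _ _).trans (Finset.sum_le_sum fun k _ => ?_)
        rw [← mul_sub, abs_mul]
        refine mul_le_mul_of_nonneg_left ?_ (abs_nonneg _)
        refine (abs_empMean_sub_le (f := fun i => pderivOn Θ (f i) k) hconv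
          (fun i => (ContDiffOn.pderivOn hU (hf i) k).differentiableOn (by norm_num)) hM0
          (fun θ hθ l => hM θ hθ k l) ha hzΘ).trans ?_
        exact mul_le_mul_of_nonneg_left (l1_sub_le_of_mem_segment hz) (Real.sqrt_nonneg _)
    _ = √M * l1 (b - a) ^ 2 := by rw [← Finset.sum_mul, ← l1]; ring

lemma exists_log_mean_value {r : ℕ} (hconv : Convex ℝ Θ) {G : Fin n → (Fin p → ℝ) → Fin r → ℝ}
    (hG : ∀ i j, DifferentiableOn ℝ (fun θ => G i θ j) Θ) (lam : Fin r → ℝ)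
    (hpos : ∀ θ ∈ Θ, ∀ i, 1 + lam ⬝ᵥ G i θ ≠ 0)
    {a b : Fin p → ℝ} (ha : a ∈ Θ) (hb : b ∈ Θ) :
    ∃ z ∈ segment ℝ a b, empMean (fun i => Real.log (1 + lam ⬝ᵥ G i b))
      - empMean (fun i => Real.log (1 + lam ⬝ᵥ G i a))
      = empMean fun i => (1 + lam ⬝ᵥ G i z)⁻¹ *
        ∑ j, lam j * ∑ k, (b - a) k * pderivOn Θ (fun t => G i t j) k z := by
  obtain ⟨z, hz, hzeq⟩ := domain_mvt (f := fun θ => (n : ℝ)⁻¹ * ∑ i, Real.log (1 + lam ⬝ᵥ G i θ))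
    (f' := fun θ => (n : ℝ)⁻¹ • ∑ i, (1 + lam ⬝ᵥ G i θ)⁻¹ •
      ∑ j, lam j • fderivWithin ℝ (fun t => G i t j) Θ θ) (s := Θ)
    (fun θ hθ => (HasFDerivWithinAt.fun_sum fun i _ => by
      refine HasFDerivWithinAt.log ?_ (hpos θ hθ i)
      exact (HasFDerivWithinAt.fun_sum fun j _ =>
        ((hG i j θ hθ).hasFDerivWithinAt).const_mul (lam j)).const_add 1).const_mul _) hconv ha hb
  refine ⟨z, hz, ?_⟩
  simp only [empMean]
  rw [hzeq]
  simp [fderivWithin_apply_eq_sum]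

end Segment

/-! ### The inner maximisation over the multipliers -/

lemma sub_two_sq_le_log {x : ℝ} (hx : |x| ≤ 1 / 8) : x - 2 * x ^ 2 ≤ Real.log (1 + x) := by
  obtain ⟨h1, h2⟩ := abs_le.1 hx
  rw [Real.le_log_iff_exp_le (by linarith)]
  have h3 : 0 < 1 - (x - 2 * x ^ 2) := by nlinarith
  have h4 : Real.exp (x - 2 * x ^ 2) ≤ (1 - (x - 2 * x ^ 2))⁻¹ := by
    have := Real.add_one_le_exp (-(x - 2 * x ^ 2))
    rw [← inv_inv (Real.exp _), ← Real.exp_neg]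
    exact inv_anti₀ h3 (by linarith)
  refine h4.trans ?_
  rw [inv_le_comm₀ h3 (by linarith), inv_le_iff_one_le_mul₀ (by linarith)]
  nlinarith [sq_nonneg x, mul_nonneg (sq_nonneg x) (by linarith : (0:ℝ) ≤ 1 + 2 * x)]

lemma log_le_sub_sq {x : ℝ} (hx : |x| ≤ 1 / 8) : Real.log (1 + x) ≤ x - x ^ 2 / 4 := by
  have h := Real.abs_log_sub_add_sum_range_le (x := -x) (by rw [abs_neg]; linarith) 2
  simp only [Finset.sum_range_succ, Finset.range_zero, Finset.sum_empty, abs_neg, sub_neg_eq_add]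
    at h
  have h0 := abs_nonneg x
  have h1 : |x| ^ (2 + 1) / (1 - |x|) ≤ x ^ 2 / 4 := by
    rw [div_le_iff₀ (by linarith), ← sq_abs x]
    nlinarith [sq_nonneg |x|, mul_nonneg (sq_nonneg |x|) (by linarith : 0 ≤ 1 / 8 - |x|)]
  have h2 := (abs_le.1 (h.trans h1)).2
  norm_num at h2
  linarith

/-- Concavity of the logarithm between `1` and `1 + y`. It lets a negative criterion on a sphere of
multipliers propagate outwards along rays. -/
lemma mul_log_le_log_mul {t y : ℝ} (ht0 : 0 ≤ t) (ht1 : t ≤ 1) (hy : -1 < y) :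
    t * Real.log (1 + y) ≤ Real.log (1 + t * y) := by
  have h := strictConcaveOn_log_Ioi.concaveOn.2 (x := 1 + y) (by simp; linarith) (y := (1 : ℝ))
    (by simp) ht0 (sub_nonneg.2 ht1) (by ring)
  simp only [smul_eq_mul, Real.log_one, mul_zero, add_zero, mul_one] at h
  rwa [show t * (1 + y) + (1 - t) = 1 + t * y by ring] at h

section Multiplier

variable {n r : ℕ} {G : Fin n → Fin r → ℝ} {c T R : ℝ} {V : Set ℝ}

lemma abs_dotProduct_le_of_l2_le (hT : ∀ i, l2 (G i) ≤ T) {lam : Fin r → ℝ} (hlam : l2 lam ≤ R)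
    (i : Fin n) : |lam ⬝ᵥ G i| ≤ R * T :=
  (abs_dotProduct_le _ _).trans
    (mul_le_mul hlam (hT i) (l2_nonneg _) ((l2_nonneg _).trans hlam))

lemma empMean_log_le (hT : ∀ i, l2 (G i) ≤ T) (hRT : R * T ≤ 1 / 8)
    (hlow : ∀ v : Fin r → ℝ, c⁻¹ * (v ⬝ᵥ v) ≤ empMean fun i => (v ⬝ᵥ G i) ^ 2)
    {lam : Fin r → ℝ} (hlam : l2 lam ≤ R) :
    empMean (fun i => Real.log (1 + lam ⬝ᵥ G i))
      ≤ l2 lam * l2 (fun j => empMean fun i => G i j) - c⁻¹ / 4 * l2 lam ^ 2 := by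
  calc empMean (fun i => Real.log (1 + lam ⬝ᵥ G i))
      ≤ empMean (fun i => lam ⬝ᵥ G i - (1 / 4) * (lam ⬝ᵥ G i) ^ 2) := empMean_mono fun i => by
        have := log_le_sub_sq ((abs_dotProduct_le_of_l2_le hT hlam i).trans hRT)
        linarith
    _ = lam ⬝ᵥ (fun j => empMean fun i => G i j)
        - (1 / 4) * empMean (fun i => (lam ⬝ᵥ G i) ^ 2) := by
        rw [empMean_sub, empMean_const_mul, dotProduct_empMean]
    _ ≤ _ := by
        have h1 := hlow lam
        have h2 := dotProduct_le_l2 lam (fun j => empMean fun i => G i j)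
        rw [l2_sq]
        linarith

lemma le_empMean_log (hT : ∀ i, l2 (G i) ≤ T) (hRT : R * T ≤ 1 / 8)
    (hup : ∀ v : Fin r → ℝ, empMean (fun i => (v ⬝ᵥ G i) ^ 2) ≤ c * (v ⬝ᵥ v))
    {lam : Fin r → ℝ} (hlam : l2 lam ≤ R) :
    lam ⬝ᵥ (fun j => empMean fun i => G i j) - 2 * c * l2 lam ^ 2
      ≤ empMean (fun i => Real.log (1 + lam ⬝ᵥ G i)) := by
  calc _ ≤ lam ⬝ᵥ (fun j => empMean fun i => G i j)
        - 2 * empMean (fun i => (lam ⬝ᵥ G i) ^ 2) := by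
        have h1 := hup lam
        rw [l2_sq]
        linarith
    _ = empMean (fun i => lam ⬝ᵥ G i - 2 * (lam ⬝ᵥ G i) ^ 2) := by
        rw [empMean_sub, empMean_const_mul, dotProduct_empMean]
    _ ≤ _ := empMean_mono fun i => by
        have := sub_two_sq_le_log ((abs_dotProduct_le_of_l2_le hT hlam i).trans hRT)
        linarith

/-- On the sphere of radius `R` the quadratic upper bound makes the objective negative, while it
vanishes at `0`; hence the maximiser over the ball is interior and, by concavity along rays,
dominates every admissible multiplier. The last clause is its stationarity equation with the
nonlinear remainder bounded. -/
lemma exists_multiplier (hc : 0 < c) (hT : ∀ i, l2 (G i) ≤ T) (hR : 0 < R)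
    (hT0 : 0 ≤ T) (hRT : R * T ≤ 1 / 8) (hV_log : ∀ v ∈ V, -1 < v)
    (hlow : ∀ v : Fin r → ℝ, c⁻¹ * (v ⬝ᵥ v) ≤ empMean fun i => (v ⬝ᵥ G i) ^ 2)
    (hup : ∀ v : Fin r → ℝ, empMean (fun i => (v ⬝ᵥ G i) ^ 2) ≤ c * (v ⬝ᵥ v))
    (hmean : l2 (fun j => empMean fun i => G i j) < R * (c⁻¹ / 4)) :
    ∃ lam : Fin r → ℝ, l2 lam < R ∧
      (∀ nu : Fin r → ℝ, (∀ i, nu ⬝ᵥ G i ∈ V) →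
        empMean (fun i => Real.log (1 + nu ⬝ᵥ G i))
          ≤ empMean (fun i => Real.log (1 + lam ⬝ᵥ G i))) ∧
      ∀ v : Fin r → ℝ, |empMean (fun i => (v ⬝ᵥ G i) * (lam ⬝ᵥ G i)) - empMean (fun i => v ⬝ᵥ G i)|
        ≤ 2 * c * T * l2 lam ^ 2 * l2 v := by
  set S : (Fin r → ℝ) → ℝ := fun lam => empMean fun i => Real.log (1 + lam ⬝ᵥ G i) with hS
  set B : Set (Fin r → ℝ) := {lam | l2 lam ≤ R} with hB
  have hS0 : S 0 = 0 := by simp [hS, empMean]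
  have hval : ∀ lam ∈ B, ∀ i, |lam ⬝ᵥ G i| ≤ 1 / 8 := fun lam hl i =>
    (abs_dotProduct_le_of_l2_le hT hl i).trans hRT
  have hBc : IsCompact B := by
    refine Metric.isCompact_of_isClosed_isBounded ?_ ?_
    · exact isClosed_le continuous_l2 continuous_const
    · refine Metric.isBounded_closedBall (x := (0 : Fin r → ℝ)) (r := R) |>.subset fun v hv => ?_
      rw [mem_closedBall_zero_iff]
      exact (norm_le_l2 v).trans hv
  have hScont : ContinuousOn S B := by
    simp only [hS, empMean]
    refine continuousOn_const.mul (continuousOn_finsetSum _ fun i _ => ?_)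
    refine ContinuousOn.log (by unfold dotProduct; fun_prop) fun lam hl => ?_
    have := (abs_le.1 (hval lam hl i)).1
    linarith
  have h0B : (0 : Fin r → ℝ) ∈ B := by simpa [hB, l2_zero] using hR.le
  obtain ⟨lam, hlamB, hmax⟩ := hBc.exists_isMaxOn ⟨0, h0B⟩ hScont
  have hsphere : ∀ nu : Fin r → ℝ, l2 nu = R → S nu < 0 := fun nu hnu => by
    have := empMean_log_le (G := G) hT hRT hlow hnu.le
    rw [hnu] at this
    have h2 : R * l2 (fun j => empMean fun i => G i j) < R * (R * (c⁻¹ / 4)) :=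
      mul_lt_mul_of_pos_left hmean hR
    calc S nu ≤ _ := this
      _ < 0 := by nlinarith
  have hlamR : l2 lam < R := by
    refine lt_of_le_of_ne hlamB fun h => ?_
    have := hsphere lam h
    have h2 : S 0 ≤ S lam := hmax h0B
    linarith
  refine ⟨lam, hlamR, fun nu hnu => ?_, fun v => ?_⟩
  · by_cases hnuB : l2 nu ≤ R
    · exact hmax hnuB
    · push Not at hnuB
      -- The multiplier is scaled back to the sphere; only `-1 < nu ⬝ᵥ G i` is needed here, not
      -- membership in the ball.
      set t := R / l2 nu with ht
      have hnu0 : 0 < l2 nu := hR.trans hnuB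
      have ht0 : 0 < t := by positivity
      have ht1 : t ≤ 1 := (div_le_one hnu0).2 hnuB.le
      have h1 : S (t • nu) < 0 := by
        apply hsphere
        rw [l2_smul, abs_of_pos ht0, ht]
        field_simp
      have h2 : t * S nu ≤ S (t • nu) := by
        simp only [hS]
        rw [← empMean_const_mul]
        refine empMean_mono fun i => ?_
        rw [smul_dotProduct, smul_eq_mul]
        exact mul_log_le_log_mul ht0.le ht1 (hV_log _ (hnu i))
      have h3 : S nu < 0 := by
        by_contra hcon
        push Not at hcon
        have := mul_nonneg ht0.le hcon
        linarith
      have h4 : S 0 ≤ S lam := hmax h0B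
      change S nu ≤ S lam
      linarith
  · have hpos : ∀ i, 0 < 1 + lam ⬝ᵥ G i := fun i => by
      have := (abs_le.1 (hval lam hlamB i)).1
      linarith
    have hderiv : HasDerivAt (fun t : ℝ => S (lam + t • v))
        (empMean fun i => (v ⬝ᵥ G i) / (1 + lam ⬝ᵥ G i)) 0 := by
      simp only [hS, empMean]
      refine HasDerivAt.const_mul _ (HasDerivAt.fun_sum fun i _ => ?_)
      have h1 : HasDerivAt (fun t : ℝ => 1 + (lam + t • v) ⬝ᵥ G i) (v ⬝ᵥ G i) 0 := by
        simp only [add_dotProduct, smul_dotProduct, smul_eq_mul]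
        have := (((hasDerivAt_id (0 : ℝ)).mul_const (v ⬝ᵥ G i)).const_add (lam ⬝ᵥ G i)).const_add 1
        simpa using this
      have h2 := h1.log (by simpa using (hpos i).ne')
      simpa using h2
    have hloc : IsLocalMax (fun t : ℝ => S (lam + t • v)) 0 := by
      have hopen : ∀ᶠ t : ℝ in 𝓝 0, l2 (lam + t • v) < R := by
        have hcont : Continuous fun t : ℝ => l2 (lam + t • v) :=
          continuous_l2.comp (by fun_prop)
        have := hcont.tendsto 0
        simp only [zero_smul, add_zero] at this
        exact this.eventually_lt_const hlamR
      filter_upwards [hopen] with t ht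
      simp only [zero_smul, add_zero]
      exact hmax (show l2 _ ≤ R from ht.le)
    have hzero := hloc.hasDerivAt_eq_zero hderiv
    set x : Fin n → ℝ := fun i => lam ⬝ᵥ G i with hx
    -- Subtracting the stationarity equation uses `x - 1 + 1 / (1 + x) = x² / (1 + x)`. One factor
    -- `|x|` is then bounded by `l2 lam * T`, the other kept for Cauchy–Schwarz.
    have hident : empMean (fun i => (v ⬝ᵥ G i) * x i) - empMean (fun i => v ⬝ᵥ G i)
        = empMean fun i => (v ⬝ᵥ G i) * (x i ^ 2 / (1 + x i)) := by
      have hzero' : empMean (fun i => (v ⬝ᵥ G i) / (1 + x i)) = 0 := hzero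
      rw [← add_zero (_ - _), ← hzero', ← empMean_sub, ← empMean_add]
      congr 1
      funext i
      have := (hpos i).ne'
      have hxi : 1 + x i ≠ 0 := this
      field_simp
      ring
    rw [hident]
    have hl0 := l2_nonneg lam
    have hT0 : 0 ≤ l2 lam * T := mul_nonneg hl0 hT0
    calc |empMean fun i => (v ⬝ᵥ G i) * (x i ^ 2 / (1 + x i))|
        ≤ empMean fun i => |(v ⬝ᵥ G i) * (x i ^ 2 / (1 + x i))| := abs_empMean_le _
      _ ≤ empMean fun i => 2 * (l2 lam * T) * (|v ⬝ᵥ G i| * |x i|) := empMean_mono fun i => by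
          rw [abs_mul, abs_div, abs_of_pos (hpos i), abs_of_nonneg (sq_nonneg (x i))]
          have h1 : |x i| ≤ l2 lam * T := abs_dotProduct_le_of_l2_le hT le_rfl i
          have h3 : (1 : ℝ) / 2 ≤ 1 + x i := by
            have := (abs_le.1 (hval lam hlamB i)).1
            change (1 : ℝ) / 2 ≤ 1 + lam ⬝ᵥ G i
            linarith
          have h2 : x i ^ 2 / (1 + x i) ≤ 2 * (l2 lam * T) * |x i| := by
            rw [div_le_iff₀ (by linarith), ← sq_abs (x i)]
            have := mul_le_mul_of_nonneg_right h1 (abs_nonneg (x i))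
            nlinarith [mul_nonneg hT0 (abs_nonneg (x i))]
          calc |v ⬝ᵥ G i| * (x i ^ 2 / (1 + x i)) ≤ |v ⬝ᵥ G i| * (2 * (l2 lam * T) * |x i|) :=
                mul_le_mul_of_nonneg_left h2 (abs_nonneg _)
            _ = _ := by ring
      _ = 2 * (l2 lam * T) * empMean fun i => |v ⬝ᵥ G i| * |x i| := empMean_const_mul _ _
      _ ≤ 2 * (l2 lam * T) * ((√c * l2 v) * (√c * l2 lam)) := by
          refine mul_le_mul_of_nonneg_left ?_ (by linarith)
          have hv0 := l2_nonneg v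
          refine empMean_abs_mul_le _ _ (by positivity) (by positivity) ?_ ?_
          · rw [mul_pow, Real.sq_sqrt hc.le, l2_sq]; exact hup v
          · rw [mul_pow, Real.sq_sqrt hc.le, l2_sq]; exact hup lam
      _ = 2 * (√c * √c) * T * l2 lam ^ 2 * l2 v := by ring
      _ = _ := by rw [Real.mul_self_sqrt hc.le]

end Multiplier

/-! ### Estimates on a regular sample -/

section Sample

variable {n p r : ℕ}

/-- Sample mean of the estimating functions. -/
def gbar (G : Fin n → (Fin p → ℝ) → Fin r → ℝ) (θ : Fin p → ℝ) : Fin r → ℝ :=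
  fun j => empMean fun i => G i θ j

/-- Sample mean of the gradients of the estimating functions. -/
def gradBar (Θ : Set (Fin p → ℝ)) (G : Fin n → (Fin p → ℝ) → Fin r → ℝ) (θ : Fin p → ℝ) :
    Matrix (Fin r) (Fin p) ℝ :=
  Matrix.of fun j k => empMean fun i => pderivOn Θ (fun t => G i t j) k θ

lemma dotProduct_gradBar {Θ : Set (Fin p → ℝ)} {G : Fin n → (Fin p → ℝ) → Fin r → ℝ} (lam : Fin r → ℝ) (u : Fin p → ℝ) (z : Fin p → ℝ) :
    empMean (fun i => ∑ j, lam j * ∑ k, u k * pderivOn Θ (fun t => G i t j) k z)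
      = lam ⬝ᵥ (gradBar Θ G z *ᵥ u) := by
  simp only [empMean_sum, empMean_const_mul, dotProduct, mulVec, gradBar, Matrix.of_apply]
  simp only [mul_comm]

/-- Uniform bounds on the realised estimating functions: `M` for the second moments of first and
second derivatives, `c` and `c⁻¹` for the eigenvalues of the second moment matrix, `T` for the
Euclidean norms. -/
structure RegularSample (Θ : Set (Fin p → ℝ)) (G : Fin n → (Fin p → ℝ) → Fin r → ℝ)
    (M c T : ℝ) : Prop where
  pos : 0 < n
  convex : Convex ℝ Θ
  uniqueDiff : UniqueDiffOn ℝ Θ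
  smooth : ∀ i j, ContDiffOn ℝ 2 (fun θ => G i θ j) Θ
  M_nonneg : 0 ≤ M
  one_le_c : 1 ≤ c
  T_nonneg : 0 ≤ T
  grad : ∀ θ ∈ Θ, ∀ j k, empMean (fun i => pderivOn Θ (fun t => G i t j) k θ ^ 2) ≤ M
  hess : ∀ θ ∈ Θ, ∀ j k l,
    empMean (fun i => pderivOn Θ (fun s => pderivOn Θ (fun t => G i t j) k s) l θ ^ 2) ≤ M
  low : ∀ θ ∈ Θ, ∀ v : Fin r → ℝ, c⁻¹ * (v ⬝ᵥ v) ≤ empMean fun i => (v ⬝ᵥ G i θ) ^ 2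
  up : ∀ θ ∈ Θ, ∀ v : Fin r → ℝ, empMean (fun i => (v ⬝ᵥ G i θ) ^ 2) ≤ c * (v ⬝ᵥ v)
  bound : ∀ θ ∈ Θ, ∀ i, l2 (G i θ) ≤ T

namespace RegularSample

variable {Θ : Set (Fin p → ℝ)} {G : Fin n → (Fin p → ℝ) → Fin r → ℝ} {M c T : ℝ}
  (H : RegularSample Θ G M c T)
include H

lemma c_pos : 0 < c := lt_of_lt_of_le one_pos H.one_le_c

lemma differentiableOn (i : Fin n) (j : Fin r) : DifferentiableOn ℝ (fun θ => G i θ j) Θ :=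
  (H.smooth i j).differentiableOn (by norm_num)

variable {a b : Fin p → ℝ}

lemma l2_gbar_sub_le (ha : a ∈ Θ) (hb : b ∈ Θ) :
    l2 (gbar G b - gbar G a) ≤ √r * (√M * l1 (b - a)) :=
  l2_le_sqrt_mul (mul_nonneg (Real.sqrt_nonneg _) (l1_nonneg _)) fun j =>
    abs_empMean_sub_le (f := fun i θ => G i θ j) H.convex (fun i => H.differentiableOn i j)
      H.M_nonneg (fun θ hθ k => H.grad θ hθ j k) ha hb

lemma l2_gbar_taylor_le (ha : a ∈ Θ) (hb : b ∈ Θ) :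
    l2 (gbar G b - gbar G a - gradBar Θ G a *ᵥ (b - a)) ≤ √r * (√M * l1 (b - a) ^ 2) :=
  l2_le_sqrt_mul (mul_nonneg (Real.sqrt_nonneg _) (sq_nonneg _)) fun j => by
    have := abs_empMean_taylor_le (f := fun i θ => G i θ j) H.convex H.uniqueDiff
      (fun i => H.smooth i j) H.M_nonneg (fun θ hθ k l => H.hess θ hθ j k l) ha hb
    convert this using 3
    simp [gbar, mulVec, dotProduct, gradBar, mul_comm]

lemma abs_gradBar_sub_le (ha : a ∈ Θ) (hb : b ∈ Θ) (x : Fin r → ℝ) (y : Fin p → ℝ) :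
    |x ⬝ᵥ (gradBar Θ G b *ᵥ y) - x ⬝ᵥ (gradBar Θ G a *ᵥ y)|
      ≤ √M * l1 (b - a) * l1 x * l1 y := by
  rw [← dotProduct_sub, ← sub_mulVec]
  have hent : ∀ j k, |(gradBar Θ G b - gradBar Θ G a) j k| ≤ √M * l1 (b - a) := fun j k =>
    abs_empMean_sub_le (f := fun i θ => pderivOn Θ (fun t => G i t j) k θ) H.convex
      (fun i => (ContDiffOn.pderivOn H.uniqueDiff (H.smooth i j) k).differentiableOn (by norm_num))
      H.M_nonneg (fun θ hθ l => H.hess θ hθ j k l) ha hb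
  calc _ ≤ ∑ j, |x j * ∑ k, (gradBar Θ G b - gradBar Θ G a) j k * y k| :=
        Finset.abs_sum_le_sum_abs _ _
    _ ≤ ∑ j, |x j| * (√M * l1 (b - a) * l1 y) := Finset.sum_le_sum fun j _ => by
        rw [abs_mul]
        refine mul_le_mul_of_nonneg_left ?_ (abs_nonneg _)
        refine (Finset.abs_sum_le_sum_abs _ _).trans ?_
        rw [l1, l1, Finset.mul_sum]
        exact Finset.sum_le_sum fun k _ => by
          rw [abs_mul]; exact mul_le_mul_of_nonneg_right (hent j k) (abs_nonneg _)
    _ = _ := by rw [← Finset.sum_mul, ← l1]; ring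

lemma empMean_sq_dotProduct_sub_le (ha : a ∈ Θ) (hb : b ∈ Θ) (w : Fin r → ℝ) :
    empMean (fun i => (w ⬝ᵥ G i b - w ⬝ᵥ G i a) ^ 2) ≤ (l2 w * (√(r * M) * l1 (b - a))) ^ 2 := by
  calc empMean (fun i => (w ⬝ᵥ G i b - w ⬝ᵥ G i a) ^ 2)
      ≤ empMean (fun i => l2 w ^ 2 * ∑ j, (G i b j - G i a j) ^ 2) := empMean_mono fun i => by
        rw [← dotProduct_sub, l2_sq]
        have := Finset.sum_mul_sq_le_sq_mul_sq Finset.univ w (G i b - G i a)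
        simpa [dotProduct, sq] using this
    _ = l2 w ^ 2 * ∑ j, empMean (fun i => (G i b j - G i a j) ^ 2) := by
        rw [empMean_const_mul, empMean_sum]
    _ ≤ l2 w ^ 2 * ∑ _j : Fin r, M * l1 (b - a) ^ 2 := by
        refine mul_le_mul_of_nonneg_left (Finset.sum_le_sum fun j _ => ?_) (sq_nonneg _)
        exact empMean_sq_sub_le (f := fun i θ => G i θ j) H.convex
          (fun i => H.differentiableOn i j) (fun θ hθ k => H.grad θ hθ j k) ha hb
    _ = _ := by
        have := H.M_nonneg
        rw [mul_pow, mul_pow, Real.sq_sqrt (by positivity), Finset.sum_const, Finset.card_univ,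
          Fintype.card_fin, nsmul_eq_mul]
        ring

lemma empMean_sq_dotProduct_le (ha : a ∈ Θ) (w : Fin r → ℝ) :
    empMean (fun i => (w ⬝ᵥ G i a) ^ 2) ≤ (√c * l2 w) ^ 2 := by
  rw [mul_pow, Real.sq_sqrt H.c_pos.le, l2_sq]
  exact H.up a ha w

lemma abs_secondMoment_sub_le (ha : a ∈ Θ) (hb : b ∈ Θ) (w lam : Fin r → ℝ) :
    |empMean (fun i => (w ⬝ᵥ G i b) * (lam ⬝ᵥ G i b))
      - empMean (fun i => (w ⬝ᵥ G i a) * (lam ⬝ᵥ G i a))|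
      ≤ 2 * √c * √(r * M) * l1 (b - a) * l2 w * l2 lam := by
  have e : empMean (fun i => (w ⬝ᵥ G i b) * (lam ⬝ᵥ G i b))
      - empMean (fun i => (w ⬝ᵥ G i a) * (lam ⬝ᵥ G i a))
      = empMean (fun i => (w ⬝ᵥ G i b - w ⬝ᵥ G i a) * (lam ⬝ᵥ G i b))
        + empMean (fun i => (w ⬝ᵥ G i a) * (lam ⬝ᵥ G i b - lam ⬝ᵥ G i a)) := by
    rw [← empMean_sub, ← empMean_add]
    congr 1; funext i; ring
  have hw := l2_nonneg w
  have hl := l2_nonneg lam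
  have hd := l1_nonneg (b - a)
  rw [e]
  refine (abs_add_le _ _).trans ?_
  have h1 := abs_empMean_mul_le _ _ (by positivity) (by positivity)
    (H.empMean_sq_dotProduct_sub_le ha hb w) (H.empMean_sq_dotProduct_le hb lam)
  have h2 := abs_empMean_mul_le _ _ (by positivity) (by positivity)
    (H.empMean_sq_dotProduct_le ha w) (H.empMean_sq_dotProduct_sub_le ha hb lam)
  refine (add_le_add h1 h2).trans (le_of_eq ?_)
  ring

/-- Replacing the weight `(1 + x)⁻¹` by `1` costs at most `2|x|` relative to the summand, and `x` is
linear in the multiplier, so the cost is quadratic in `lam`. -/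
lemma empMean_weighted_gradient_le (hz : a ∈ Θ) {R : ℝ} (hRT : R * T ≤ 1 / 8)
    (lam : Fin r → ℝ) (hlam : l2 lam ≤ R) (u : Fin p → ℝ) :
    empMean (fun i => (1 + lam ⬝ᵥ G i a)⁻¹ *
        ∑ j, lam j * ∑ k, u k * pderivOn Θ (fun t => G i t j) k a)
      ≤ lam ⬝ᵥ (gradBar Θ G a *ᵥ u) + 2 * (√M * l1 lam * l1 u * (√c * l2 lam)) := by
  set y : Fin n → ℝ := fun i => ∑ j, lam j * ∑ k, u k * pderivOn Θ (fun t => G i t j) k a with hy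
  set x : Fin n → ℝ := fun i => lam ⬝ᵥ G i a with hx
  have hxb : ∀ i, |x i| ≤ 1 / 8 := fun i =>
    (abs_dotProduct_le_of_l2_le (H.bound a hz) hlam i).trans hRT
  rw [← dotProduct_gradBar lam u a]
  have hy2 : empMean (fun i => y i ^ 2) ≤ (√M * l1 lam * l1 u) ^ 2 := by
    refine (empMean_sum_mul_sq_le lam (fun j i => ∑ k, u k * pderivOn Θ (fun t => G i t j) k a)
      (M := M * l1 u ^ 2) fun j => ?_).trans (le_of_eq ?_)
    · exact empMean_sum_mul_sq_le u _ fun k => H.grad a hz j k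
    · rw [mul_pow, mul_pow, Real.sq_sqrt H.M_nonneg]; ring
  have hu := l1_nonneg u
  have hl := l1_nonneg lam
  have hl2 := l2_nonneg lam
  have h1 := empMean_abs_mul_le y x (by positivity) (by positivity) hy2
    (H.empMean_sq_dotProduct_le hz lam)
  calc empMean (fun i => (1 + x i)⁻¹ * y i)
      ≤ empMean (fun i => y i + 2 * (|y i| * |x i|)) := empMean_mono fun i => by
        have h2 := abs_le.1 (hxb i)
        have h3 : 0 < 1 + x i := by linarith [h2.1]
        have h4 : (1 + x i)⁻¹ * y i - y i = - (y i * x i) * (1 + x i)⁻¹ := by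
          field_simp; ring
        have h5 : (1 + x i)⁻¹ ≤ 2 := by
          rw [inv_le_comm₀ h3 (by norm_num)]; linarith [h2.1]
        have h6 : - (y i * x i) ≤ |y i| * |x i| := by
          rw [← abs_mul]; exact neg_le_abs _
        have h7 : - (y i * x i) * (1 + x i)⁻¹ ≤ (|y i| * |x i|) * 2 :=
          mul_le_mul h6 h5 (inv_nonneg.2 h3.le) (by positivity)
        linarith
    _ = empMean y + 2 * empMean (fun i => |y i| * |x i|) := by
        rw [empMean_add, empMean_const_mul]
    _ ≤ _ := by linarith

end RegularSample

/-- The criterion at `θhat` is bounded by any bound on the criterion at another point of `Θ`. -/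
def MinimisesCriterion (V : Set ℝ) (Θ : Set (Fin p → ℝ)) (G : Fin n → (Fin p → ℝ) → Fin r → ℝ)
    (θhat : Fin p → ℝ) : Prop :=
  ∀ θ ∈ Θ, ∀ B : ℝ,
    (∀ nu : Fin r → ℝ, (∀ i, nu ⬝ᵥ G i θ ∈ V) →
      empMean (fun i => Real.log (1 + nu ⬝ᵥ G i θ)) ≤ B) →
    ∀ lam : Fin r → ℝ, (∀ i, lam ⬝ᵥ G i θhat ∈ V) →
      empMean (fun i => Real.log (1 + lam ⬝ᵥ G i θhat)) ≤ B

lemma IsELEstimate.minimisesCriterion {𝒳 : Type*} {V : Set ℝ} {Θ : Set (Fin p → ℝ)}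
    {g : 𝒳 → (Fin p → ℝ) → Fin r → ℝ} {x : Fin n → 𝒳} {θhat : Fin p → ℝ} (hn : 0 < n)
    (h : IsELEstimate V Θ g x θhat) :
    MinimisesCriterion V Θ (fun i θ => g (x i) θ) θhat := by
  intro θ hθ B hB lam hlam
  have hn' : (0 : ℝ) < n := by exact_mod_cast hn
  have h1 : criterion V g x θ ≤ ((n * B : ℝ) : EReal) := by
    refine iSup₂_le fun nu hnu => ?_
    rw [EReal.coe_le_coe_iff]
    have := hB nu hnu
    rwa [empMean, inv_mul_le_iff₀ hn'] at this
  have h2 : ((∑ i, Real.log (1 + lam ⬝ᵥ g (x i) θhat) : ℝ) : EReal) ≤ criterion V g x θhat :=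
    le_iSup₂ (f := fun (lam : Fin r → ℝ) (_ : lam ∈ multipliers V g x θhat) =>
      ((∑ i, Real.log (1 + lam ⬝ᵥ g (x i) θhat) : ℝ) : EReal)) lam hlam
  have h3 := h2.trans ((h.2 hθ).trans h1)
  rw [EReal.coe_le_coe_iff] at h3
  rwa [empMean, inv_mul_le_iff₀ hn']

variable {Θ : Set (Fin p → ℝ)} {G : Fin n → (Fin p → ℝ) → Fin r → ℝ} {M c T : ℝ} {V : Set ℝ}
  {θ₀ θhat : Fin p → ℝ} {s δ : ℝ}

lemma mem_of_abs_le (hVδ : ∀ x, |x| ≤ δ → x ∈ V) {R : ℝ} (hRδ : R * T ≤ δ)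
    {H : Fin n → Fin r → ℝ} (hT : ∀ i, l2 (H i) ≤ T) {lam : Fin r → ℝ} (hlam : l2 lam ≤ R)
    (i : Fin n) : lam ⬝ᵥ H i ∈ V :=
  hVδ _ ((abs_dotProduct_le_of_l2_le hT hlam i).trans hRδ)

/-- The criterion at `θ₀` is of order `s²`. If `ḡ(θhat)` had length `L`, a multiplier of length `s`
pointing along it would give at least `sL - 2cs²`; minimality forces `L = O(s)`. -/
lemma RegularSample.l2_gbar_le_of_minimises (H : RegularSample Θ G M c T)
    (hVδ : ∀ x, |x| ≤ δ → x ∈ V) (hδ8 : δ ≤ 1 / 8) (hV_log : ∀ v ∈ V, -1 < v)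
    (hmin : MinimisesCriterion V Θ G θhat) (hθ₀ : θ₀ ∈ Θ) (hθhat : θhat ∈ Θ)
    (hs : 0 < s) (hsT : 5 * c * s * T ≤ δ) (hmean : l2 (gbar G θ₀) ≤ s) :
    l2 (gbar G θhat) ≤ 7 * c * s := by
  have hc := H.c_pos
  have hT := H.T_nonneg
  have hR8 : 5 * c * s * T ≤ 1 / 8 := hsT.trans hδ8
  -- With radius `5cs` the threshold `R * (c⁻¹ / 4)` is `5s/4`, strictly above the bound `s` on the
  -- mean.
  obtain ⟨lam, hlam, hlmax, -⟩ := exists_multiplier (G := fun i => G i θ₀) (R := 5 * c * s)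
    hc (H.bound θ₀ hθ₀) (by positivity) H.T_nonneg hR8 hV_log (H.low θ₀ hθ₀) (H.up θ₀ hθ₀) (by
      refine lt_of_le_of_lt hmean ?_
      have : 5 * c * s * (c⁻¹ / 4) = 5 / 4 * s := by field_simp
      rw [this]; linarith)
  have hB : empMean (fun i => Real.log (1 + lam ⬝ᵥ G i θ₀)) ≤ 5 * c * s * s := by
    refine (empMean_log_le (H.bound θ₀ hθ₀) hR8 (H.low θ₀ hθ₀) hlam.le).trans ?_
    have h1 : l2 lam * l2 (gbar G θ₀) ≤ 5 * c * s * s :=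
      mul_le_mul hlam.le hmean (l2_nonneg _) (by positivity)
    have h2 : 0 ≤ c⁻¹ / 4 * l2 lam ^ 2 := by positivity
    change l2 lam * l2 (gbar G θ₀) - _ ≤ _
    linarith
  rcases eq_or_lt_of_le (l2_nonneg (gbar G θhat)) with h0 | h0
  · rw [← h0]; positivity
  set nu : Fin r → ℝ := (s / l2 (gbar G θhat)) • gbar G θhat with hnu
  have hnu2 : l2 nu = s := by
    rw [hnu, l2_smul, abs_of_pos (by positivity)]; field_simp
  have hsR : s ≤ 5 * c * s := by nlinarith [H.one_le_c]
  have h3 := hmin θ₀ hθ₀ _ (fun mu hmu => (hlmax mu hmu).trans hB) nu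
    (mem_of_abs_le hVδ hsT (H.bound θhat hθhat) (hnu2.le.trans hsR))
  have h4 := le_empMean_log (H.bound θhat hθhat) hR8 (H.up θhat hθhat) (hnu2.le.trans hsR)
  have h5 : nu ⬝ᵥ gbar G θhat = s * l2 (gbar G θhat) := by
    rw [hnu, smul_dotProduct, ← l2_sq, smul_eq_mul]; field_simp
  rw [hnu2] at h4
  change nu ⬝ᵥ gbar G θhat - _ ≤ _ at h4
  rw [h5] at h4
  have h6 : s * l2 (gbar G θhat) ≤ s * (7 * c * s) := by nlinarith
  exact le_of_mul_le_mul_left h6 hs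

/-- Approximate first-order condition of the estimator in the direction `u`. -/
lemma RegularSample.first_order_le (H : RegularSample Θ G M c T)
    (hVδ : ∀ x, |x| ≤ δ → x ∈ V) (hδ8 : δ ≤ 1 / 8) (hV_log : ∀ v ∈ V, -1 < v)
    (hmin : MinimisesCriterion V Θ G θhat) (hθ₀ : θ₀ ∈ Θ) (hθhat : θhat ∈ Θ)
    (hs : 0 < s) (hsT : 5 * c * s * T ≤ δ) {u : Fin p → ℝ} {τ : ℝ} (hτ : 0 < τ)
    (hb : θhat + τ • u ∈ Θ) (hmean : l2 (gbar G (θhat + τ • u)) ≤ s)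
    {Gm : Matrix (Fin r) (Fin p) ℝ} {Vm : Matrix (Fin r) (Fin r) ℝ} (hVm : Vmᵀ = Vm)
    {w : Fin r → ℝ} (hw : Vm *ᵥ w = Gm *ᵥ u) {κ ν D U W : ℝ} (hκ0 : 0 ≤ κ) (hν0 : 0 ≤ ν)
    (hκ : ∑ j, ∑ k, (gradBar Θ G θ₀ - Gm) j k ^ 2 ≤ κ ^ 2)
    (hν : ∑ j, ∑ k, ((Matrix.of fun j k => empMean fun i => G i θ₀ j * G i θ₀ k) - Vm) j k ^ 2
      ≤ ν ^ 2)
    (hU : l2 u ≤ U) (hW : l2 w ≤ W) (hD : l2 (θhat - θ₀) + τ * U ≤ D) :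
    0 ≤ w ⬝ᵥ gbar G θ₀ + w ⬝ᵥ (Gm *ᵥ (θhat - θ₀)) +
      (2 * (√M * (√r * (5 * c * s)) * (√p * U) * (√c * (5 * c * s)))
        + √M * (√p * D) * (√r * (5 * c * s)) * (√p * U)
        + 5 * c * s * κ * U + W * ν * (5 * c * s)
        + 2 * √c * √(r * M) * (√p * D) * W * (5 * c * s)
        + 2 * c * T * (5 * c * s) ^ 2 * W
        + W * (√r * (√M * (τ * (√p * U))))
        + W * (√r * (√M * (√p * D) ^ 2)) + W * κ * D) := by
  have hc := H.c_pos
  have hT := H.T_nonneg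
  have hR8 : 5 * c * s * T ≤ 1 / 8 := hsT.trans hδ8
  set b := θhat + τ • u with hbdef
  -- The multiplier is optimal at the perturbed point `b`, not at `θhat`: for it the objective at
  -- `b` is the criterion's upper bound, whereas at `θhat` it is merely one admissible value.
  obtain ⟨lam, hlam, hlmax, hfoc⟩ := exists_multiplier (G := fun i => G i b) (R := 5 * c * s)
    hc (H.bound b hb) (by positivity) H.T_nonneg hR8 hV_log (H.low b hb) (H.up b hb) (by
      refine lt_of_le_of_lt hmean ?_
      have : 5 * c * s * (c⁻¹ / 4) = 5 / 4 * s := by field_simp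
      rw [this]; linarith)
  set R := 5 * c * s with hR
  have hR0 : 0 ≤ R := by positivity
  have hU0 : 0 ≤ U := (l2_nonneg u).trans hU
  have hW0 : 0 ≤ W := (l2_nonneg w).trans hW
  have hD0 : 0 ≤ D := by
    have := l2_nonneg (θhat - θ₀)
    have : 0 ≤ τ * U := by positivity
    linarith
  have hΔD : l2 (θhat - θ₀) ≤ D := by
    have : 0 ≤ τ * U := by positivity
    linarith
  have hl0 := l2_nonneg lam
  have hlR := hlam.le
  have hl1 : l1 lam ≤ √r * R :=
    (l1_le_sqrt_mul_l2 lam).trans (mul_le_mul_of_nonneg_left hlR (Real.sqrt_nonneg _))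
  have hu1 : l1 u ≤ √p * U :=
    (l1_le_sqrt_mul_l2 u).trans (mul_le_mul_of_nonneg_left hU (Real.sqrt_nonneg _))
  have hl10 := l1_nonneg lam
  have hu10 := l1_nonneg u
  have hba : b - θhat = τ • u := by rw [hbdef]; abel
  have hba1 : l1 (b - θhat) ≤ τ * (√p * U) := by
    rw [hba, l1_smul, abs_of_pos hτ]
    exact mul_le_mul_of_nonneg_left hu1 hτ.le
  have hΔ1 : l1 (θhat - θ₀) ≤ √p * l2 (θhat - θ₀) := l1_le_sqrt_mul_l2 _
  have hpD : √p * l2 (θhat - θ₀) + τ * (√p * U) ≤ √p * D := by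
    have := mul_le_mul_of_nonneg_left hD (Real.sqrt_nonneg (p : ℝ))
    linarith
  have hseg : ∀ z ∈ segment ℝ θhat b, l1 (z - θ₀) ≤ √p * D := fun z hz => by
    have h1 : z - θ₀ = (z - θhat) + (θhat - θ₀) := by abel
    rw [h1]
    have h2 := l1_add_le (z - θhat) (θhat - θ₀)
    have h3 := l1_sub_le_of_mem_segment hz
    linarith
  -- the mean value inequality
  have hS : empMean (fun i => Real.log (1 + lam ⬝ᵥ G i θhat))
      ≤ empMean (fun i => Real.log (1 + lam ⬝ᵥ G i b)) :=
    hmin b hb _ hlmax lam (mem_of_abs_le hVδ hsT (H.bound θhat hθhat) hlR)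
  have hpos : ∀ θ ∈ Θ, ∀ i, 1 + lam ⬝ᵥ G i θ ≠ 0 := fun θ hθ i => by
    have := (abs_le.1 ((abs_dotProduct_le_of_l2_le (H.bound θ hθ) hlR i).trans hR8)).1
    exact ne_of_gt (by linarith)
  obtain ⟨z, hz, hzeq⟩ := exists_log_mean_value H.convex H.differentiableOn lam hpos hθhat hb
  have hzΘ : z ∈ Θ := H.convex.segment_subset hθhat hb hz
  have hgr0 : 0 ≤ empMean (fun i => (1 + lam ⬝ᵥ G i z)⁻¹ *
        ∑ j, lam j * ∑ k, u k * pderivOn Θ (fun t => G i t j) k z) := by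
    have h1 : empMean (fun i => (1 + lam ⬝ᵥ G i z)⁻¹ *
        ∑ j, lam j * ∑ k, (b - θhat) k * pderivOn Θ (fun t => G i t j) k z)
        = τ * empMean (fun i => (1 + lam ⬝ᵥ G i z)⁻¹ *
        ∑ j, lam j * ∑ k, u k * pderivOn Θ (fun t => G i t j) k z) := by
      rw [← empMean_const_mul, hba]
      congr 1; funext i
      simp only [Pi.smul_apply, smul_eq_mul, Finset.mul_sum]
      refine Finset.sum_congr rfl fun j _ => Finset.sum_congr rfl fun k _ => by ring
    have h2 : 0 ≤ τ * empMean (fun i => (1 + lam ⬝ᵥ G i z)⁻¹ *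
        ∑ j, lam j * ∑ k, u k * pderivOn Θ (fun t => G i t j) k z) := by
      rw [← h1, ← hzeq]; linarith
    exact nonneg_of_mul_nonneg_right h2 hτ
  -- The estimates `e1` to `e10` form a chain from the weighted gradient to the linear form. Weights
  -- become one; the gradient moves from `z` to `θ₀` and then to `Gm`; `e4` is the exact identity
  -- `λᵀGu = wᵀVλ`; `Vm` is replaced by sample second moments at `θ₀`, then at `b`; stationarity
  -- produces `wᵀḡ(b)`, which moves to `θhat` and is expanded at `θ₀`. The primed versions insert
  -- the size bounds.
  have e1 := H.empMean_weighted_gradient_le hzΘ hR8 lam hlR u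
  have e1' : 2 * (√M * l1 lam * l1 u * (√c * l2 lam))
      ≤ 2 * (√M * (√r * R) * (√p * U) * (√c * R)) := by gcongr
  have e2 := (abs_le.1 (H.abs_gradBar_sub_le hθ₀ hzΘ lam u)).2
  have e2' : √M * l1 (z - θ₀) * l1 lam * l1 u ≤ √M * (√p * D) * (√r * R) * (√p * U) := by
    have := hseg z hz
    have := l1_nonneg (z - θ₀)
    gcongr
  have e3 := (abs_le.1 (abs_dotProduct_mulVec_le (gradBar Θ G θ₀ - Gm) hκ0 hκ lam u)).2
  have e3' : l2 lam * κ * l2 u ≤ R * κ * U := by have := l2_nonneg u; gcongr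
  rw [sub_mulVec, dotProduct_sub] at e3
  have e4 : lam ⬝ᵥ (Gm *ᵥ u) = w ⬝ᵥ (Vm *ᵥ lam) := by
    rw [← hw, dotProduct_mulVec, ← mulVec_transpose, hVm, dotProduct_comm]
  have e5 := (abs_le.1 (abs_dotProduct_mulVec_le _ hν0 hν w lam)).1
  have e5' : l2 w * ν * l2 lam ≤ W * ν * R := by have := l2_nonneg w; gcongr
  rw [sub_mulVec, dotProduct_sub] at e5
  have hVhat : w ⬝ᵥ ((Matrix.of fun j k => empMean fun i => G i θ₀ j * G i θ₀ k) *ᵥ lam)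
      = empMean fun i => (w ⬝ᵥ G i θ₀) * (lam ⬝ᵥ G i θ₀) := by
    have : ∀ i, (w ⬝ᵥ G i θ₀) * (lam ⬝ᵥ G i θ₀)
        = ∑ j, w j * ∑ k, lam k * (G i θ₀ j * G i θ₀ k) := fun i => by
      simp only [dotProduct]
      rw [Finset.sum_mul_sum]
      simp only [Finset.mul_sum]
      refine Finset.sum_congr rfl fun j _ => Finset.sum_congr rfl fun k _ => by ring
    simp only [this, empMean_sum, empMean_const_mul]
    simp only [dotProduct, mulVec, Matrix.of_apply, mul_comm]
  rw [hVhat] at e5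
  have e6 := (abs_le.1 (H.abs_secondMoment_sub_le hθ₀ hb w lam)).1
  have hb1 : l1 (b - θ₀) ≤ √p * D := hseg b (right_mem_segment ℝ θhat b)
  have e6' : 2 * √c * √(r * M) * l1 (b - θ₀) * l2 w * l2 lam
      ≤ 2 * √c * √(r * M) * (√p * D) * W * R := by
    have := l2_nonneg w
    have := l1_nonneg (b - θ₀)
    gcongr
  have e7 := (abs_le.1 (hfoc w)).2
  have e7' : 2 * c * T * l2 lam ^ 2 * l2 w ≤ 2 * c * T * R ^ 2 * W := by
    have := l2_nonneg w; gcongr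
  rw [← dotProduct_empMean] at e7
  have e8 : w ⬝ᵥ (gbar G b - gbar G θhat) ≤ W * (√r * (√M * (τ * (√p * U)))) := by
    refine (dotProduct_le_l2 _ _).trans (mul_le_mul hW ?_ (l2_nonneg _) hW0)
    exact (H.l2_gbar_sub_le hθhat hb).trans (by gcongr)
  rw [dotProduct_sub] at e8
  have e9 : w ⬝ᵥ (gbar G θhat - gbar G θ₀ - gradBar Θ G θ₀ *ᵥ (θhat - θ₀))
      ≤ W * (√r * (√M * (√p * D) ^ 2)) := by
    refine (dotProduct_le_l2 _ _).trans (mul_le_mul hW ?_ (l2_nonneg _) hW0)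
    refine (H.l2_gbar_taylor_le hθ₀ hθhat).trans ?_
    have : l1 (θhat - θ₀) ≤ √p * D :=
      hΔ1.trans (mul_le_mul_of_nonneg_left hΔD (Real.sqrt_nonneg _))
    have := l1_nonneg (θhat - θ₀)
    gcongr
  rw [dotProduct_sub, dotProduct_sub] at e9
  have e10 := (abs_le.1 (abs_dotProduct_mulVec_le (gradBar Θ G θ₀ - Gm) hκ0 hκ w (θhat - θ₀))).2
  have e10' : l2 w * κ * l2 (θhat - θ₀) ≤ W * κ * D := by
    have := l2_nonneg w
    have := l2_nonneg (θhat - θ₀)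
    gcongr
  rw [sub_mulVec, dotProduct_sub] at e10
  change _ - w ⬝ᵥ gbar G b ≤ _ at e7
  linarith

end Sample

/-! ### Rates -/

section Rates

/-- Bookkeeping with `ρ = √r`, `π = √p`, `q = √n`, `a = √(r/n)`. Most terms are quadratic in `a`, so
`q * a = ρ` leaves one power of `a`; the step term has `τ = a / q`, which absorbs `q`. The
multiplier remainder alone carries `T` and gives `T * ρ * a`; everything else is dominated by `ρ² *
π² * a`. -/
lemma first_order_error_le {M c A B D₀ U W T : ℝ} {ρ π a q : ℝ} {rr pp : ℝ} (hc : 0 ≤ c)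
    (hA : 0 ≤ A) (hB : 0 ≤ B) (hD₀ : 0 ≤ D₀) (hU : 0 ≤ U) (hW : 0 ≤ W) (hT : 0 ≤ T)
    (hρ : 1 ≤ ρ) (hπ : 1 ≤ π) (ha : 0 ≤ a) (hq : 0 < q) (haq : q * a = ρ)
    (hrr : √rr = ρ) (hrr0 : 0 ≤ rr) (hpp : √pp = π) :
    q * (2 * (√M * (√rr * (5 * c * (B * a))) * (√pp * U) * (√c * (5 * c * (B * a))))
        + √M * (√pp * (D₀ * a)) * (√rr * (5 * c * (B * a))) * (√pp * U)
        + 5 * c * (B * a) * (A * (π * a)) * U + W * (A * (ρ * a)) * (5 * c * (B * a))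
        + 2 * √c * √(rr * M) * (√pp * (D₀ * a)) * W * (5 * c * (B * a))
        + 2 * c * T * (5 * c * (B * a)) ^ 2 * W
        + W * (√rr * (√M * (a / q * (√pp * U))))
        + W * (√rr * (√M * (√pp * (D₀ * a)) ^ 2)) + W * (A * (π * a)) * (D₀ * a))
      ≤ (50 * √M * c ^ 2 * B ^ 2 * U * √c + 5 * √M * D₀ * c * B * U + 5 * c * B * A * U
          + 5 * W * A * c * B + 10 * √c * √M * D₀ * W * c * B + 50 * c ^ 3 * B ^ 2 * W
          + W * √M * U + W * √M * D₀ ^ 2 + W * A * D₀) * (T * ρ * a + ρ ^ 2 * π ^ 2 * a) := by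
  rw [Real.sqrt_mul hrr0, hrr, hpp]
  have hM' := Real.sqrt_nonneg M
  have hc' := Real.sqrt_nonneg c
  have hρ0 : 0 ≤ ρ := by linarith
  have hπ0 : 0 ≤ π := by linarith
  have hρ1 : 1 ≤ ρ := hρ
  have hρ2 : ρ ≤ ρ ^ 2 := by nlinarith
  have hπ2 : π ≤ π ^ 2 := by nlinarith
  have hπ3 : 1 ≤ π ^ 2 := hπ.trans hπ2
  have hTρ : 0 ≤ T * ρ * a := by positivity
  set E := T * ρ * a + ρ ^ 2 * π ^ 2 * a with hE
  have m1 : ρ ^ 2 * π * a ≤ E := by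
    have : ρ ^ 2 * π * a ≤ ρ ^ 2 * π ^ 2 * a := by gcongr
    linarith
  have m2 : ρ ^ 2 * π ^ 2 * a ≤ E := by linarith
  have m3 : ρ * π * a ≤ E := by
    have : ρ * π * a ≤ ρ ^ 2 * π ^ 2 * a := by gcongr
    linarith
  have m4 : ρ ^ 2 * a ≤ E := by
    have : ρ ^ 2 * 1 * a ≤ ρ ^ 2 * π ^ 2 * a := by gcongr
    linarith
  have m5 : T * ρ * a ≤ E := by
    have : 0 ≤ ρ ^ 2 * π ^ 2 * a := by positivity
    linarith
  have hqq : q * (a / q) = a := by field_simp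
  have t : q * (2 * (√M * (ρ * (5 * c * (B * a))) * (π * U) * (√c * (5 * c * (B * a))))
        + √M * (π * (D₀ * a)) * (ρ * (5 * c * (B * a))) * (π * U)
        + 5 * c * (B * a) * (A * (π * a)) * U + W * (A * (ρ * a)) * (5 * c * (B * a))
        + 2 * √c * (ρ * √M) * (π * (D₀ * a)) * W * (5 * c * (B * a))
        + 2 * c * T * (5 * c * (B * a)) ^ 2 * W
        + W * (ρ * (√M * (a / q * (π * U))))
        + W * (ρ * (√M * (π * (D₀ * a)) ^ 2)) + W * (A * (π * a)) * (D₀ * a))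
      = 50 * √M * c ^ 2 * B ^ 2 * U * √c * (ρ ^ 2 * π * a)
        + 5 * √M * D₀ * c * B * U * (ρ ^ 2 * π ^ 2 * a)
        + 5 * c * B * A * U * (ρ * π * a) + 5 * W * A * c * B * (ρ ^ 2 * a)
        + 10 * √c * √M * D₀ * W * c * B * (ρ ^ 2 * π * a) + 50 * c ^ 3 * B ^ 2 * W * (T * ρ * a)
        + W * √M * U * (ρ * π * a) + W * √M * D₀ ^ 2 * (ρ ^ 2 * π ^ 2 * a)
        + W * A * D₀ * (ρ * π * a) := by
    generalize a / q = β at hqq ⊢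
    linear_combination (50 * √M * c ^ 2 * B ^ 2 * U * √c * ρ * π * a
      + 5 * √M * D₀ * c * B * U * π ^ 2 * ρ * a + 5 * c * B * A * U * π * a
      + 5 * W * A * c * B * ρ * a + 10 * √c * √M * D₀ * W * c * B * ρ * π * a
      + 50 * c ^ 3 * B ^ 2 * W * T * a + W * √M * D₀ ^ 2 * ρ * π ^ 2 * a
      + W * A * D₀ * π * a) * haq + W * ρ * √M * π * U * hqq
  rw [t]
  calc _ ≤ 50 * √M * c ^ 2 * B ^ 2 * U * √c * E + 5 * √M * D₀ * c * B * U * E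
        + 5 * c * B * A * U * E + 5 * W * A * c * B * E
        + 10 * √c * √M * D₀ * W * c * B * E + 50 * c ^ 3 * B ^ 2 * W * E
        + W * √M * U * E + W * √M * D₀ ^ 2 * E + W * A * D₀ * E := by gcongr
    _ = _ := by ring

end Rates

section Linearisation

set_option maxHeartbeats 1000000 in
/-- Deterministic asymptotic linearity: on a regular sample whose moments are close to the
population ones, the estimator satisfies the linearised first-order condition up to an error of
the order of the two rates. -/
theorem exists_linearisation (M c A c₄ U W C₁ δ : ℝ) (hc : 1 ≤ c) (hA : 1 ≤ A)
    (hc₄ : 0 < c₄) (hU : 0 ≤ U) (hW : 0 ≤ W) (hC₁ : 0 < C₁) (hδ : 0 < δ) (hδ8 : δ ≤ 1 / 8) :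
    ∃ K D₀ η : ℝ, 0 ≤ K ∧ 0 < η ∧
    ∀ (n p r : ℕ) (Θ : Set (Fin p → ℝ)) (G : Fin n → (Fin p → ℝ) → Fin r → ℝ) (T a rad : ℝ)
      (V : Set ℝ) (θ₀ θhat : Fin p → ℝ) (m : (Fin p → ℝ) → Fin r → ℝ)
      (Gm : Matrix (Fin r) (Fin p) ℝ) (Vm : Matrix (Fin r) (Fin r) ℝ),
      1 ≤ p → p ≤ r → a = √(r / n) → RegularSample Θ G M c T →
      T * √r * a ≤ η → r * p * a ≤ η → D₀ * a ≤ rad → {θ | l2 (θ - θ₀) ≤ rad} ⊆ Θ →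
      (∀ x, |x| ≤ δ → x ∈ V) → (∀ v ∈ V, -1 < v) → MinimisesCriterion V Θ G θhat →
      θ₀ ∈ Θ → θhat ∈ Θ → l2 (gbar G θ₀) ≤ A * a →
      ∑ j, ∑ k, (gradBar Θ G θ₀ - Gm) j k ^ 2 ≤ (A * (√p * a)) ^ 2 →
      ∑ j, ∑ k, ((Matrix.of fun j k => empMean fun i => G i θ₀ j * G i θ₀ k) - Vm) j k ^ 2
        ≤ (A * (√r * a)) ^ 2 →
      (∀ v, c₄ * l2 v ≤ l2 (Gm *ᵥ v)) → Vmᵀ = Vm →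
      (∀ θ ∈ Θ, C₁ * ‖θ - θ₀‖ ≤ ‖m θ‖) →
      (∀ θ ∈ Θ, ∀ j, |gbar G θ j - gbar G θ₀ j - m θ j| ≤ C₁ / 2 * ‖θ - θ₀‖ + A * a) →
      ∀ (u : Fin p → ℝ) (w : Fin r → ℝ), Vm *ᵥ w = Gm *ᵥ u → l2 u ≤ U → l2 w ≤ W →
        √n * |w ⬝ᵥ gbar G θ₀ + w ⬝ᵥ (Gm *ᵥ (θhat - θ₀))| ≤ K * (T * √r * a + r * p * a) := by
  -- Below, `K₁ * a` and `K₂ * a` are the sup-norm and Euclidean rates of the estimator, with half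
  -- of the identification constant spent on absorbing errors. `B * a` bounds `ḡ` at the perturbed
  -- point, and `D₀ * a` its distance from `θ₀`.
  have hc0 : 0 < c := by linarith
  have hA0 : 0 < A := by linarith
  set K₁ : ℝ := 2 / C₁ * (7 * c * A + 2 * A) with hK₁
  set K₂ : ℝ := 2 / c₄ * (7 * c * A + A) with hK₂
  set B : ℝ := 7 * c * A + √M * U with hB
  set D₀ : ℝ := K₂ + U with hD₀
  have hM' := Real.sqrt_nonneg M
  have hc' := Real.sqrt_nonneg c
  have hK₁0 : 0 < K₁ := by positivity
  have hK₂0 : 0 < K₂ := by positivity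
  have hB0 : 0 < B := by positivity
  have hD₀0 : 0 < D₀ := by positivity
  set K := 50 * √M * c ^ 2 * B ^ 2 * U * √c + 5 * √M * D₀ * c * B * U + 5 * c * B * A * U
          + 5 * W * A * c * B + 10 * √c * √M * D₀ * W * c * B + 50 * c ^ 3 * B ^ 2 * W
          + W * √M * U + W * √M * D₀ ^ 2 + W * A * D₀ with hK
  -- The three caps keep `√p * a ≤ 1`, keep all `λᵀg_i` within `δ`, and let half of `c₄ * l2 Δ`
  -- absorb the Taylor and gradient errors.
  refine ⟨K, D₀, min 1 (min (δ / (5 * c * B)) (c₄ / (2 * (A + √M * K₁)))), by positivity,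
    by positivity, ?_⟩
  intro n p r Θ G T a rad V θ₀ θhat m Gm Vm hp hpr haeq H hE₁ hE₂ hrad hball hVδ hV_log hmin hθ₀
    hθhat hmean hκ hν hGm hVm hid hunif
  have hn : (0 : ℝ) < n := by exact_mod_cast H.pos
  have hp' : (1 : ℝ) ≤ p := by exact_mod_cast hp
  have hr' : (p : ℝ) ≤ r := by exact_mod_cast hpr
  set ρ := √(r : ℝ) with hρdef
  set π := √(p : ℝ) with hπdef
  set q := √(n : ℝ) with hqdef
  have hρsq : ρ ^ 2 = r := Real.sq_sqrt (by positivity)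
  have hπsq : π ^ 2 = p := Real.sq_sqrt (by positivity)
  have hπ1 : 1 ≤ π := Real.one_le_sqrt.2 hp'
  have hπρ : π ≤ ρ := Real.sqrt_le_sqrt hr'
  have hρ1 : 1 ≤ ρ := hπ1.trans hπρ
  have hq0 : 0 < q := Real.sqrt_pos.2 hn
  have hq1 : 1 ≤ q := Real.one_le_sqrt.2 (by exact_mod_cast H.pos)
  have haq' : a = ρ / q := by rw [haeq, Real.sqrt_div (by positivity)]
  have ha : 0 < a := by rw [haq']; positivity
  have haq : q * a = ρ := by rw [haq']; field_simp
  have hT := H.T_nonneg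
  rw [← hρsq, ← hπsq] at hE₂ ⊢
  have hη1 := hE₂.trans (min_le_left _ _)
  have hη2 := hE₁.trans ((min_le_right _ _).trans (min_le_left _ _))
  have hη3 := hE₂.trans ((min_le_right _ _).trans (min_le_right _ _))
  have hTa : T * a ≤ δ / (5 * c * B) := by
    refine le_trans ?_ hη2
    have : T * 1 * a ≤ T * ρ * a := by gcongr
    linarith
  have hsT : 5 * c * (B * a) * T ≤ δ := by
    rw [le_div_iff₀ (by positivity)] at hTa
    linarith
  have hAB : A ≤ B := by
    have h1 : 0 ≤ √M * U := by positivity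
    have h2 : 0 ≤ (7 * c - 1) * A := mul_nonneg (by linarith) hA0.le
    rw [hB]; linarith
  have hsT' : 5 * c * (A * a) * T ≤ δ := by
    refine le_trans ?_ hsT
    gcongr
  have hπa : π * a ≤ ρ ^ 2 * π ^ 2 * a := by
    have h1 : 1 * π ≤ ρ ^ 2 * π ^ 2 := by
      have : π ≤ π ^ 2 := le_self_pow₀ hπ1 two_ne_zero
      have : 1 ≤ ρ ^ 2 := one_le_pow₀ hρ1
      gcongr
    rw [one_mul] at h1
    exact mul_le_mul_of_nonneg_right h1 ha.le
  have hmhat : l2 (gbar G θhat) ≤ 7 * c * (A * a) :=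
    H.l2_gbar_le_of_minimises hVδ hδ8 hV_log hmin hθ₀ hθhat (by positivity) hsT' hmean
  -- rate in the supremum norm
  have hsup : ‖θhat - θ₀‖ ≤ K₁ * a := by
    have h1 : ‖m θhat‖ ≤ C₁ / 2 * ‖θhat - θ₀‖ + (7 * c * A + 2 * A) * a := by
      refine (pi_norm_le_iff_of_nonneg (by positivity)).2 fun j => ?_
      rw [Real.norm_eq_abs]
      have h2 := hunif θhat hθhat j
      have h3 := (abs_apply_le_l2 (gbar G θhat) j).trans hmhat
      have h4 := (abs_apply_le_l2 (gbar G θ₀) j).trans hmean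
      rw [abs_le] at h2 h3 h4 ⊢
      constructor <;> linarith [h2.1, h2.2, h3.1, h3.2, h4.1, h4.2]
    have h2 := hid θhat hθhat
    rw [hK₁, div_mul_eq_mul_div, div_mul_eq_mul_div, le_div_iff₀ hC₁]
    linarith
  -- rate in the Euclidean norm
  have hΔ : l2 (θhat - θ₀) ≤ K₂ * a := by
    set Δ := θhat - θ₀ with hΔdef
    have hΔ0 := l2_nonneg Δ
    have h1 := H.l2_gbar_taylor_le hθ₀ hθhat
    have h2 : l2 ((gradBar Θ G θ₀ - Gm) *ᵥ Δ) ≤ A * (π * a) * l2 Δ := by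
      refine l2_le_of_forall_dotProduct (by positivity) fun x => ?_
      have := (abs_le.1 (abs_dotProduct_mulVec_le _ (by positivity) hκ x Δ)).2
      linarith
    have h3 : Gm *ᵥ Δ = (gbar G θhat - gbar G θ₀)
        - (gbar G θhat - gbar G θ₀ - gradBar Θ G θ₀ *ᵥ Δ) - (gradBar Θ G θ₀ - Gm) *ᵥ Δ := by
      rw [sub_mulVec]; abel
    have h4 := hGm Δ
    rw [h3] at h4
    have h5 := l2_sub_le ((gbar G θhat - gbar G θ₀)
        - (gbar G θhat - gbar G θ₀ - gradBar Θ G θ₀ *ᵥ Δ)) ((gradBar Θ G θ₀ - Gm) *ᵥ Δ)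
    have h6 := l2_sub_le (gbar G θhat - gbar G θ₀)
        (gbar G θhat - gbar G θ₀ - gradBar Θ G θ₀ *ᵥ Δ)
    have h7 := l2_sub_le (gbar G θhat) (gbar G θ₀)
    -- One factor `l1 Δ` is kept as `√p * l2 Δ`; the other uses the sup-norm rate. The quadratic
    -- error thus becomes a small multiple of `l2 Δ`, without assuming Euclidean consistency.
    have h8 : ρ * (√M * l1 Δ ^ 2) ≤ √M * K₁ * (ρ ^ 2 * π ^ 2 * a) * l2 Δ := by
      have h9 : l1 Δ ≤ π * l2 Δ := l1_le_sqrt_mul_l2 Δ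
      have h10 : l1 Δ ≤ π ^ 2 * (K₁ * a) := by
        refine (l1_le_mul_norm Δ).trans ?_
        rw [hπsq]
        exact mul_le_mul_of_nonneg_left hsup (by positivity)
      calc ρ * (√M * l1 Δ ^ 2) = ρ * (√M * (l1 Δ * l1 Δ)) := by ring
        _ ≤ ρ * (√M * ((π * l2 Δ) * (π ^ 2 * (K₁ * a)))) := by
            have := l1_nonneg Δ
            gcongr
        _ = √M * K₁ * (ρ * π * π ^ 2 * a) * l2 Δ := by ring
        _ ≤ √M * K₁ * (ρ * ρ * π ^ 2 * a) * l2 Δ := by gcongr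
        _ = _ := by ring
    have h9 : A * (π * a) * l2 Δ ≤ A * (ρ ^ 2 * π ^ 2 * a) * l2 Δ := by gcongr
    have h10 : (A + √M * K₁) * (ρ ^ 2 * π ^ 2 * a) * l2 Δ ≤ c₄ / 2 * l2 Δ := by
      refine mul_le_mul_of_nonneg_right ?_ hΔ0
      rw [le_div_iff₀ (by positivity)] at hη3
      linarith
    rw [hK₂, div_mul_eq_mul_div, div_mul_eq_mul_div, le_div_iff₀ hc₄]
    linarith
  -- first-order condition in both directions
  have key : ∀ (u : Fin p → ℝ) (w : Fin r → ℝ), Vm *ᵥ w = Gm *ᵥ u → l2 u ≤ U → l2 w ≤ W →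
      0 ≤ q * (w ⬝ᵥ gbar G θ₀ + w ⬝ᵥ (Gm *ᵥ (θhat - θ₀)))
        + K * (T * ρ * a + ρ ^ 2 * π ^ 2 * a) := by
    intro u w hw hu hwW
    -- The step `a / q` is short enough that `√n` times the change of `ḡ` along it is of order `√r
    -- √p a`, and at most `a`, so the perturbed point stays in `Θ`.
    have hτ : 0 < a / q := by positivity
    have hτa : a / q ≤ a := div_le_self ha.le hq1
    have hDle : l2 (θhat - θ₀) + a / q * U ≤ D₀ * a := by
      have : a / q * U ≤ a * U := mul_le_mul_of_nonneg_right hτa hU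
      rw [hD₀]; linarith
    have hbΘ : θhat + (a / q) • u ∈ Θ := by
      apply hball
      have h1 : θhat + (a / q) • u - θ₀ = (θhat - θ₀) + (a / q) • u := by abel
      change l2 _ ≤ rad
      rw [h1]
      refine (l2_add_le _ _).trans (le_trans ?_ (hDle.trans hrad))
      rw [l2_smul, abs_of_pos hτ]
      gcongr
    have hmb : l2 (gbar G (θhat + (a / q) • u)) ≤ B * a := by
      have h1 := H.l2_gbar_sub_le hθhat hbΘ
      have h2 := l2_add_le (gbar G (θhat + (a / q) • u) - gbar G θhat) (gbar G θhat)
      rw [sub_add_cancel] at h2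
      rw [add_sub_cancel_left, l1_smul, abs_of_pos hτ] at h1
      have h3 : ρ * (√M * (a / q * l1 u)) ≤ √M * U * a := by
        have h4 : l1 u ≤ π * U :=
          (l1_le_sqrt_mul_l2 u).trans (mul_le_mul_of_nonneg_left hu (Real.sqrt_nonneg _))
        have h5 : π * a ≤ 1 := hπa.trans hη1
        calc ρ * (√M * (a / q * l1 u)) ≤ ρ * (√M * (a / q * (π * U))) := by gcongr
          _ = √M * U * ((ρ / q) * (π * a)) := by ring
          _ = √M * U * (a * (π * a)) := by rw [← haq']
          _ ≤ √M * U * (a * 1) := by gcongr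
          _ = _ := by ring
      rw [hB]
      linarith
    have h1 := H.first_order_le hVδ hδ8 hV_log hmin hθ₀ hθhat (s := B * a) (by positivity) hsT hτ
      hbΘ hmb hVm hw (κ := A * (π * a)) (ν := A * (ρ * a)) (by positivity) (by positivity) hκ hν
      hu hwW hDle
    have h2 := first_order_error_le (M := M) (c := c) (A := A) (B := B) (D₀ := D₀) (U := U)
      (W := W) (T := T) hc0.le hA0.le hB0.le hD₀0.le hU hW hT hρ1 hπ1 ha.le hq0 haq
      (rr := r) (pp := p) rfl (by positivity) rfl
    have h3 := mul_nonneg hq0.le h1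
    rw [mul_add] at h3
    linarith
  intro u w hw hu hwW
  have h1 := key u w hw hu hwW
  have h2 := key (-u) (-w) (by rw [mulVec_neg, mulVec_neg, hw]) (by rwa [l2_neg])
    (by rwa [l2_neg])
  rw [neg_dotProduct, neg_dotProduct] at h2
  rw [← abs_of_pos hq0, ← abs_mul, abs_le]
  constructor <;> linarith

end Linearisation

/-! ### Symmetric matrices -/

section SymmetricMatrices

variable {q : ℕ} {M : Matrix (Fin q) (Fin q) ℝ}

lemma finite_spectrum (hM : M.IsHermitian) : (spectrum ℝ M).Finite := by
  rw [hM.spectrum_real_eq_range_eigenvalues]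
  exact Set.finite_range _

lemma lamMin_mul_le (hM : M.IsHermitian) (v : Fin q → ℝ) :
    lamMin M * (v ⬝ᵥ v) ≤ v ⬝ᵥ (M *ᵥ v) := by
  have h : (M - algebraMap ℝ (Matrix (Fin q) (Fin q) ℝ) (lamMin M)).PosSemidef := by
    rw [posSemidef_iff_isHermitian_and_spectrum_nonneg]
    refine ⟨hM.sub (by simp [Algebra.algebraMap_eq_smul_one, IsHermitian]), ?_⟩
    rw [← spectrum.sub_singleton_eq]
    rintro x ⟨y, hy, z, hz, rfl⟩
    rw [Set.mem_singleton_iff] at hz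
    subst hz
    have := csInf_le (finite_spectrum hM).bddBelow hy
    simpa [lamMin] using this
  have := h.dotProduct_mulVec_nonneg v
  simp only [star_trivial, sub_mulVec, dotProduct_sub, Algebra.algebraMap_eq_smul_one,
    smul_mulVec, one_mulVec, dotProduct_smul, smul_eq_mul] at this
  linarith

lemma le_lamMax_mul (hM : M.IsHermitian) (v : Fin q → ℝ) :
    v ⬝ᵥ (M *ᵥ v) ≤ lamMax M * (v ⬝ᵥ v) := by
  have h : (algebraMap ℝ (Matrix (Fin q) (Fin q) ℝ) (lamMax M) - M).PosSemidef := by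
    rw [posSemidef_iff_isHermitian_and_spectrum_nonneg]
    refine ⟨IsHermitian.sub
      (by simp [Algebra.algebraMap_eq_smul_one, IsHermitian]) hM, ?_⟩
    rw [← spectrum.singleton_sub_eq]
    rintro x ⟨y, hy, z, hz, rfl⟩
    rw [Set.mem_singleton_iff] at hy
    subst hy
    have := le_csSup (finite_spectrum hM).bddAbove hz
    simpa [lamMax] using this
  have := h.dotProduct_mulVec_nonneg v
  simp only [star_trivial, sub_mulVec, dotProduct_sub, Algebra.algebraMap_eq_smul_one,
    smul_mulVec, one_mulVec, dotProduct_smul, smul_eq_mul] at this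
  linarith

lemma matSqrt_mul_self (hM : M.PosSemidef) : matSqrt M * matSqrt M = M := by
  have hsa : IsSelfAdjoint M := hM.1
  rw [matSqrt, ← cfc_mul Real.sqrt Real.sqrt M]
  conv_rhs => rw [← cfc_id' ℝ M]
  refine cfc_congr fun x hx => ?_
  exact Real.mul_self_sqrt ((posSemidef_iff_isHermitian_and_spectrum_nonneg.1 hM).2 hx)

lemma transpose_matSqrt : (matSqrt M)ᵀ = matSqrt M := by
  have : IsSelfAdjoint (matSqrt M) := cfc_predicate _ _
  have h := this.star_eq
  rwa [star_eq_conjTranspose, conjTranspose_eq_transpose_of_trivial] at h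

lemma isUnit_matSqrt (hM : M.PosDef) : IsUnit (matSqrt M).det := by
  have h := congrArg det (matSqrt_mul_self hM.posSemidef)
  rw [det_mul] at h
  exact isUnit_of_mul_isUnit_left (h ▸ (isUnit_iff_isUnit_det _).1 hM.isUnit)

lemma posDef_of_form {c : ℝ} (hc : 0 < c) (hM : Mᵀ = M)
    (h : ∀ v, c * (v ⬝ᵥ v) ≤ v ⬝ᵥ (M *ᵥ v)) : M.PosDef := by
  refine PosDef.of_dotProduct_mulVec_pos (by
    rw [IsHermitian, conjTranspose_eq_transpose_of_trivial, hM]) fun v hv => ?_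
  have h1 : 0 < v ⬝ᵥ v := by
    refine lt_of_le_of_ne (dotProduct_self_nonneg' v) fun h0 => hv ?_
    exact dotProduct_self_eq_zero.1 h0.symm
  rw [star_trivial]
  exact lt_of_lt_of_le (by positivity) (h v)

lemma dotProduct_mulVec_mulVec_self (B : Matrix (Fin q) (Fin q) ℝ) (hB : Bᵀ = B)
    (x y : Fin q → ℝ) : (B *ᵥ x) ⬝ᵥ (B *ᵥ y) = x ⬝ᵥ ((B * B) *ᵥ y) := by
  rw [← mulVec_mulVec, dotProduct_mulVec x B, ← mulVec_transpose, hB]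

/-- A direction `α` for `J^{1/2}` is carried by a linear functional `w` of the estimating
functions. -/
theorem exists_influence {p r : ℕ} {Gm : Matrix (Fin r) (Fin p) ℝ} {Vm : Matrix (Fin r) (Fin r) ℝ}
    {c c₄ : ℝ} (hc : 0 < c) (hc₄ : 0 < c₄) (hVm : Vmᵀ = Vm)
    (hlow : ∀ v, c⁻¹ * (v ⬝ᵥ v) ≤ v ⬝ᵥ (Vm *ᵥ v)) (hup : ∀ v, v ⬝ᵥ (Vm *ᵥ v) ≤ c * (v ⬝ᵥ v))
    (hGm : ∀ v, c₄ * l2 v ≤ l2 (Gm *ᵥ v)) {α : Fin p → ℝ} (hα : α ⬝ᵥ α = 1) :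
    ∃ (u : Fin p → ℝ) (w : Fin r → ℝ), Vm *ᵥ w = Gm *ᵥ u ∧ l2 u ≤ √c / c₄ ∧ l2 w ≤ √c ∧
      w ⬝ᵥ (Vm *ᵥ w) = 1 ∧
      ∀ Δ, w ⬝ᵥ (Gm *ᵥ Δ) = α ⬝ᵥ (matSqrt (outer (Gmᵀ * (matSqrt Vm)⁻¹)) *ᵥ Δ) := by
  have hVpd : Vm.PosDef := posDef_of_form (inv_pos.2 hc) hVm hlow
  have hVu : IsUnit Vm.det := (isUnit_iff_isUnit_det _).1 hVpd.isUnit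
  set S := matSqrt Vm with hS
  have hST : Sᵀ = S := transpose_matSqrt
  have hSS : S * S = Vm := matSqrt_mul_self hVpd.posSemidef
  have hSu : IsUnit S.det := isUnit_matSqrt hVpd
  have hSiT : (S⁻¹)ᵀ = S⁻¹ := by rw [transpose_nonsing_inv, hST]
  set J := outer (Gmᵀ * S⁻¹) with hJ
  have hJeq : J = Gmᵀ * Vm⁻¹ * Gm := by
    rw [hJ, outer, transpose_mul, hSiT, transpose_transpose, ← hSS, Matrix.mul_inv_rev]
    simp only [Matrix.mul_assoc]
  have hJT : Jᵀ = J := by rw [hJ, outer, transpose_mul, transpose_transpose]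
  have hJform : ∀ v, v ⬝ᵥ (J *ᵥ v) = l2 (S⁻¹ *ᵥ (Gm *ᵥ v)) ^ 2 := fun v => by
    rw [l2_sq, hJ, outer, transpose_mul, hSiT, transpose_transpose, ← mulVec_mulVec,
      ← mulVec_mulVec, ← mulVec_mulVec, dotProduct_mulVec, ← mulVec_transpose, transpose_transpose,
      dotProduct_mulVec, ← mulVec_transpose, hSiT]
  -- For `x = V^{-1/2}Gv` one has `|Gv|² = xᵀVx ≤ c|x|²`, which transfers the lower bound on `G` to
  -- `J`.
  have hJlow : ∀ v, c₄ ^ 2 / c * (v ⬝ᵥ v) ≤ v ⬝ᵥ (J *ᵥ v) := fun v => by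
    set x := S⁻¹ *ᵥ (Gm *ᵥ v) with hx
    have h1 : S *ᵥ x = Gm *ᵥ v := by
      rw [hx, mulVec_mulVec, mul_nonsing_inv _ hSu, one_mulVec]
    have h2 : l2 (Gm *ᵥ v) ^ 2 ≤ c * l2 x ^ 2 := by
      rw [← h1, l2_sq, l2_sq, dotProduct_mulVec_mulVec_self S hST, hSS]
      exact hup x
    have h3 : (c₄ * l2 v) ^ 2 ≤ l2 (Gm *ᵥ v) ^ 2 :=
      pow_le_pow_left₀ (mul_nonneg hc₄.le (l2_nonneg v)) (hGm v) 2
    rw [hJform, ← l2_sq, div_mul_eq_mul_div, div_le_iff₀ hc, ← mul_pow]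
    linarith
  have hJpd : J.PosDef := posDef_of_form (by positivity) hJT hJlow
  set K := matSqrt J with hK
  have hKT : Kᵀ = K := transpose_matSqrt
  have hKK : K * K = J := matSqrt_mul_self hJpd.posSemidef
  have hKu : IsUnit K.det := isUnit_matSqrt hJpd
  -- With `u = J^{-1/2}α` and `w = V⁻¹Gu`, both `wᵀVw = uᵀJu = |α|² = 1` and `wᵀGΔ = uᵀJΔ =
  -- αᵀJ^{1/2}Δ` hold.
  set u := K⁻¹ *ᵥ α with hu
  have hKu' : K *ᵥ u = α := by rw [hu, mulVec_mulVec, mul_nonsing_inv _ hKu, one_mulVec]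
  set w := Vm⁻¹ *ᵥ (Gm *ᵥ u) with hw
  have hVw : Vm *ᵥ w = Gm *ᵥ u := by
    rw [hw, mulVec_mulVec, mul_nonsing_inv _ hVu, one_mulVec]
  have huJu : u ⬝ᵥ (J *ᵥ u) = 1 := by
    rw [← hKK, ← dotProduct_mulVec_mulVec_self K hKT, hKu', hα]
  have hwG : ∀ Δ, w ⬝ᵥ (Gm *ᵥ Δ) = u ⬝ᵥ (J *ᵥ Δ) := fun Δ => by
    have hViT : (Vm⁻¹)ᵀ = Vm⁻¹ := by rw [transpose_nonsing_inv, hVm]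
    rw [hJeq, ← mulVec_mulVec, ← mulVec_mulVec, dotProduct_mulVec u, ← mulVec_transpose,
      transpose_transpose, dotProduct_mulVec _ Vm⁻¹, ← mulVec_transpose, hViT]
  have hwVw : w ⬝ᵥ (Vm *ᵥ w) = 1 := by rw [hVw, hwG, huJu]
  refine ⟨u, w, hVw, ?_, ?_, hwVw, fun Δ => ?_⟩
  · have h1 := hJlow u
    rw [huJu, div_mul_eq_mul_div, div_le_one hc, ← l2_sq, ← mul_pow] at h1
    rw [le_div_iff₀ hc₄, mul_comm]
    exact Real.le_sqrt_of_sq_le h1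
  · have h1 := hlow w
    rw [hwVw, inv_mul_le_iff₀ hc, mul_one, ← l2_sq] at h1
    exact Real.le_sqrt_of_sq_le h1
  · rw [hwG, ← hKK, ← dotProduct_mulVec_mulVec_self K hKT, hKu']

end SymmetricMatrices

/-! ### Independent and identically distributed samples -/

section IID

variable {Ω 𝒳 : Type*} [MeasurableSpace Ω] [MeasurableSpace 𝒳] {P : Measure Ω}
  {μ : Measure 𝒳} {n : ℕ} {X : Fin n → Ω → 𝒳}

lemma memLp_comp_of_hasLaw {i : Fin n} (hX : ∀ i, HasLaw (X i) μ P) {f : 𝒳 → ℝ}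
    (hf : MemLp f 2 μ) : MemLp (fun ω => f (X i ω)) 2 P := by
  have h : MemLp f 2 (P.map (X i)) := by rwa [(hX i).map_eq]
  exact h.comp_of_map (hX i).aemeasurable

lemma integral_comp_of_hasLaw {i : Fin n} (hX : ∀ i, HasLaw (X i) μ P) {f : 𝒳 → ℝ}
    (hf : AEStronglyMeasurable f μ) : ∫ ω, f (X i ω) ∂P = ∫ x, f x ∂μ :=
  (hX i).integral_comp hf


lemma measure_le_ofReal_of_integral [IsFiniteMeasure P] {f : Ω → ℝ} (hf0 : ∀ ω, 0 ≤ f ω) (hf : Integrable f P)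
    {t C : ℝ} (ht : 0 < t) (hC : ∫ ω, f ω ∂P ≤ C) :
    P {ω | t ≤ f ω} ≤ ENNReal.ofReal (C / t) := by
  have h := mul_meas_ge_le_integral_of_nonneg (ae_of_all P hf0) hf t
  rw [ENNReal.le_ofReal_iff_toReal_le (measure_ne_top _ _)
    (div_nonneg ((integral_nonneg hf0).trans hC) ht.le), le_div_iff₀ ht, mul_comm]
  exact h.trans hC

lemma memLp_empMean (hX : ∀ i, HasLaw (X i) μ P) {f : 𝒳 → ℝ} (hf : MemLp f 2 μ) :
    MemLp (fun ω => empMean fun i => f (X i ω)) 2 P := by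
  simp only [empMean]
  exact (memLp_finsetSum _ fun i _ => memLp_comp_of_hasLaw hX hf).const_mul _

variable [IsProbabilityMeasure P]

lemma integral_empMean (hn : 0 < n) (hX : ∀ i, HasLaw (X i) μ P) {f : 𝒳 → ℝ} (hf : MemLp f 2 μ) :
    ∫ ω, empMean (fun i => f (X i ω)) ∂P = ∫ x, f x ∂μ := by
  simp only [empMean]
  rw [integral_const_mul, integral_finsetSum _ fun i _ =>
    (memLp_comp_of_hasLaw hX hf).integrable (by norm_num)]
  simp only [integral_comp_of_hasLaw hX hf.1, Finset.sum_const, Finset.card_univ,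
    Fintype.card_fin, nsmul_eq_mul]
  have : (n : ℝ) ≠ 0 := by positivity
  field_simp

lemma integral_sq_empMean_sub_le (hn : 0 < n) (hX : ∀ i, HasLaw (X i) μ P) (hI : iIndepFun X P)
    {f : 𝒳 → ℝ} (hfm : Measurable f) (hf : MemLp f 2 μ) :
    ∫ ω, (empMean (fun i => f (X i ω)) - ∫ x, f x ∂μ) ^ 2 ∂P ≤ (∫ x, f x ^ 2 ∂μ) / n := by
  have hn' : (0 : ℝ) < n := by exact_mod_cast hn
  have h1 : ∫ ω, (empMean (fun i => f (X i ω)) - ∫ x, f x ∂μ) ^ 2 ∂P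
      = Var[fun ω => empMean (fun i => f (X i ω)); P] := by
    rw [variance_eq_integral (memLp_empMean hX hf).1.aemeasurable, integral_empMean hn hX hf]
  have h2 : Var[∑ i, fun ω => f (X i ω); P] = ∑ i, Var[fun ω => f (X i ω); P] :=
    IndepFun.variance_sum (fun i _ => memLp_comp_of_hasLaw hX hf) fun i _ j _ hij =>
      (hI.indepFun hij).comp hfm hfm
  have h3 : ∀ i, Var[fun ω => f (X i ω); P] ≤ ∫ x, f x ^ 2 ∂μ := fun i => by
    refine (variance_le_expectation_sq (memLp_comp_of_hasLaw hX hf).1).trans (le_of_eq ?_)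
    exact integral_comp_of_hasLaw hX (f := fun x => f x ^ 2) (hf.1.pow 2)
  have h4 : (fun ω => empMean (fun i => f (X i ω))) = fun ω => (n : ℝ)⁻¹ * (∑ i, fun ω => f (X i ω)) ω := by
    funext ω; simp [empMean]
  rw [h1, h4, variance_const_mul, h2]
  calc ((n : ℝ)⁻¹) ^ 2 * ∑ i, Var[fun ω => f (X i ω); P]
      ≤ ((n : ℝ)⁻¹) ^ 2 * ∑ _i : Fin n, ∫ x, f x ^ 2 ∂μ :=
        mul_le_mul_of_nonneg_left (Finset.sum_le_sum fun i _ => h3 i) (by positivity)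
    _ = _ := by
        rw [Finset.sum_const, Finset.card_univ, Fintype.card_fin, nsmul_eq_mul]
        field_simp

/-- Markov's inequality for the summed variances; the index type ranges over vector or matrix
entries, giving Euclidean or Frobenius deviations at once. -/
lemma measure_sum_sq_empMean_sub_le (hn : 0 < n) (hX : ∀ i, HasLaw (X i) μ P)
    (hI : iIndepFun X P) {ι : Type*} [Fintype ι] {F : ι → 𝒳 → ℝ} (hFm : ∀ j, Measurable (F j))
    (hF : ∀ j, MemLp (F j) 2 μ) {C t : ℝ} (hC : ∀ j, ∫ x, F j x ^ 2 ∂μ ≤ C) (ht : 0 < t) :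
    P {ω | t ≤ ∑ j, (empMean (fun i => F j (X i ω)) - ∫ x, F j x ∂μ) ^ 2}
      ≤ ENNReal.ofReal (Fintype.card ι * C / n / t) := by
  have hint : ∀ j, Integrable (fun ω => (empMean (fun i => F j (X i ω)) - ∫ x, F j x ∂μ) ^ 2) P :=
    fun j => ((memLp_empMean hX (hF j)).sub (memLp_const _)).integrable_sq
  refine measure_le_ofReal_of_integral (fun ω => Finset.sum_nonneg fun j _ => sq_nonneg _)
    (integrable_finsetSum _ fun j _ => hint j) ht ?_
  rw [integral_finsetSum _ fun j _ => hint j]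
  calc ∑ j, ∫ ω, (empMean (fun i => F j (X i ω)) - ∫ x, F j x ∂μ) ^ 2 ∂P
      ≤ ∑ _j : ι, C / n := Finset.sum_le_sum fun j _ =>
        (integral_sq_empMean_sub_le hn hX hI (hFm j) (hF j)).trans
          (div_le_div_of_nonneg_right (hC j) (by positivity))
    _ = _ := by
        rw [Finset.sum_const, Finset.card_univ, nsmul_eq_mul]; ring

/-- Follows from `(1 + x + x²)(1 - x + x²) = 1 + x² + x⁴ ≥ 1`. The penalty `-x²` keeps the
exponential bounded, so two moments replace exponential moments. -/
lemma exp_sub_sq_le (x : ℝ) : Real.exp (x - x ^ 2) ≤ 1 + x + x ^ 2 := by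
  have h1 : 0 < 1 - (x - x ^ 2) := by nlinarith [sq_nonneg (x - 1 / 2)]
  have h2 : 0 < 1 + x + x ^ 2 := by nlinarith [sq_nonneg (x + 1 / 2)]
  have h3 := Real.add_one_le_exp (-(x - x ^ 2))
  rw [Real.exp_neg] at h3
  have h4 : 1 - (x - x ^ 2) ≤ (Real.exp (x - x ^ 2))⁻¹ := by linarith
  rw [le_inv_comm₀ h1 (Real.exp_pos _)] at h4
  refine h4.trans ?_
  rw [inv_le_iff_one_le_mul₀ h1]
  nlinarith [sq_nonneg x, sq_nonneg (x ^ 2)]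

/-- Self-normalised exponential tail bound for sums of independent variables. -/
lemma measure_selfNormalized_le [IsProbabilityMeasure μ] (hX : ∀ i, HasLaw (X i) μ P)
    (hI : iIndepFun X P) {h : 𝒳 → ℝ} (hm : Measurable h) (hh : MemLp h 2 μ) {t B : ℝ}
    (ht : 0 < t) (hB : 0 < B) :
    P {ω | n * t ≤ ∑ i, h (X i ω) - n * ∫ x, h x ∂μ ∧
        ∑ i, h (X i ω) ^ 2 + n * ∫ x, h x ^ 2 ∂μ ≤ n * B}
      ≤ ENNReal.ofReal (Real.exp (-(n * t ^ 2 / (4 * B)))) := by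
  -- This value maximises `l * t - l² * B`, giving the exponent `t² / (4 * B)` per observation.
  set l : ℝ := t / (2 * B) with hl
  have hl0 : 0 < l := by positivity
  set m₁ := ∫ x, h x ∂μ with hm₁
  set m₂ := ∫ x, h x ^ 2 ∂μ with hm₂
  have hint1 : Integrable h μ := hh.integrable (by norm_num)
  have hint2 : Integrable (fun x => h x ^ 2) μ := hh.integrable_sq
  -- The centring by both moments makes `φ` have integral at most one, so the product over the
  -- sample does too, by independence.
  set φ : 𝒳 → ℝ := fun x => Real.exp (l * h x - (l * h x) ^ 2 - l * m₁ - l ^ 2 * m₂) with hφ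
  have hφm : Measurable φ := by fun_prop
  have hφb : ∀ x, φ x ≤ Real.exp (1 / 4 - l * m₁ - l ^ 2 * m₂) := fun x => by
    apply Real.exp_le_exp.2
    nlinarith [sq_nonneg (l * h x - 1 / 2)]
  have hφint : Integrable φ μ := by
    refine Integrable.of_bound hφm.aestronglyMeasurable
      (Real.exp (1 / 4 - l * m₁ - l ^ 2 * m₂)) (ae_of_all _ fun x => ?_)
    rw [Real.norm_eq_abs, abs_of_pos (Real.exp_pos _)]
    exact hφb x
  have hφ1 : ∫ x, φ x ∂μ ≤ 1 := by
    have h1 : ∀ x, φ x ≤ Real.exp (-(l * m₁ + l ^ 2 * m₂)) * (1 + l * h x + l ^ 2 * h x ^ 2) :=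
      fun x => by
        have : φ x = Real.exp (-(l * m₁ + l ^ 2 * m₂)) * Real.exp (l * h x - (l * h x) ^ 2) := by
          rw [← Real.exp_add]
          simp only [hφ]
          congr 1; ring
        rw [this]
        refine mul_le_mul_of_nonneg_left ((exp_sub_sq_le _).trans (le_of_eq (by ring)))
          (Real.exp_pos _).le
    have hi : Integrable (fun x => 1 + l * h x + l ^ 2 * h x ^ 2) μ :=
      ((integrable_const _).add (hint1.const_mul _)).add (hint2.const_mul _)
    have h2 : ∫ x, (1 + l * h x + l ^ 2 * h x ^ 2) ∂μ = 1 + (l * m₁ + l ^ 2 * m₂) := by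
      have hA : Integrable (fun x => 1 + l * h x) μ :=
        (integrable_const _).add (hint1.const_mul _)
      rw [integral_add hA (hint2.const_mul _), integral_add (integrable_const _)
        (hint1.const_mul _), integral_const_mul, integral_const_mul]
      simp [hm₁, hm₂]; ring
    calc ∫ x, φ x ∂μ ≤ ∫ x, Real.exp (-(l * m₁ + l ^ 2 * m₂)) *
          (1 + l * h x + l ^ 2 * h x ^ 2) ∂μ := integral_mono hφint (hi.const_mul _) h1
      _ = Real.exp (-(l * m₁ + l ^ 2 * m₂)) * (1 + (l * m₁ + l ^ 2 * m₂)) := by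
          rw [integral_const_mul, h2]
      _ ≤ Real.exp (-(l * m₁ + l ^ 2 * m₂)) * Real.exp (l * m₁ + l ^ 2 * m₂) := by
          refine mul_le_mul_of_nonneg_left ?_ (Real.exp_pos _).le
          linarith [Real.add_one_le_exp (l * m₁ + l ^ 2 * m₂)]
      _ = 1 := by rw [← Real.exp_add]; simp
  have hprod : ∫ ω, ∏ i, φ (X i ω) ∂P ≤ 1 := by
    rw [iIndepFun.integral_fun_prod_comp hI (fun i => (hX i).aemeasurable)
      (fun i => hφm.aestronglyMeasurable)]
    refine Finset.prod_le_one (fun i _ => integral_nonneg fun ω => (Real.exp_pos _).le) fun i _ => ?_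
    rw [integral_comp_of_hasLaw hX hφm.aestronglyMeasurable]
    exact hφ1
  have hprodm : AEStronglyMeasurable (fun ω => ∏ i, φ (X i ω)) P :=
    Finset.aestronglyMeasurable_fun_prod _ fun i _ =>
      (hφm.comp_aemeasurable (hX i).aemeasurable).aestronglyMeasurable
  have hprodint : Integrable (fun ω => ∏ i, φ (X i ω)) P := by
    refine Integrable.of_bound hprodm (∏ _i : Fin n, Real.exp (1 / 4 - l * m₁ - l ^ 2 * m₂))
      (ae_of_all _ fun ω => ?_)
    rw [Real.norm_eq_abs, abs_of_nonneg (Finset.prod_nonneg fun i _ => (Real.exp_pos _).le)]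
    exact Finset.prod_le_prod (fun i _ => (Real.exp_pos _).le) fun i _ => hφb _
  have hmk := measure_le_ofReal_of_integral (f := fun ω => ∏ i, φ (X i ω))
    (fun ω => Finset.prod_nonneg fun i _ => (Real.exp_pos _).le) hprodint
    (t := Real.exp (n * t ^ 2 / (4 * B))) (Real.exp_pos _) hprod
  rw [one_div, ← Real.exp_neg] at hmk
  refine (measure_mono ?_).trans hmk
  rintro ω ⟨h1, h2⟩
  change Real.exp _ ≤ ∏ i, φ (X i ω)
  simp only [hφ]
  rw [← Real.exp_sum]
  apply Real.exp_le_exp.2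
  have e1 : ∑ i, (l * h (X i ω) - (l * h (X i ω)) ^ 2 - l * m₁ - l ^ 2 * m₂)
      = l * (∑ i, h (X i ω) - n * m₁) - l ^ 2 * (∑ i, h (X i ω) ^ 2 + n * m₂) := by
    simp only [Finset.sum_sub_distrib, mul_pow, ← Finset.mul_sum, Finset.sum_const,
      Finset.card_univ, Fintype.card_fin, nsmul_eq_mul]
    ring
  rw [e1]
  have e2 : (n : ℝ) * t ^ 2 / (4 * B) = l * (n * t) - l ^ 2 * (n * B) := by
    rw [hl]; field_simp; ring
  rw [e2]
  have e3 := mul_le_mul_of_nonneg_left h1 hl0.le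
  have e4 := mul_le_mul_of_nonneg_left h2 (sq_nonneg l)
  linarith

end IID

/-! ### A uniform law of large numbers with Lipschitz slack -/

lemma exists_grid {p : ℕ} {Θ : Set (Fin p → ℝ)} {θ₀ : Fin p → ℝ} (hθ₀ : θ₀ ∈ Θ) {K η : ℝ}
    (hη : 0 < η) (hK : ∀ θ ∈ Θ, ‖θ - θ₀‖ ≤ K) {m : ℕ} (hm : 2 * K / η < m) :
    ∃ rep : (Fin p → Fin m) → Fin p → ℝ, (∀ c, rep c ∈ Θ) ∧ ∀ θ ∈ Θ, ∃ c, ‖θ - rep c‖ ≤ η := by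
  classical
  have hcoord : ∀ θ ∈ Θ, ∀ k, 0 ≤ θ k - θ₀ k + K ∧ θ k - θ₀ k + K ≤ 2 * K := fun θ hθ k => by
    have h := (norm_le_pi_norm (θ - θ₀) k).trans (hK θ hθ)
    rw [Real.norm_eq_abs, Pi.sub_apply, abs_le] at h
    constructor <;> linarith [h.1, h.2]
  have hlt : ∀ θ ∈ Θ, ∀ k, ⌊(θ k - θ₀ k + K) / η⌋₊ < m := fun θ hθ k => by
    have h := hcoord θ hθ k
    rw [Nat.floor_lt (div_nonneg h.1 hη.le)]
    exact lt_of_le_of_lt (div_le_div_of_nonneg_right h.2 hη.le) hm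
  -- Each cell of side `η` that meets `Θ` is represented by one of its points in `Θ`, since no bound
  -- is available outside `Θ`; empty cells get the harmless value `θ₀`.
  refine ⟨fun c => if h : ∃ θ ∈ Θ, ∀ k, ⌊(θ k - θ₀ k + K) / η⌋₊ = c k then h.choose else θ₀,
    fun c => ?_, fun θ hθ => ⟨fun k => ⟨_, hlt θ hθ k⟩, ?_⟩⟩
  · dsimp only
    split_ifs with h
    · exact h.choose_spec.1
    · exact hθ₀
  · have h : ∃ θ' ∈ Θ, ∀ k, ⌊(θ' k - θ₀ k + K) / η⌋₊ = ⌊(θ k - θ₀ k + K) / η⌋₊ :=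
      ⟨θ, hθ, fun k => rfl⟩
    dsimp only
    rw [dif_pos h]
    obtain ⟨hΘ', hfl⟩ := h.choose_spec
    set θ' := h.choose
    refine (pi_norm_le_iff_of_nonneg hη.le).2 fun k => ?_
    have h1 := hfl k
    have ha := div_nonneg (hcoord θ hθ k).1 hη.le
    have hb := div_nonneg (hcoord θ' hΘ' k).1 hη.le
    have h2 := Nat.floor_le ha
    have h3 := Nat.lt_floor_add_one ((θ k - θ₀ k + K) / η)
    have h4 := Nat.floor_le hb
    have h5 := Nat.lt_floor_add_one ((θ' k - θ₀ k + K) / η)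
    rw [h1] at h4 h5
    have h6 : |(θ k - θ₀ k + K) / η - (θ' k - θ₀ k + K) / η| ≤ 1 := by
      rw [abs_le]; constructor <;> linarith
    rw [← sub_div, abs_div, abs_of_pos hη, div_le_one hη] at h6
    rw [Real.norm_eq_abs, Pi.sub_apply]
    rwa [show θ k - θ₀ k + K - (θ' k - θ₀ k + K) = θ k - θ' k by ring] at h6

section ULLN

variable {Ω 𝒳 : Type*} [MeasurableSpace Ω] [MeasurableSpace 𝒳] {P : Measure Ω}
  {μ : Measure 𝒳} {n : ℕ} {X : Fin n → Ω → 𝒳} {E : Set Ω}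

lemma integrable_pow_four {f : 𝒳 → ℝ} (hf : MemLp f 4 μ) : Integrable (fun x => f x ^ 4) μ := by
  have h := MemLp.integrable_norm_pow (p := 4) hf (by norm_num)
  refine h.congr (ae_of_all _ fun x => ?_)
  simp only [Real.norm_eq_abs]
  exact Even.pow_abs (by decide) _

lemma memLp_sq_of_memLp_four {f : 𝒳 → ℝ} (hf : MemLp f 4 μ) : MemLp (fun x => f x ^ 2) 2 μ := by
  refine (memLp_two_iff_integrable_sq (f := fun x => f x ^ 2) (hf.1.pow 2)).2 ?_
  exact (integrable_pow_four hf).congr (ae_of_all _ fun x => by ring)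

variable [IsProbabilityMeasure P]

/-- Chebyshev's bad event has probability at most one half and `Eᶜ` less, so some outcome avoids
both. Reading the bounds at it gives a nonrandom statement about the population mean. -/
lemma abs_integral_le_of_event (hn : 0 < n) (hX : ∀ i, HasLaw (X i) μ P) (hI : iIndepFun X P)
    {f : 𝒳 → ℝ} (hfm : Measurable f) (hf : MemLp f 2 μ) {C b : ℝ} (hC : 0 < C)
    (hfC : ∫ x, f x ^ 2 ∂μ ≤ C) (hE : P Eᶜ < 2⁻¹)
    (hb : ∀ ω ∈ E, |empMean fun i => f (X i ω)| ≤ b) :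
    |∫ x, f x ∂μ| ≤ b + √(2 * C / n) := by
  have hn' : (0 : ℝ) < n := by exact_mod_cast hn
  have h1 := measure_sum_sq_empMean_sub_le (ι := Unit) (F := fun _ => f) hn hX hI (fun _ => hfm)
    (fun _ => hf) (fun _ => hfC) (t := 2 * C / n) (by positivity)
  simp only [Finset.univ_unique, Finset.sum_singleton, Fintype.card_unit, Nat.cast_one] at h1
  have h2 : 1 * C / n / (2 * C / n) = 2⁻¹ := by field_simp
  have h3 : ENNReal.ofReal 2⁻¹ = 2⁻¹ := by
    rw [ENNReal.ofReal_inv_of_pos (by norm_num)]; norm_num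
  rw [h2, h3] at h1
  obtain ⟨ω, hω⟩ : ∃ ω, ω ∉ Eᶜ ∪ {ω | 2 * C / n ≤
      (empMean (fun i => f (X i ω)) - ∫ x, f x ∂μ) ^ 2} := by
    by_contra hcon
    push Not at hcon
    have h4 : Eᶜ ∪ {ω | 2 * C / n ≤ (empMean (fun i => f (X i ω)) - ∫ x, f x ∂μ) ^ 2}
      = Set.univ := Set.eq_univ_of_forall hcon
    have h5 := measure_union_le (μ := P) Eᶜ {ω | 2 * C / n ≤
      (empMean (fun i => f (X i ω)) - ∫ x, f x ∂μ) ^ 2}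
    rw [h4, measure_univ] at h5
    have h6 : P Eᶜ + P {ω | 2 * C / n ≤ (empMean (fun i => f (X i ω)) - ∫ x, f x ∂μ) ^ 2}
        < 2⁻¹ + 2⁻¹ := ENNReal.add_lt_add_of_lt_of_le (by finiteness) hE h1
    rw [ENNReal.inv_two_add_inv_two] at h6
    exact absurd h5 (not_le.2 h6)
  simp only [Set.mem_union, Set.mem_compl_iff, Set.mem_ofPred_eq, not_or, not_not, not_le] at hω
  have h4 := Real.abs_le_sqrt hω.2.le
  have h5 := abs_le.1 (hb ω hω.1)
  rw [abs_le] at h4 ⊢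
  constructor <;> linarith [h4.1, h4.2, h5.1, h5.2]

variable [IsProbabilityMeasure μ] {p r : ℕ} {Θ : Set (Fin p → ℝ)} {g : 𝒳 → (Fin p → ℝ) → Fin r → ℝ} {θ₀ : Fin p → ℝ}
  {M C C₁ K : ℝ}

/-- The slack `C₁ / 4 * δ` is what makes the exponent uniform in `δ`: its square against `M(pδ)²`
contributes `n / p² ≥ √n`, and `1/√n` squared against `√(2C)/√n` also contributes `√n`, up to
constants. The population second moment is bounded through `E`. -/
lemma measure_signed_deviation_le (hn : 0 < n) (hX : ∀ i, HasLaw (X i) μ P) (hI : iIndepFun X P)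
    {h : 𝒳 → ℝ} (hm : Measurable h) (hh : MemLp h 2 μ) (hh2 : MemLp (fun x => h x ^ 2) 2 μ)
    (hM : 0 < M) (hC : 0 < C) (hC₁ : 0 < C₁) (hC4 : ∫ x, (h x ^ 2) ^ 2 ∂μ ≤ C) (hE : P Eᶜ < 2⁻¹)
    {δ : ℝ} (hδ : 0 ≤ δ) (hpn : p ^ 4 ≤ n)
    (hb : ∀ ω ∈ E, empMean (fun i => h (X i ω) ^ 2) ≤ M * (p * δ) ^ 2) :
    P (E ∩ {ω | C₁ / 4 * δ + 1 / √n ≤ empMean (fun i => h (X i ω)) - ∫ x, h x ∂μ})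
      ≤ ENNReal.ofReal (Real.exp
          (-(min (C₁ ^ 2 / (128 * M)) (1 / (4 * √(2 * C))) * √n))) := by
  have hn' : (0 : ℝ) < n := by exact_mod_cast hn
  set q := √(n : ℝ) with hq
  have hq0 : 0 < q := Real.sqrt_pos.2 hn'
  have hqq : q ^ 2 = n := Real.sq_sqrt hn'.le
  set C' := √(2 * C) with hC'
  have hC'0 : 0 < C' := Real.sqrt_pos.2 (by positivity)
  have hpop : ∫ x, h x ^ 2 ∂μ ≤ M * (p * δ) ^ 2 + C' / q := by
    have h1 := abs_integral_le_of_event hn hX hI (hm.pow_const 2) hh2 hC hC4 hE (fun ω hω => by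
      rw [abs_of_nonneg (empMean_nonneg fun i => sq_nonneg _)]
      exact hb ω hω)
    rw [Real.sqrt_div (by positivity)] at h1
    exact (le_abs_self _).trans h1
  set t := C₁ / 4 * δ + 1 / q with ht
  have ht0 : 0 < t := by positivity
  set B := 2 * (M * (p * δ) ^ 2) + C' / q with hB
  have hB0 : 0 < B := by positivity
  have htail := measure_selfNormalized_le hX hI hm hh ht0 hB0
  refine ((measure_mono ?_).trans htail).trans (ENNReal.ofReal_le_ofReal (Real.exp_le_exp.2 ?_))
  · rintro ω ⟨hωE, hω⟩
    have h1 := hb ω hωE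
    simp only [Set.mem_ofPred_eq, empMean] at hω h1 ⊢
    rw [inv_mul_le_iff₀ hn'] at h1
    constructor
    · have := mul_le_mul_of_nonneg_left hω hn'.le
      rw [mul_sub, mul_inv_cancel_left₀ hn'.ne'] at this
      exact this
    · have := mul_le_mul_of_nonneg_left hpop hn'.le
      rw [hB]; linarith
  · rw [neg_le_neg_iff, le_div_iff₀ (by positivity)]
    set κ := min (C₁ ^ 2 / (128 * M)) (1 / (4 * C')) with hκ
    have hκ0 : 0 < κ := by positivity
    have hκ1 : κ * (128 * M) ≤ C₁ ^ 2 := by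
      rw [← le_div_iff₀ (by positivity)]; exact min_le_left _ _
    have hκ2 : κ * (4 * C') ≤ 1 := by
      rw [← le_div_iff₀ (by positivity)]; exact min_le_right _ _
    have hp2 : (p : ℝ) ^ 2 ≤ q := by
      apply Real.le_sqrt_of_sq_le
      rw [← pow_mul]
      exact_mod_cast hpn
    have e1 : κ * q * (4 * B) = κ * (128 * M) / 16 * (q * p ^ 2) * δ ^ 2 + κ * (4 * C') := by
      rw [hB]; field_simp; ring
    have e2 : (C₁ / 4 * δ) ^ 2 + (1 / q) ^ 2 ≤ t ^ 2 := by
      rw [ht]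
      have : 0 ≤ C₁ / 4 * δ * (1 / q) := by positivity
      nlinarith
    calc κ * q * (4 * B) = κ * (128 * M) / 16 * (q * p ^ 2) * δ ^ 2 + κ * (4 * C') := e1
      _ ≤ C₁ ^ 2 / 16 * (q * q) * δ ^ 2 + 1 := by gcongr
      _ = n * ((C₁ / 4 * δ) ^ 2 + (1 / q) ^ 2) := by rw [← hqq]; field_simp; ring
      _ ≤ n * t ^ 2 := by gcongr

/-- Uniform law of large numbers, with a slack proportional to the distance from `θ₀`. -/
theorem measure_uniform_deviation_le (hn : 0 < n) (hX : ∀ i, HasLaw (X i) μ P)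
    (hI : iIndepFun X P) (hg : ∀ θ ∈ Θ, ∀ j, Measurable fun x => g x θ j)
    (hg4 : ∀ θ ∈ Θ, ∀ j, MemLp (fun x => g x θ j) 4 μ) (hM : 0 < M) (hC : 1 ≤ C) (hC₁ : 0 < C₁)
    (hC4 : ∀ θ ∈ Θ, ∀ j, ∫ x, g x θ j ^ 4 ∂μ ≤ C) (hθ₀ : θ₀ ∈ Θ) (hmean : popMean μ g θ₀ = 0)
    (hE : P Eᶜ < 2⁻¹) (hpn : p ^ 4 ≤ n) (hMn : M ≤ n) (hC₁n : C₁ ≤ n)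
    (hinc : ∀ ω ∈ E, ∀ θ ∈ Θ, ∀ θ' ∈ Θ, ∀ j,
      empMean (fun i => (g (X i ω) θ' j - g (X i ω) θ j) ^ 2) ≤ M * (p * ‖θ' - θ‖) ^ 2)
    (hK : ∀ θ ∈ Θ, ‖θ - θ₀‖ ≤ K) {m : ℕ} (hm : 2 * K * n ^ 2 < m) :
    P {ω | ¬ ∀ θ ∈ Θ, ∀ j, |gbar (fun i θ => g (X i ω) θ) θ j
        - gbar (fun i θ => g (X i ω) θ) θ₀ j - popMean μ g θ j|
          ≤ C₁ / 2 * ‖θ - θ₀‖ + (4 + √(8 * C)) / √n}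
      ≤ P Eᶜ + ENNReal.ofReal (2 * (m ^ p) * r * Real.exp
          (-(min (C₁ ^ 2 / (128 * M)) (1 / (4 * √(2 * (16 * C)))) * √n))) := by
  have hn' : (0 : ℝ) < n := by exact_mod_cast hn
  have hn1 : (1 : ℝ) ≤ n := by exact_mod_cast hn
  set q := √(n : ℝ) with hq
  have hq0 : 0 < q := Real.sqrt_pos.2 hn'
  have hqq : q ^ 2 = n := Real.sq_sqrt hn'.le
  have hq1 : 1 ≤ q := Real.one_le_sqrt.2 hn1
  -- At this mesh the sample increments within a cell are at most `√M * p * η ≤ 1/√n`, because `M ≤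
  -- n` and `p ≤ n`.
  set η : ℝ := 1 / n ^ 2 with hη
  have hη0 : 0 < η := by positivity
  obtain ⟨rep, hrep, hcov⟩ := exists_grid hθ₀ hη0 hK (m := m) (by
    rw [hη, div_div_eq_mul_div, div_one]; exact hm)
  set bnd := ENNReal.ofReal (Real.exp
      (-(min (C₁ ^ 2 / (128 * M)) (1 / (4 * √(2 * (16 * C)))) * q))) with hbnd
  have hmem2 : ∀ θ ∈ Θ, ∀ j, MemLp (fun x => g x θ j) 2 μ := fun θ hθ j =>
    (hg4 θ hθ j).mono_exponent (by norm_num)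
  have hint : ∀ θ ∈ Θ, ∀ j, Integrable (fun x => g x θ j) μ := fun θ hθ j =>
    (hmem2 θ hθ j).integrable (by norm_num)
  have hdm : ∀ θ ∈ Θ, ∀ θ' ∈ Θ, ∀ j, Measurable fun x => g x θ' j - g x θ j :=
    fun θ hθ θ' hθ' j => (hg θ' hθ' j).sub (hg θ hθ j)
  have hd4 : ∀ θ ∈ Θ, ∀ θ' ∈ Θ, ∀ j, MemLp (fun x => g x θ' j - g x θ j) 4 μ :=
    fun θ hθ θ' hθ' j => (hg4 θ' hθ' j).sub (hg4 θ hθ j)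
  have hd2 : ∀ θ ∈ Θ, ∀ θ' ∈ Θ, ∀ j, MemLp (fun x => g x θ' j - g x θ j) 2 μ :=
    fun θ hθ θ' hθ' j => (hd4 θ hθ θ' hθ' j).mono_exponent (by norm_num)
  have hd22 : ∀ θ ∈ Θ, ∀ θ' ∈ Θ, ∀ j, MemLp (fun x => (g x θ' j - g x θ j) ^ 2) 2 μ :=
    fun θ hθ θ' hθ' j => memLp_sq_of_memLp_four (hd4 θ hθ θ' hθ' j)
  have hi4 : ∀ θ ∈ Θ, ∀ j, Integrable (fun x => g x θ j ^ 4) μ := fun θ hθ j =>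
    integrable_pow_four (hg4 θ hθ j)
  have hdC : ∀ θ ∈ Θ, ∀ θ' ∈ Θ, ∀ j, ∫ x, ((g x θ' j - g x θ j) ^ 2) ^ 2 ∂μ ≤ 16 * C :=
    fun θ hθ θ' hθ' j => by
      calc ∫ x, ((g x θ' j - g x θ j) ^ 2) ^ 2 ∂μ
          ≤ ∫ x, (8 * g x θ' j ^ 4 + 8 * g x θ j ^ 4) ∂μ := by
            refine integral_mono (hd22 θ hθ θ' hθ' j).integrable_sq
              (((hi4 θ' hθ' j).const_mul 8).add ((hi4 θ hθ j).const_mul 8)) fun x => ?_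
            generalize g x θ' j = a
            generalize g x θ j = b
            have h1 : (a - b) ^ 2 ≤ 2 * (a ^ 2 + b ^ 2) := by nlinarith [sq_nonneg (a + b)]
            have h2 := pow_le_pow_left₀ (sq_nonneg (a - b)) h1 2
            change ((a - b) ^ 2) ^ 2 ≤ 8 * a ^ 4 + 8 * b ^ 4
            nlinarith [sq_nonneg (a ^ 2 - b ^ 2)]
        _ = 8 * ∫ x, g x θ' j ^ 4 ∂μ + 8 * ∫ x, g x θ j ^ 4 ∂μ := by
            rw [integral_add ((hi4 θ' hθ' j).const_mul 8) ((hi4 θ hθ j).const_mul 8),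
              integral_const_mul, integral_const_mul]
        _ ≤ 16 * C := by linarith [hC4 θ hθ j, hC4 θ' hθ' j]
  have hdC2 : ∀ θ ∈ Θ, ∀ θ' ∈ Θ, ∀ j, ∫ x, (g x θ' j - g x θ j) ^ 2 ∂μ ≤ 4 * C :=
    fun θ hθ θ' hθ' j => by
      have hi2 : Integrable (fun x => (g x θ' j - g x θ j) ^ 2) μ := (hd2 θ hθ θ' hθ' j).integrable_sq
      have hi22 : Integrable (fun x => ((g x θ' j - g x θ j) ^ 2) ^ 2) μ :=
        (hd22 θ hθ θ' hθ' j).integrable_sq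
      calc ∫ x, (g x θ' j - g x θ j) ^ 2 ∂μ
          ≤ ∫ x, (2 + 1 / 8 * ((g x θ' j - g x θ j) ^ 2) ^ 2) ∂μ := by
            refine integral_mono hi2 ((integrable_const _).add (hi22.const_mul _)) fun x => ?_
            generalize (g x θ' j - g x θ j) ^ 2 = y
            change y ≤ 2 + 1 / 8 * y ^ 2
            nlinarith [sq_nonneg (y - 4)]
        _ = 2 + 1 / 8 * ∫ x, ((g x θ' j - g x θ j) ^ 2) ^ 2 ∂μ := by
            rw [integral_add (integrable_const _) (hi22.const_mul _), integral_const_mul]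
            simp
        _ ≤ 4 * C := by linarith [hdC θ hθ θ' hθ' j]
  -- the bad event on the grid
  set bad : (Fin p → Fin m) → Fin r → Set Ω := fun c j =>
    (E ∩ {ω | C₁ / 4 * ‖rep c - θ₀‖ + 1 / q ≤ empMean (fun i => g (X i ω) (rep c) j
        - g (X i ω) θ₀ j) - ∫ x, (g x (rep c) j - g x θ₀ j) ∂μ}) ∪
    (E ∩ {ω | C₁ / 4 * ‖rep c - θ₀‖ + 1 / q ≤ empMean (fun i => g (X i ω) θ₀ j
        - g (X i ω) (rep c) j) - ∫ x, (g x θ₀ j - g x (rep c) j) ∂μ}) with hbad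
  have hbadP : ∀ c j, P (bad c j) ≤ 2 * bnd := fun c j => by
    rw [two_mul]
    refine (measure_union_le _ _).trans (add_le_add ?_ ?_)
    · exact measure_signed_deviation_le (p := p) hn hX hI (hdm _ hθ₀ _ (hrep c) j)
        (hd2 _ hθ₀ _ (hrep c) j) (hd22 _ hθ₀ _ (hrep c) j) hM (by positivity) hC₁
        (hdC _ hθ₀ _ (hrep c) j) hE (norm_nonneg _) hpn fun ω hω => hinc ω hω _ hθ₀ _ (hrep c) j
    · refine measure_signed_deviation_le (p := p) hn hX hI (hdm _ (hrep c) _ hθ₀ j)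
        (hd2 _ (hrep c) _ hθ₀ j) (hd22 _ (hrep c) _ hθ₀ j) hM (by positivity) hC₁
        (hdC _ (hrep c) _ hθ₀ j) hE (norm_nonneg _) hpn fun ω hω => ?_
      rw [norm_sub_rev]
      exact hinc ω hω _ (hrep c) _ hθ₀ j
  have hunion : P (⋃ c, ⋃ j, bad c j) ≤ ENNReal.ofReal (2 * (m ^ p) * r * Real.exp
          (-(min (C₁ ^ 2 / (128 * M)) (1 / (4 * √(2 * (16 * C)))) * q))) := by
    calc P (⋃ c, ⋃ j, bad c j) ≤ ∑ _c : Fin p → Fin m, ∑ _j : Fin r, 2 * bnd := by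
          refine (measure_iUnion_fintype_le _ _).trans (Finset.sum_le_sum fun c _ => ?_)
          exact (measure_iUnion_fintype_le _ _).trans (Finset.sum_le_sum fun j _ => hbadP c j)
      _ = ENNReal.ofReal (2 * (m ^ p) * r) * bnd := by
          rw [ENNReal.ofReal_mul (by positivity), ENNReal.ofReal_mul (by positivity),
            ENNReal.ofReal_pow (by positivity), ENNReal.ofReal_natCast, ENNReal.ofReal_natCast]
          simp
          ring
      _ = _ := by rw [hbnd, ← ENNReal.ofReal_mul (by positivity)]
  refine (measure_mono ?_).trans ((measure_union_le Eᶜ (⋃ c, ⋃ j, bad c j)).trans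
    (add_le_add_right hunion _))
  intro ω hω
  by_contra hcon
  simp only [Set.mem_union, Set.mem_compl_iff, not_or, not_not, Set.mem_iUnion, not_exists]
    at hcon
  obtain ⟨hωE, hgood⟩ := hcon
  refine hω fun θ hθ j => ?_
  obtain ⟨c, hc⟩ := hcov θ hθ
  set ν := rep c with hν
  have hνΘ : ν ∈ Θ := hrep c
  have hg1 := hgood c j
  simp only [hbad, Set.mem_union, Set.mem_inter_iff, hωE, true_and, Set.mem_ofPred_eq, not_or,
    not_le] at hg1
  obtain ⟨hg1, hg2⟩ := hg1
  rw [empMean_sub, integral_sub (hint ν hνΘ j) (hint θ₀ hθ₀ j)] at hg1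
  rw [empMean_sub, integral_sub (hint θ₀ hθ₀ j) (hint ν hνΘ j)] at hg2
  have h0 : ∫ x, g x θ₀ j ∂μ = 0 := congrFun hmean j
  rw [h0] at hg1 hg2
  have hpn2 : (p : ℝ) ≤ n := by
    have : p ≤ p ^ 4 := Nat.le_self_pow (by norm_num) p
    exact_mod_cast this.trans hpn
  have hsM : √M ≤ q := Real.sqrt_le_sqrt hMn
  have hpη : √M * (p * η) ≤ 1 / q := by
    calc √M * (p * η) ≤ q * (n * (1 / n ^ 2)) := by rw [hη]; gcongr
      _ = 1 / q := by rw [← hqq]; field_simp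
  have hC₁η : C₁ / 4 * η ≤ 1 / q := by
    have h1 : C₁ / 4 * η ≤ n * (1 / n ^ 2) := by
      rw [hη]; gcongr; linarith
    refine h1.trans ?_
    rw [← hqq]
    rw [show q ^ 2 * (1 / (q ^ 2) ^ 2) = 1 / q * (1 / q) by field_simp]
    exact mul_le_of_le_one_right (by positivity) ((div_le_one hq0).2 hq1)
  have hnorm : ‖θ - ν‖ ≤ η := hc
  have hsq : ∀ ω' ∈ E, |empMean fun i => g (X i ω') θ j - g (X i ω') ν j| ≤ √M * (p * η) :=
    fun ω' hω' => by
      refine abs_empMean_le_of_sq _ (by positivity) ?_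
      rw [mul_pow, Real.sq_sqrt hM.le]
      refine (hinc ω' hω' ν hνΘ θ hθ j).trans ?_
      gcongr
  have hs1 := hsq ω hωE
  have hs2 := abs_integral_le_of_event hn hX hI (hdm ν hνΘ θ hθ j) (hd2 ν hνΘ θ hθ j)
    (C := 4 * C) (by positivity) (hdC2 ν hνΘ θ hθ j) hE hsq
  rw [integral_sub (hint θ hθ j) (hint ν hνΘ j), Real.sqrt_div (by positivity),
    show 2 * (4 * C) = 8 * C by ring] at hs2
  rw [empMean_sub] at hs1
  have hδν : ‖ν - θ₀‖ ≤ ‖θ - θ₀‖ + η := by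
    have : ν - θ₀ = (θ - θ₀) - (θ - ν) := by abel
    rw [this]
    exact (norm_sub_le _ _).trans (by linarith)
  have hδν' := mul_le_mul_of_nonneg_left hδν (by positivity : 0 ≤ C₁ / 4)
  have hC₁δ : 0 ≤ C₁ / 4 * ‖θ - θ₀‖ := by positivity
  -- The four units of `1/√n` are the sample and population discretisation, the deviation on the
  -- grid, and the slack change `C₁ / 4 * η`; `√(8C)/√n` is the Chebyshev cost for the population
  -- increment.
  have e1 : (4 + √(8 * C)) / q = 4 * (1 / q) + √(8 * C) / q := by ring
  rw [e1]
  change |empMean (fun i => g (X i ω) θ j) - empMean (fun i => g (X i ω) θ₀ j)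
    - ∫ x, g x θ j ∂μ| ≤ _
  rw [abs_le] at hs1 hs2 ⊢
  constructor <;> linarith [hs1.1, hs1.2, hs2.1, hs2.2]

end ULLN

/-! ### Central limit theorem for triangular arrays -/

/-- The Taylor remainder is at most `4|x|³`, which `2|x|e ≤ e² + x²` splits into second and fourth
powers. Only these moments then enter, and `e` is free to tend to zero. -/
lemma norm_exp_mul_I_sub_taylor_le {x : ℝ} {e : ℝ} (he : 0 < e) :
    ‖Complex.exp (x * Complex.I) - (1 + x * Complex.I - x ^ 2 / 2)‖
      ≤ 2 * (e * x ^ 2 + x ^ 4 / e) := by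
  have hx4 : 4 * |x| ^ 3 ≤ 2 * (e * x ^ 2 + x ^ 4 / e) := by
    have h1 : 2 * |x| * e ≤ e ^ 2 + x ^ 2 := by nlinarith [sq_nonneg (e - |x|), sq_abs x]
    have h2 : e * x ^ 2 + x ^ 4 / e = x ^ 2 * (e ^ 2 + x ^ 2) / e := by field_simp
    rw [h2, ← sub_nonneg]
    have h3 : 2 * (x ^ 2 * (e ^ 2 + x ^ 2) / e) - 4 * |x| ^ 3
        = 2 * x ^ 2 * (e ^ 2 + x ^ 2 - 2 * |x| * e) / e := by
      have : |x| ^ 3 = |x| * x ^ 2 := by rw [← sq_abs]; ring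
      rw [this]; field_simp; ring
    rw [h3]
    have := sub_nonneg.2 h1
    positivity
  refine le_trans ?_ hx4
  have hn : ‖(x : ℂ) * Complex.I‖ = |x| := by simp
  by_cases h : |x| ≤ 1
  · have h1 := Complex.exp_bound (x := x * Complex.I) (by rw [hn]; exact h) (n := 3) (by norm_num)
    rw [hn] at h1
    have h2 : ∑ m ∈ Finset.range 3, ((x : ℂ) * Complex.I) ^ m / (m.factorial : ℂ)
        = 1 + x * Complex.I - x ^ 2 / 2 := by
      simp only [Finset.sum_range_succ, Finset.range_zero, Finset.sum_empty, Nat.factorial]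
      simp [mul_pow, Complex.I_sq]
      ring
    rw [h2] at h1
    refine h1.trans ?_
    have : 0 ≤ |x| ^ 3 := by positivity
    norm_num [Nat.factorial]
    linarith
  · push Not at h
    have h1 : ‖Complex.exp (x * Complex.I) - (1 + x * Complex.I - x ^ 2 / 2)‖
        ≤ 1 + (1 + |x| + |x| ^ 2 / 2) := by
      refine (norm_sub_le _ _).trans (add_le_add (Complex.norm_exp_ofReal_mul_I x).le ?_)
      refine (norm_sub_le _ _).trans (add_le_add ((norm_add_le _ _).trans (by simp)) ?_)
      simp
    refine h1.trans ?_
    have h2 : |x| ≤ |x| ^ 3 := le_self_pow₀ h.le (by norm_num)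
    have h3 : |x| ^ 2 ≤ |x| ^ 3 := pow_le_pow_right₀ h.le (by norm_num)
    nlinarith

section Lyapunov

variable {Ω 𝒳 : Type*} [MeasurableSpace Ω] [MeasurableSpace 𝒳] {P : Measure Ω}
  {μ : Measure 𝒳} {n : ℕ} {X : Fin n → Ω → 𝒳}

lemma norm_integral_exp_sub_le [IsProbabilityMeasure μ] (hn : 0 < n) {Y : 𝒳 → ℝ}
    (hY4 : MemLp Y 4 μ) (h1 : ∫ x, Y x ∂μ = 0) (h2 : ∫ x, Y x ^ 2 ∂μ = 1) {β : ℝ}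
    (hβ : 0 < β) (h4 : ∫ x, Y x ^ 4 ∂μ ≤ n * β ^ 2) (t : ℝ) :
    ‖∫ x, Complex.exp ((t * (√n)⁻¹ * Y x : ℝ) * Complex.I) ∂μ - (1 + (-(t ^ 2 / 2) : ℂ) / n)‖
      ≤ 2 * (t ^ 2 + t ^ 4) * β * ‖1 / (n : ℂ)‖ := by
  have hn' : (0 : ℝ) < n := by exact_mod_cast hn
  set s : ℝ := t * (√n)⁻¹ with hs
  have hs2 : s ^ 2 = t ^ 2 / n := by
    rw [hs, mul_pow, inv_pow, Real.sq_sqrt hn'.le]; rfl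
  have hY1 : Integrable Y μ := hY4.integrable (by norm_num)
  have hY2 : Integrable (fun x => Y x ^ 2) μ := (hY4.mono_exponent (by norm_num)).integrable_sq
  have hY4' := integrable_pow_four hY4
  have hexp : Integrable (fun x => Complex.exp ((s * Y x : ℝ) * Complex.I)) μ := by
    refine Integrable.of_bound ?_ 1 (ae_of_all _ fun x => (Complex.norm_exp_ofReal_mul_I _).le)
    have : AEMeasurable Y μ := hY4.1.aemeasurable
    exact AEMeasurable.aestronglyMeasurable (by fun_prop)
  have hi1 : Integrable (fun x => ((s * Y x : ℝ) : ℂ) * Complex.I) μ :=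
    ((hY1.const_mul s).ofReal).mul_const _
  have hi2 : Integrable (fun x => ((s * Y x : ℝ) : ℂ) ^ 2 / 2) μ := by
    have : Integrable (fun x => (((s * Y x) ^ 2 / 2 : ℝ) : ℂ)) μ := by
      refine Integrable.ofReal ?_
      simp only [mul_pow]
      exact (hY2.const_mul _).div_const _
    refine this.congr (ae_of_all _ fun x => by push_cast; ring)
  have hc : Integrable (fun _ : 𝒳 => (1 : ℂ)) μ := integrable_const _
  have hT : Integrable (fun x => 1 + ((s * Y x : ℝ) : ℂ) * Complex.I
      - ((s * Y x : ℝ) : ℂ) ^ 2 / 2) μ := (hc.add hi1).sub hi2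
  have hTi : ∫ x, (1 + ((s * Y x : ℝ) : ℂ) * Complex.I - ((s * Y x : ℝ) : ℂ) ^ 2 / 2) ∂μ
      = 1 + (-(t ^ 2 / 2) : ℂ) / n := by
    have hadd : Integrable (fun x => 1 + ((s * Y x : ℝ) : ℂ) * Complex.I) μ := hc.add hi1
    have e1 : ∫ x, ((s * Y x : ℝ) : ℂ) ∂μ = ((∫ x, s * Y x ∂μ : ℝ) : ℂ) := integral_ofReal
    rw [integral_sub hadd hi2, integral_add hc hi1, integral_mul_const, e1,
      integral_const_mul, h1]
    have e2 : ∫ x, ((s * Y x : ℝ) : ℂ) ^ 2 / 2 ∂μ = ((s ^ 2 / 2 : ℝ) : ℂ) := by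
      have : ∀ x, ((s * Y x : ℝ) : ℂ) ^ 2 / 2 = ((s ^ 2 / 2 * Y x ^ 2 : ℝ) : ℂ) := fun x => by
        push_cast; ring
      have e3 : ∫ x, ((s ^ 2 / 2 * Y x ^ 2 : ℝ) : ℂ) ∂μ
        = ((∫ x, s ^ 2 / 2 * Y x ^ 2 ∂μ : ℝ) : ℂ) := integral_ofReal
      simp only [this]
      rw [e3, integral_const_mul, h2, mul_one]
    rw [e2, hs2]
    simp
    ring
  rw [← hTi, ← integral_sub hexp hT]
  have hbd : Integrable (fun x => 2 * (β * (s * Y x) ^ 2 + (s * Y x) ^ 4 / β)) μ := by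
    simp only [mul_pow]
    exact (((hY2.const_mul _).const_mul β).add ((hY4'.const_mul _).div_const β)).const_mul 2
  refine (norm_integral_le_of_norm_le hbd (ae_of_all _ fun x =>
    norm_exp_mul_I_sub_taylor_le hβ)).trans ?_
  have e3 : ∫ x, 2 * (β * (s * Y x) ^ 2 + (s * Y x) ^ 4 / β) ∂μ
      = 2 * (β * s ^ 2 + s ^ 4 / β * ∫ x, Y x ^ 4 ∂μ) := by
    have : ∀ x, 2 * (β * (s * Y x) ^ 2 + (s * Y x) ^ 4 / β)
      = 2 * β * s ^ 2 * Y x ^ 2 + 2 * s ^ 4 / β * Y x ^ 4 := fun x => by ring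
    simp only [this]
    rw [integral_add (hY2.const_mul _) (hY4'.const_mul _), integral_const_mul, integral_const_mul,
      h2]
    ring
  rw [e3]
  have e4 : s ^ 4 = t ^ 4 / n ^ 2 := by
    rw [show s ^ 4 = (s ^ 2) ^ 2 by ring, hs2]; ring
  have e5 : ‖1 / (n : ℂ)‖ = 1 / n := by simp
  rw [e4, hs2, e5]
  calc 2 * (β * (t ^ 2 / n) + t ^ 4 / n ^ 2 / β * ∫ x, Y x ^ 4 ∂μ)
      ≤ 2 * (β * (t ^ 2 / n) + t ^ 4 / n ^ 2 / β * (n * β ^ 2)) := by gcongr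
    _ = _ := by field_simp

lemma integral_exp_empMean (hn : 0 < n) (hX : ∀ i, HasLaw (X i) μ P) (hI : iIndepFun X P)
    {Y : 𝒳 → ℝ} (hm : Measurable Y) (t : ℝ) :
    ∫ ω, Complex.exp ((t * (√n * empMean fun i => Y (X i ω)) : ℝ) * Complex.I) ∂P
      = (∫ x, Complex.exp ((t * (√n)⁻¹ * Y x : ℝ) * Complex.I) ∂μ) ^ n := by
  have hn' : (0 : ℝ) < n := by exact_mod_cast hn
  have h1 : ∀ ω, Complex.exp ((t * (√n * empMean fun i => Y (X i ω)) : ℝ) * Complex.I)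
      = ∏ i, Complex.exp ((t * (√n)⁻¹ * Y (X i ω) : ℝ) * Complex.I) := fun ω => by
    rw [← Complex.exp_sum, ← Finset.sum_mul, ← Complex.ofReal_sum, ← Finset.mul_sum]
    have : √(n : ℝ) * (n : ℝ)⁻¹ = (√n)⁻¹ := by
      rw [← Real.sqrt_div_self, div_eq_mul_inv]
    simp only [empMean]
    rw [← mul_assoc (√(n : ℝ)), this, ← mul_assoc]
  simp only [h1]
  have hfm : Measurable fun x => Complex.exp ((t * (√n)⁻¹ * Y x : ℝ) * Complex.I) := by fun_prop
  rw [hI.integral_fun_prod_comp (f := fun _ x => Complex.exp ((t * (√n)⁻¹ * Y x : ℝ) * Complex.I))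
    (fun i => (hX i).aemeasurable) fun i => hfm.aestronglyMeasurable]
  have h2 : ∀ i, ∫ ω, Complex.exp ((t * (√n)⁻¹ * Y (X i ω) : ℝ) * Complex.I) ∂P
      = ∫ x, Complex.exp ((t * (√n)⁻¹ * Y x : ℝ) * Complex.I) ∂μ := fun i =>
    (hX i).integral_comp (f := fun x => Complex.exp ((t * (√n)⁻¹ * Y x : ℝ) * Complex.I))
      hfm.aestronglyMeasurable
  simp only [h2, Finset.prod_const, Finset.card_univ, Fintype.card_fin]

/-- The integrands differ by at most `|t| * η` off the exceptional set and by at most `2` on it. -/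
lemma norm_integral_exp_sub_integral_exp_le [IsProbabilityMeasure P] {A Z : Ω → ℝ}
    (hA : AEMeasurable A P) (hZ : AEMeasurable Z P) (t : ℝ) {η ε : ℝ} (hη : 0 ≤ η) (hε : 0 ≤ ε)
    (h : P {ω | η < |A ω - Z ω|} ≤ ENNReal.ofReal ε) :
    ‖∫ ω, Complex.exp ((t * A ω : ℝ) * Complex.I) ∂P
      - ∫ ω, Complex.exp ((t * Z ω : ℝ) * Complex.I) ∂P‖ ≤ |t| * η + 2 * ε := by
  have hint : ∀ {W : Ω → ℝ}, AEMeasurable W P →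
      Integrable (fun ω => Complex.exp ((t * W ω : ℝ) * Complex.I)) P := fun {W} hW => by
    refine Integrable.of_bound ?_ 1 (ae_of_all _ fun x => (Complex.norm_exp_ofReal_mul_I _).le)
    exact AEMeasurable.aestronglyMeasurable (by fun_prop)
  rw [← integral_sub (hint hA) (hint hZ)]
  -- The exceptional set is enlarged to a measurable one of equal measure before integrating its
  -- indicator.
  set B := toMeasurable P {ω | η < |A ω - Z ω|} with hB
  have hBm : MeasurableSet B := measurableSet_toMeasurable _ _
  have hBP : P.real B ≤ ε := by
    rw [measureReal_def, hB, measure_toMeasurable]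
    exact ENNReal.toReal_le_of_le_ofReal hε h
  have hbd : Integrable (fun ω => |t| * η + B.indicator (fun _ => (2 : ℝ)) ω) P :=
    (integrable_const _).add ((integrable_const _).indicator hBm)
  refine (norm_integral_le_of_norm_le hbd (ae_of_all _ fun ω => ?_)).trans ?_
  · by_cases hω : ω ∈ B
    · rw [Set.indicator_of_mem hω]
      have h1 := norm_sub_le (Complex.exp ((t * A ω : ℝ) * Complex.I))
        (Complex.exp ((t * Z ω : ℝ) * Complex.I))
      rw [Complex.norm_exp_ofReal_mul_I, Complex.norm_exp_ofReal_mul_I] at h1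
      have : 0 ≤ |t| * η := by positivity
      linarith
    · rw [Set.indicator_of_notMem hω, add_zero]
      have h1 : |A ω - Z ω| ≤ η := by
        by_contra hcon
        exact hω (subset_toMeasurable _ _ (not_le.1 hcon))
      have h2 : Complex.exp ((t * A ω : ℝ) * Complex.I) - Complex.exp ((t * Z ω : ℝ) * Complex.I)
          = Complex.exp ((t * Z ω : ℝ) * Complex.I)
            * (Complex.exp (Complex.I * (t * (A ω - Z ω) : ℝ)) - 1) := by
        rw [mul_sub, ← Complex.exp_add, mul_one]
        congr 2
        push_cast; ring
      rw [h2, norm_mul, Complex.norm_exp_ofReal_mul_I, one_mul]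
      refine (Real.norm_exp_I_mul_ofReal_sub_one_le).trans ?_
      rw [Real.norm_eq_abs, abs_mul]
      exact mul_le_mul_of_nonneg_left h1 (abs_nonneg t)
  · rw [integral_add (integrable_const _) ((integrable_const _).indicator hBm),
      integral_indicator hBm]
    simp
    linarith

end Lyapunov

/-- Sequences of statistics that are asymptotically equal to normalised sums of the rows of a
triangular array, under a fourth moment condition, are asymptotically standard normal. -/
theorem tendstoInDistribution_of_asymptotically_linear {Ω 𝒳 : ℕ → Type*}
    [∀ n, MeasurableSpace (Ω n)] [∀ n, MeasurableSpace (𝒳 n)]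
    {P : ∀ n, Measure (Ω n)} [∀ n, IsProbabilityMeasure (P n)]
    {μ : ∀ n, Measure (𝒳 n)} [∀ n, IsProbabilityMeasure (μ n)]
    {X : ∀ n, Fin n → Ω n → 𝒳 n} (hX : ∀ n i, HasLaw (X n i) (μ n) (P n))
    (hI : ∀ n, iIndepFun (X n) (P n)) {A : ∀ n, Ω n → ℝ} (hA : ∀ n, AEMeasurable (A n) (P n))
    {Y : ∀ n, 𝒳 n → ℝ} {β : ℕ → ℝ} (hβ : Tendsto β atTop (𝓝 0))
    (hY : ∀ᶠ n in atTop, Measurable (Y n) ∧ MemLp (Y n) 4 (μ n) ∧ ∫ x, Y n x ∂(μ n) = 0 ∧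
      ∫ x, Y n x ^ 2 ∂(μ n) = 1 ∧ 0 < β n ∧ ∫ x, Y n x ^ 4 ∂(μ n) ≤ n * β n ^ 2)
    (hclose : ∀ η : ℝ, 0 < η → ∀ ε : ℝ, 0 < ε → ∀ᶠ n in atTop,
      P n {ω | η < |A n ω - √n * empMean fun i => Y n (X n i ω)|} ≤ ENNReal.ofReal ε) :
    TendstoInDistribution A atTop (id : ℝ → ℝ) P (gaussianReal 0 1) where
  forall_aemeasurable := hA
  tendsto := by
    refine ProbabilityMeasure.tendsto_iff_tendsto_charFun.2 fun t => ?_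
    have hlim : charFun ((gaussianReal 0 1).map (id : ℝ → ℝ)) t
        = Complex.exp (-(t ^ 2 / 2)) := by
      rw [Measure.map_id, charFun_gaussianReal]
      simp
    have hcf : ∀ n, charFun ((P n).map (A n)) t
        = ∫ ω, Complex.exp ((t * A n ω : ℝ) * Complex.I) ∂(P n) := fun n => by
      rw [charFun_apply_real, integral_map (hA n)]
      · simp
      · exact (by fun_prop : Measurable fun x : ℝ =>
          Complex.exp ((t : ℂ) * x * Complex.I)).aestronglyMeasurable
    change Tendsto (fun n => charFun ((P n).map (A n)) t) atTop
      (𝓝 (charFun ((gaussianReal 0 1).map (id : ℝ → ℝ)) t))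
    rw [hlim]
    simp only [hcf]
    set f : ℕ → ℂ := fun n => ∫ x, Complex.exp ((t * (√n)⁻¹ * Y n x : ℝ) * Complex.I) ∂(μ n) with hf
    -- Each factor is `1 - t²/(2n)` up to an error `O(β n) / n`, so its `n`-th power has the
    -- Gaussian limit.
    have hfn : Tendsto (fun n => f n ^ n) atTop (𝓝 (Complex.exp (-(t ^ 2 / 2)))) := by
      apply Complex.tendsto_pow_exp_of_isLittleO_sub_add_div
      rw [Asymptotics.isLittleO_iff]
      intro c hc
      have hβ' : Tendsto (fun n => 2 * (t ^ 2 + t ^ 4) * β n) atTop (𝓝 0) := by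
        simpa using hβ.const_mul (2 * (t ^ 2 + t ^ 4))
      filter_upwards [hY, hβ'.eventually_lt_const hc, eventually_gt_atTop 0] with n hn hcn hn0
      obtain ⟨-, h4, h1, h2, hb, h44⟩ := hn
      exact (norm_integral_exp_sub_le hn0 h4 h1 h2 hb h44 t).trans
        (mul_le_mul_of_nonneg_right hcn.le (norm_nonneg _))
    rw [← tendsto_sub_nhds_zero_iff] at hfn ⊢
    have hdiff : Tendsto (fun n => ∫ ω, Complex.exp ((t * A n ω : ℝ) * Complex.I) ∂(P n) - f n ^ n)
        atTop (𝓝 0) := by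
      rw [Metric.tendsto_nhds]
      intro c hc
      have hη : 0 < c / (4 * (|t| + 1)) := by positivity
      filter_upwards [hY, hclose _ hη (c / 8) (by positivity), eventually_gt_atTop 0]
        with n hn hcl hn0
      rw [dist_zero_right, hf]
      dsimp only
      rw [← integral_exp_empMean hn0 (hX n) (hI n) hn.1 t]
      have hZ : AEMeasurable (fun ω => √n * empMean fun i => Y n (X n i ω)) (P n) := by
        simp only [empMean]
        refine ((Finset.aemeasurable_fun_sum _ fun i _ => ?_).const_mul _).const_mul _
        exact hn.1.comp_aemeasurable (hX n i).aemeasurable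
      refine (norm_integral_exp_sub_integral_exp_le (hA n) hZ t hη.le (by positivity) hcl).trans_lt ?_
      have : |t| * (c / (4 * (|t| + 1))) ≤ c / 4 := by
        rw [← mul_div_assoc, div_le_div_iff₀ (by positivity) (by norm_num)]
        nlinarith [abs_nonneg t]
      linarith
    have := hdiff.add hfn
    simpa using this

/-! ### Population moments -/

section Population

variable {𝒳 : Type*} [MeasurableSpace 𝒳] {μ : Measure 𝒳} {p r : ℕ}
  {Θ : Set (Fin p → ℝ)} {θ₀ : Fin p → ℝ} {g : 𝒳 → (Fin p → ℝ) → Fin r → ℝ}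

lemma integrable_of_lintegral_le {f : 𝒳 → ℝ} (hf : AEStronglyMeasurable f μ) (hf0 : ∀ x, 0 ≤ f x)
    {C : ℝ} (h : ∫⁻ x, ENNReal.ofReal (f x) ∂μ ≤ ENNReal.ofReal C) : Integrable f μ := by
  refine ⟨hf, ?_⟩
  rw [hasFiniteIntegral_iff_ofReal (ae_of_all _ hf0)]
  exact h.trans_lt ENNReal.ofReal_lt_top

lemma integral_le_of_lintegral_le {f : 𝒳 → ℝ} (hf : AEStronglyMeasurable f μ) (hf0 : ∀ x, 0 ≤ f x)
    {C : ℝ} (hC : 0 ≤ C) (h : ∫⁻ x, ENNReal.ofReal (f x) ∂μ ≤ ENNReal.ofReal C) :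
    ∫ x, f x ∂μ ≤ C := by
  rw [integral_eq_lintegral_of_nonneg_ae (ae_of_all _ hf0) hf]
  exact ENNReal.toReal_le_of_le_ofReal hC h

lemma lintegral_pow_four_le [IsProbabilityMeasure μ] {f : 𝒳 → ℝ} {γ C : ℝ} (hγ : 4 ≤ γ)
    (hC : 0 ≤ C) (h : ∫⁻ x, ENNReal.ofReal (|f x| ^ γ) ∂μ ≤ ENNReal.ofReal C) :
    ∫⁻ x, ENNReal.ofReal (f x ^ 4) ∂μ ≤ ENNReal.ofReal (1 + C) := by
  calc ∫⁻ x, ENNReal.ofReal (f x ^ 4) ∂μ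
      ≤ ∫⁻ x, (1 + ENNReal.ofReal (|f x| ^ γ)) ∂μ := lintegral_mono fun x => by
        have h0 : (0 : ℝ) ≤ |f x| ^ γ := Real.rpow_nonneg (abs_nonneg _) _
        rw [← ENNReal.ofReal_one, ← ENNReal.ofReal_add zero_le_one h0]
        refine ENNReal.ofReal_le_ofReal ?_
        rcases le_total |f x| 1 with h1 | h1
        · have : |f x| ^ 4 ≤ 1 := pow_le_one₀ (abs_nonneg _) h1
          rw [Even.pow_abs (by decide)] at this
          linarith
        · have : |f x| ^ (4 : ℝ) ≤ |f x| ^ γ := Real.rpow_le_rpow_of_exponent_le h1 hγ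
          rw [show (4 : ℝ) = ((4 : ℕ) : ℝ) by norm_num, Real.rpow_natCast,
            Even.pow_abs (by decide)] at this
          linarith
    _ = 1 + ∫⁻ x, ENNReal.ofReal (|f x| ^ γ) ∂μ := by
        rw [lintegral_add_left measurable_const]; simp
    _ ≤ 1 + ENNReal.ofReal C := by gcongr
    _ = _ := by rw [ENNReal.ofReal_add zero_le_one hC, ENNReal.ofReal_one]

lemma memLp_four_of_lintegral_le {f : 𝒳 → ℝ} (hf : Measurable f) {C : ℝ}
    (h : ∫⁻ x, ENNReal.ofReal (f x ^ 4) ∂μ ≤ ENNReal.ofReal C) : MemLp f 4 μ := by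
  rw [← integrable_norm_rpow_iff hf.aestronglyMeasurable (by norm_num) (by norm_num)]
  refine (integrable_of_lintegral_le (hf.pow_const 4).aestronglyMeasurable
    (fun x => by positivity) h).congr (ae_of_all _ fun x => ?_)
  have : (4 : ENNReal).toReal = ((4 : ℕ) : ℝ) := by simp
  simp only [this, Real.rpow_natCast, Real.norm_eq_abs]
  rw [Even.pow_abs (by decide)]

lemma integral_sq_mul_sq_le {f h : 𝒳 → ℝ} (hf : MemLp f 4 μ) (hh : MemLp h 4 μ) {C : ℝ}
    (hfC : ∫ x, f x ^ 4 ∂μ ≤ C) (hhC : ∫ x, h x ^ 4 ∂μ ≤ C) : ∫ x, (f x * h x) ^ 2 ∂μ ≤ C := by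
  have h1 := integrable_pow_four hf
  have h2 := integrable_pow_four hh
  calc ∫ x, (f x * h x) ^ 2 ∂μ ≤ ∫ x, (2⁻¹ * f x ^ 4 + 2⁻¹ * h x ^ 4) ∂μ := by
        refine integral_mono_of_nonneg (ae_of_all _ fun x => sq_nonneg _)
          ((h1.const_mul _).add (h2.const_mul _)) (ae_of_all _ fun x => ?_)
        nlinarith [sq_nonneg (f x ^ 2 - h x ^ 2)]
    _ = 2⁻¹ * ∫ x, f x ^ 4 ∂μ + 2⁻¹ * ∫ x, h x ^ 4 ∂μ := by
        rw [integral_add (h1.const_mul _) (h2.const_mul _), integral_const_mul, integral_const_mul]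
    _ ≤ C := by linarith

lemma memLp_two_mul {f h : 𝒳 → ℝ} (hf : MemLp f 4 μ) (hh : MemLp h 4 μ) :
    MemLp (fun x => f x * h x) 2 μ := by
  have : ENNReal.HolderTriple 4 4 2 := ⟨by
    rw [← ENNReal.toReal_eq_toReal_iff' (by simp) (by simp), ENNReal.toReal_add (by simp) (by simp)]
    norm_num⟩
  exact hh.mul hf

/-- Let `ε` increase to `‖θ - θ₀‖`; the strict separation condition becomes a linear lower bound. -/
lemma mul_norm_sub_le_of_separated {m : (Fin p → ℝ) → Fin r → ℝ} {C₁ : ℝ} (hC₁ : 0 < C₁)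
    (h : ∀ ε : ℝ, 0 < ε → ∀ θ ∈ Θ, ε < ‖θ - θ₀‖ → C₁ * ε ≤ ‖m θ‖) {θ : Fin p → ℝ} (hθ : θ ∈ Θ) :
    C₁ * ‖θ - θ₀‖ ≤ ‖m θ‖ := by
  rw [← le_div_iff₀' hC₁]
  refine le_of_forall_lt_imp_le_of_dense fun ε hε => ?_
  rcases le_or_gt ε 0 with h0 | h0
  · exact h0.trans (by positivity)
  · rw [le_div_iff₀' hC₁]; exact h ε h0 θ hθ hε

lemma abs_integral_le_of_pow_four [IsProbabilityMeasure μ] {f : 𝒳 → ℝ} (hf : MemLp f 4 μ) {C : ℝ}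
    (hC : ∫ x, f x ^ 4 ∂μ ≤ C) : |∫ x, f x ∂μ| ≤ 1 + C := by
  have h1 := integrable_pow_four hf
  refine abs_integral_le_integral_abs.trans ?_
  calc ∫ x, |f x| ∂μ ≤ ∫ x, (1 + f x ^ 4) ∂μ :=
        integral_mono_of_nonneg (ae_of_all _ fun x => abs_nonneg _)
          ((integrable_const _).add h1) (ae_of_all _ fun x => by
            have := abs_nonneg (f x)
            have e : f x ^ 4 = |f x| ^ 4 := (Even.pow_abs (by decide) _).symm
            simp only [e]
            rcases le_total |f x| 1 with h | h
            · nlinarith [pow_nonneg this 4]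
            · nlinarith [le_self_pow₀ h (by norm_num : 4 ≠ 0)])
    _ = 1 + ∫ x, f x ^ 4 ∂μ := by rw [integral_add (integrable_const _) h1]; simp
    _ ≤ _ := by linarith

lemma transpose_popV (θ : Fin p → ℝ) : (popV μ g θ)ᵀ = popV μ g θ := by
  ext j k; simp [popV, mul_comm]

lemma dotProduct_popV_mulVec {θ : Fin p → ℝ} (h : ∀ j, MemLp (fun x => g x θ j) 2 μ)
    (v w : Fin r → ℝ) :
    v ⬝ᵥ (popV μ g θ *ᵥ w) = ∫ x, (v ⬝ᵥ g x θ) * (w ⬝ᵥ g x θ) ∂μ := by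
  have hi : ∀ j k, Integrable (fun x => g x θ j * g x θ k) μ := fun j k => (h j).integrable_mul (h k)
  have e : ∀ x, (v ⬝ᵥ g x θ) * (w ⬝ᵥ g x θ) = ∑ j, ∑ k, v j * w k * (g x θ j * g x θ k) := by
    intro x
    simp only [dotProduct, Finset.sum_mul_sum]
    exact Finset.sum_congr rfl fun j _ => Finset.sum_congr rfl fun k _ => by ring
  simp only [e]
  rw [integral_finsetSum _ fun j _ => integrable_finsetSum _ fun k _ => (hi j k).const_mul _]
  simp only [dotProduct, mulVec, popV, Matrix.of_apply, Finset.mul_sum]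
  refine Finset.sum_congr rfl fun j _ => ?_
  rw [integral_finsetSum _ fun k _ => (hi j k).const_mul _]
  refine Finset.sum_congr rfl fun k _ => ?_
  rw [integral_const_mul]; ring

lemma memLp_dotProduct {θ : Fin p → ℝ} {q : ENNReal} (h : ∀ j, MemLp (fun x => g x θ j) q μ)
    (w : Fin r → ℝ) : MemLp (fun x => w ⬝ᵥ g x θ) q μ := by
  simp only [dotProduct]
  exact memLp_finsetSum _ fun j _ => (h j).const_mul _

/-- Cauchy–Schwarz twice, at the price of `r²`; this is affordable because only `r²/n → 0` is needed
for the central limit theorem. -/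
lemma integral_dotProduct_pow_four_le {θ : Fin p → ℝ} (h : ∀ j, MemLp (fun x => g x θ j) 4 μ)
    {C : ℝ} (hC : ∀ j, ∫ x, g x θ j ^ 4 ∂μ ≤ C) (w : Fin r → ℝ) :
    ∫ x, (w ⬝ᵥ g x θ) ^ 4 ∂μ ≤ l2 w ^ 4 * (r ^ 2 * C) := by
  have hi : ∀ j, Integrable (fun x => g x θ j ^ 4) μ := fun j => integrable_pow_four (h j)
  calc ∫ x, (w ⬝ᵥ g x θ) ^ 4 ∂μ
      ≤ ∫ x, l2 w ^ 4 * (r * ∑ j, g x θ j ^ 4) ∂μ := by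
        refine integral_mono_of_nonneg (ae_of_all _ fun x => by positivity)
          (((integrable_finsetSum _ fun j _ => hi j).const_mul _).const_mul _)
          (ae_of_all _ fun x => ?_)
        have h1 : (w ⬝ᵥ g x θ) ^ 2 ≤ l2 w ^ 2 * l2 (g x θ) ^ 2 := by
          rw [← mul_pow, ← sq_abs]
          exact pow_le_pow_left₀ (abs_nonneg _) (abs_dotProduct_le _ _) 2
        have h2 : (l2 (g x θ) ^ 2) ^ 2 ≤ r * ∑ j, g x θ j ^ 4 := by
          rw [l2_sq]
          have := sq_sum_le_card_mul_sum_sq (s := (Finset.univ : Finset (Fin r)))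
            (f := fun j => g x θ j ^ 2)
          simp only [Finset.card_univ, Fintype.card_fin, ← pow_mul] at this
          simpa [dotProduct, ← sq] using this
        calc (w ⬝ᵥ g x θ) ^ 4 = ((w ⬝ᵥ g x θ) ^ 2) ^ 2 := by ring
          _ ≤ (l2 w ^ 2 * l2 (g x θ) ^ 2) ^ 2 := pow_le_pow_left₀ (sq_nonneg _) h1 2
          _ = l2 w ^ 4 * (l2 (g x θ) ^ 2) ^ 2 := by ring
          _ ≤ _ := mul_le_mul_of_nonneg_left h2 (pow_nonneg (l2_nonneg _) _)
    _ = l2 w ^ 4 * (r * ∑ j, ∫ x, g x θ j ^ 4 ∂μ) := by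
        rw [integral_const_mul, integral_const_mul, integral_finsetSum _ fun j _ => hi j]
    _ ≤ l2 w ^ 4 * (r * ∑ _j : Fin r, C) := by
        have := pow_nonneg (l2_nonneg w) 4
        gcongr with j; exact hC j
    _ = _ := by
        rw [Finset.sum_const, Finset.card_univ, Fintype.card_fin, nsmul_eq_mul]; ring

/-- At the interior point `θ₀` the derivative is a limit of difference quotients along points of the
ball, each measurable in `x`. -/
lemma measurable_pderivOn {f : 𝒳 → (Fin p → ℝ) → ℝ} {ρ : ℝ} (hρ : 0 < ρ)
    (hball : {θ | ∑ k, (θ k - θ₀ k) ^ 2 ≤ ρ ^ 2} ⊆ Θ) (hnhds : Θ ∈ 𝓝 θ₀)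
    (hf : ∀ θ ∈ Θ, Measurable fun x => f x θ) (hd : ∀ x, DifferentiableOn ℝ (f x) Θ) (k : Fin p) :
    Measurable fun x => pderivOn Θ (f x) k θ₀ := by
  have hmem : ∀ t : ℝ, |t| ≤ ρ → θ₀ + t • Pi.single k 1 ∈ Θ := fun t ht => hball (by
    have e : ∑ i, ((θ₀ + t • (Pi.single k 1 : Fin p → ℝ)) i - θ₀ i) ^ 2 = t ^ 2 := by
      rw [Finset.sum_eq_single k]
      · simp
      · intro b _ hb; simp [Pi.single_eq_of_ne hb]
      · simp
    rw [Set.mem_ofPred_eq, e]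
    exact sq_le_sq' (abs_le.1 ht).1 (abs_le.1 ht).2)
  set t : ℕ → ℝ := fun m => ρ / (m + 1) with ht
  have ht0 : ∀ m, 0 < t m := fun m => by positivity
  have htρ : ∀ m, |t m| ≤ ρ := fun m => by
    rw [abs_of_pos (ht0 m)]
    exact div_le_self hρ.le (by linarith [(Nat.cast_nonneg m : (0:ℝ) ≤ m)])
  have htl : Tendsto t atTop (𝓝[≠] 0) := by
    refine tendsto_nhdsWithin_iff.2 ⟨?_, Eventually.of_forall fun m => (ht0 m).ne'⟩
    exact (tendsto_const_div_atTop_nhds_zero_nat ρ).comp (tendsto_add_atTop_nat 1) |>.congr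
      fun m => by simp [ht]
  refine measurable_of_tendsto_metrizable (f := fun m x =>
    (t m)⁻¹ • (f x (θ₀ + t m • Pi.single k 1) - f x (θ₀ + (0 : ℝ) • Pi.single k 1))) (fun m => ?_) ?_
  · exact ((hf _ (hmem _ (htρ m))).sub (hf _ (hmem 0 (by simpa using hρ.le)))).const_mul (t m)⁻¹
  · rw [tendsto_pi_nhds]
    intro x
    have h0 : θ₀ ∈ Θ := mem_of_mem_nhds hnhds
    have h1 : HasFDerivAt (f x) (fderivWithin ℝ (f x) Θ θ₀) θ₀ :=
      ((hd x θ₀ h0).hasFDerivWithinAt).hasFDerivAt hnhds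
    have h2 : HasDerivAt (fun s : ℝ => f x (θ₀ + s • Pi.single k 1))
        (fderivWithin ℝ (f x) Θ θ₀ (Pi.single k 1)) 0 := h1.hasLineDerivAt (Pi.single k 1)
    have := (hasDerivAt_iff_tendsto_slope_zero.1 h2).comp htl
    simpa [Function.comp_def, pderivOn] using this

lemma mul_l2_le_of_lamMin_matQ {c : ℝ} (hc : 0 ≤ c) (h : c ≤ lamMin (matQ μ Θ g θ₀))
    (v : Fin p → ℝ) : √c * l2 v ≤ l2 (popGrad μ Θ g θ₀ *ᵥ v) := by
  have hH : (matQ μ Θ g θ₀).IsHermitian := by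
    simp [matQ, outer, Matrix.IsHermitian, Matrix.conjTranspose_eq_transpose_of_trivial,
      Matrix.transpose_mul]
  have h1 := lamMin_mul_le hH v
  have h2 : v ⬝ᵥ (matQ μ Θ g θ₀ *ᵥ v) = l2 (popGrad μ Θ g θ₀ *ᵥ v) ^ 2 := by
    rw [l2_sq, matQ, outer, transpose_transpose, ← mulVec_mulVec, dotProduct_mulVec,
      vecMul_transpose]
  rw [l2, ← Real.sqrt_mul hc]
  refine Real.sqrt_le_iff.2 ⟨l2_nonneg _, ?_⟩
  rw [← h2]
  exact (mul_le_mul_of_nonneg_right h (dotProduct_self_nonneg' v)).trans h1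

/-- The bound makes the matrix injective, so there are at least as many moments as parameters. -/
lemma le_of_mul_l2_le {B : Matrix (Fin r) (Fin p) ℝ} {c : ℝ} (hc : 0 < c)
    (h : ∀ v, c * l2 v ≤ l2 (B *ᵥ v)) : p ≤ r := by
  have hinj : Function.Injective B.mulVecLin := by
    rw [injective_iff_map_eq_zero]
    intro v hv
    have h1 := h v
    rw [show B *ᵥ v = 0 from hv, l2_zero] at h1
    exact l2_eq_zero (le_antisymm (by
      by_contra hlt; push Not at hlt; nlinarith [mul_pos hc hlt]) (l2_nonneg v))
  simpa using LinearMap.finrank_le_finrank_of_injective hinj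

end Population

/-! ### Typical samples -/

section SampleMatrices

variable {𝒳 : Type*} {n p r : ℕ} {g : 𝒳 → (Fin p → ℝ) → Fin r → ℝ}

lemma isHermitian_empV (x : Fin n → 𝒳) (θ : Fin p → ℝ) : (empV g x θ).IsHermitian := by
  ext j k
  simp [empV, mul_comm]

lemma dotProduct_empV_mulVec (x : Fin n → 𝒳) (θ : Fin p → ℝ) (v : Fin r → ℝ) :
    v ⬝ᵥ (empV g x θ *ᵥ v) = empMean fun i => (v ⬝ᵥ g (x i) θ) ^ 2 := by
  have e : ∀ i, (v ⬝ᵥ g (x i) θ) ^ 2 = ∑ j, ∑ k, v j * v k * (g (x i) θ j * g (x i) θ k) := by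
    intro i
    simp only [dotProduct, sq, Finset.sum_mul_sum]
    exact Finset.sum_congr rfl fun j _ => Finset.sum_congr rfl fun k _ => by ring
  rw [funext e]
  simp only [empMean_sum, empMean_const_mul, dotProduct, mulVec, empV, Matrix.of_apply,
    Finset.mul_sum]
  exact Finset.sum_congr rfl fun j _ => Finset.sum_congr rfl fun k _ => by ring

end SampleMatrices

section Typical

variable {Ω 𝒳 : Type*} [MeasurableSpace Ω] [MeasurableSpace 𝒳] {P : Measure Ω} {μ : Measure 𝒳}
  {n p r : ℕ} {X : Fin n → Ω → 𝒳}
  {Θ : Set (Fin p → ℝ)} {θ₀ : Fin p → ℝ} {g : 𝒳 → (Fin p → ℝ) → Fin r → ℝ}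

lemma mem_nhds_of_ball_subset {ρ : ℝ} (hρ : 0 < ρ)
    (hball : {θ | ∑ k, (θ k - θ₀ k) ^ 2 ≤ ρ ^ 2} ⊆ Θ) : Θ ∈ 𝓝 θ₀ := by
  have hc : Continuous fun θ : Fin p → ℝ => ∑ k, (θ k - θ₀ k) ^ 2 := by fun_prop
  refine mem_of_superset ((isOpen_lt hc continuous_const).mem_nhds (x := θ₀) ?_) fun θ hθ =>
    hball (le_of_lt hθ : ∑ k, (θ k - θ₀ k) ^ 2 ≤ ρ ^ 2)
  simp only [sub_self, Set.mem_ofPred_eq]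
  simpa using by positivity

lemma le_of_iSup_ofReal_le {f : ℝ} {S : ENNReal} {M : NNReal} (h : ENNReal.ofReal f ≤ S)
    (hS : S ≤ M) : f ≤ M := by
  have := h.trans hS
  rw [← ENNReal.ofReal_coe_nnreal] at this
  exact (ENNReal.ofReal_le_ofReal_iff M.coe_nonneg).1 this

/-- For the envelope, a single `|g|^γ` is at most the whole sum, hence at most `n * M`, uniformly in
`θ`; this yields `√r (nM)^{1/γ}` without a union bound. -/
lemma regularSample_of_regSup_le {M : NNReal} {c γ : ℝ} {x : Fin n → 𝒳} (hn : 0 < n)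
    (hconv : Convex ℝ Θ) (hnhds : Θ ∈ 𝓝 θ₀) (hsm : ∀ x j, ContDiffOn ℝ 2 (fun θ => g x θ j) Θ)
    (hc : 1 ≤ c) (hγ : 0 < γ) (hM : regSup Θ g γ x ≤ M)
    (heig : ∀ θ ∈ Θ, c⁻¹ ≤ lamMin (empV g x θ) ∧ lamMax (empV g x θ) ≤ c) :
    RegularSample Θ (fun i θ => g (x i) θ) M c (√r * (n * M) ^ γ⁻¹) where
  pos := hn
  convex := hconv
  uniqueDiff := uniqueDiffOn_convex hconv ⟨θ₀, mem_interior_iff_mem_nhds.2 hnhds⟩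
  smooth i j := hsm (x i) j
  M_nonneg := M.coe_nonneg
  one_le_c := hc
  T_nonneg := mul_nonneg (Real.sqrt_nonneg _) (Real.rpow_nonneg (by positivity) _)
  grad θ hθ j k := by
    refine le_of_iSup_ofReal_le ?_ ((le_iSup₂ (f := fun θ (_ : θ ∈ Θ) => _) θ hθ).trans hM)
    refine le_trans ?_ (le_self_add.trans le_self_add)
    exact le_iSup₂ (f := fun j k => ENNReal.ofReal
      (empMean fun i => (pderivOn Θ (fun t => g (x i) t j) k θ) ^ 2)) j k
  hess θ hθ j k l := by
    refine le_of_iSup_ofReal_le ?_ ((le_iSup₂ (f := fun θ (_ : θ ∈ Θ) => _) θ hθ).trans hM)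
    refine le_trans ?_ (le_add_self.trans le_self_add)
    refine le_trans ?_ (le_iSup₂ j k)
    exact le_iSup (fun l => ENNReal.ofReal (empMean fun i =>
      (pderivOn Θ (fun s => pderivOn Θ (fun t => g (x i) t j) k s) l θ) ^ 2)) l
  low θ hθ v := by
    rw [← dotProduct_empV_mulVec]
    exact (mul_le_mul_of_nonneg_right (heig θ hθ).1 (dotProduct_self_nonneg' v)).trans
      (lamMin_mul_le (isHermitian_empV x θ) v)
  up θ hθ v := by
    rw [← dotProduct_empV_mulVec]
    exact (le_lamMax_mul (isHermitian_empV x θ) v).trans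
      (mul_le_mul_of_nonneg_right (heig θ hθ).2 (dotProduct_self_nonneg' v))
  bound θ hθ i := by
    have hn' : (0 : ℝ) < n := by exact_mod_cast hn
    refine l2_le_sqrt_mul (Real.rpow_nonneg (by positivity) _) fun j => ?_
    have h1 : empMean (fun i => |g (x i) θ j| ^ γ) ≤ M := by
      refine le_of_iSup_ofReal_le ?_ ((le_iSup₂ (f := fun θ (_ : θ ∈ Θ) => _) θ hθ).trans hM)
      refine le_trans ?_ le_add_self
      exact le_iSup (fun j => ENNReal.ofReal (empMean fun i => |g (x i) θ j| ^ γ)) j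
    have h2 : |g (x i) θ j| ^ γ ≤ n * M := by
      rw [empMean, inv_mul_le_iff₀ hn'] at h1
      exact (Finset.single_le_sum (f := fun i => |g (x i) θ j| ^ γ)
        (fun i _ => Real.rpow_nonneg (abs_nonneg _) _) (Finset.mem_univ i)).trans h1
    calc |g (x i) θ j| = (|g (x i) θ j| ^ γ) ^ γ⁻¹ := by
          rw [← Real.rpow_mul (abs_nonneg _), mul_inv_cancel₀ hγ.ne', Real.rpow_one]
      _ ≤ _ := Real.rpow_le_rpow (Real.rpow_nonneg (abs_nonneg _) _) h2 (by positivity)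

variable (μ Θ g θ₀) in
/-- Moment bounds on the estimating functions and on their gradients at `θ₀`, identification of
`θ₀`, and a lower bound on the singular values of the mean gradient. -/
structure PopulationBounds (C C₁ c₄ : ℝ) : Prop where
  mem : θ₀ ∈ Θ
  one_le : 1 ≤ C
  meas : ∀ θ ∈ Θ, ∀ j, Measurable fun x => g x θ j
  memLp : ∀ θ ∈ Θ, ∀ j, MemLp (fun x => g x θ j) 4 μ
  fourth : ∀ θ ∈ Θ, ∀ j, ∫ x, g x θ j ^ 4 ∂μ ≤ C
  grad_meas : ∀ j k, Measurable fun x => pderivOn Θ (fun t => g x t j) k θ₀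
  grad_memLp : ∀ j k, MemLp (fun x => pderivOn Θ (fun t => g x t j) k θ₀) 2 μ
  grad : ∀ j k, ∫ x, pderivOn Θ (fun t => g x t j) k θ₀ ^ 2 ∂μ ≤ C
  mean : popMean μ g θ₀ = 0
  sep : ∀ θ ∈ Θ, C₁ * ‖θ - θ₀‖ ≤ ‖popMean μ g θ‖
  low : ∀ v, c₄ * l2 v ≤ l2 (popGrad μ Θ g θ₀ *ᵥ v)

namespace PopulationBounds

variable [IsProbabilityMeasure P] {C C₁ c₄ t : ℝ}
  (H : PopulationBounds μ Θ θ₀ g C C₁ c₄)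
include H

/-- Identification and bounded moments together force `Θ` to be bounded, so a finite grid can cover
it. -/
lemma norm_sub_le [IsProbabilityMeasure μ] (hC₁ : 0 < C₁) {θ : Fin p → ℝ} (hθ : θ ∈ Θ) : ‖θ - θ₀‖ ≤ (1 + C) / C₁ := by
  rw [le_div_iff₀' hC₁]
  refine (H.sep θ hθ).trans ?_
  have : 0 ≤ 1 + C := by linarith [H.one_le]
  exact (pi_norm_le_iff_of_nonneg this).2 fun j =>
    abs_integral_le_of_pow_four (H.memLp θ hθ j) (H.fourth θ hθ j)

lemma integral_sq_le [IsProbabilityMeasure μ] (j : Fin r) : ∫ x, g x θ₀ j ^ 2 ∂μ ≤ C := by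
  have h1 := integrable_pow_four (H.memLp θ₀ H.mem j)
  have h2 := H.fourth θ₀ H.mem j
  calc ∫ x, g x θ₀ j ^ 2 ∂μ ≤ ∫ x, (2⁻¹ + 2⁻¹ * g x θ₀ j ^ 4) ∂μ :=
        integral_mono_of_nonneg (ae_of_all _ fun x => sq_nonneg _)
          ((integrable_const _).add (h1.const_mul _)) (ae_of_all _ fun x => by
            nlinarith [sq_nonneg (g x θ₀ j ^ 2 - 1)])
    _ = 2⁻¹ + 2⁻¹ * ∫ x, g x θ₀ j ^ 4 ∂μ := by
        rw [integral_add (integrable_const _) (h1.const_mul _), integral_const_mul]; simp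
    _ ≤ C := by linarith [H.one_le]

lemma measure_gbar_le [IsProbabilityMeasure μ] (hn : 0 < n) (hX : ∀ i, HasLaw (X i) μ P) (hI : iIndepFun X P)
    (ht : 0 < t) :
    P {ω | t ≤ l2 (gbar (fun i θ => g (X i ω) θ) θ₀) ^ 2} ≤ ENNReal.ofReal (r * C / n / t) := by
  have h := measure_sum_sq_empMean_sub_le hn hX hI (F := fun (j : Fin r) x => g x θ₀ j)
    (fun j => H.meas θ₀ H.mem j)
    (fun j => (H.memLp θ₀ H.mem j).mono_exponent (by norm_num)) H.integral_sq_le ht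
  rw [Fintype.card_fin] at h
  refine le_trans (le_of_eq ?_) h
  congr 1; ext ω
  have e : ∀ j, ∫ x, g x θ₀ j ∂μ = 0 := fun j => congrFun H.mean j
  simp only [e, sub_zero]
  rw [Set.mem_ofPred_eq, Set.mem_ofPred_eq, l2_sq]
  simp only [gbar, dotProduct, sq]

lemma measure_gradBar_le (hn : 0 < n) (hX : ∀ i, HasLaw (X i) μ P) (hI : iIndepFun X P)
    (ht : 0 < t) :
    P {ω | t ≤ ∑ j, ∑ k, (gradBar Θ (fun i θ => g (X i ω) θ) θ₀ - popGrad μ Θ g θ₀) j k ^ 2}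
      ≤ ENNReal.ofReal (r * p * C / n / t) := by
  have h := measure_sum_sq_empMean_sub_le hn hX hI
    (F := fun (q : Fin r × Fin p) x => pderivOn Θ (fun t => g x t q.1) q.2 θ₀)
    (fun q => H.grad_meas q.1 q.2) (fun q => H.grad_memLp q.1 q.2) (fun q => H.grad q.1 q.2) ht
  simp only [Fintype.card_prod, Fintype.card_fin, Nat.cast_mul, Fintype.sum_prod_type] at h
  simpa only [gradBar, popGrad, Matrix.sub_apply, Matrix.of_apply] using h

lemma measure_secondMoment_le (hn : 0 < n) (hX : ∀ i, HasLaw (X i) μ P) (hI : iIndepFun X P)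
    (ht : 0 < t) :
    P {ω | t ≤ ∑ j, ∑ k, ((Matrix.of fun j k => empMean fun i => g (X i ω) θ₀ j * g (X i ω) θ₀ k)
        - popV μ g θ₀) j k ^ 2} ≤ ENNReal.ofReal (r * r * C / n / t) := by
  have h4 := H.memLp θ₀ H.mem
  have h := measure_sum_sq_empMean_sub_le hn hX hI
    (F := fun (q : Fin r × Fin r) x => g x θ₀ q.1 * g x θ₀ q.2)
    (fun q => (H.meas θ₀ H.mem q.1).mul (H.meas θ₀ H.mem q.2))
    (fun q => memLp_two_mul (h4 q.1) (h4 q.2))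
    (fun q => integral_sq_mul_sq_le (h4 q.1) (h4 q.2) (H.fourth θ₀ H.mem q.1)
      (H.fourth θ₀ H.mem q.2)) ht
  simp only [Fintype.card_prod, Fintype.card_fin, Nat.cast_mul, Fintype.sum_prod_type] at h
  simpa only [popV, Matrix.sub_apply, Matrix.of_apply] using h

/-- Eigenvalue bounds are assumed only for the sample matrix. Some outcome has both those bounds and
a Frobenius error at most `(2c)⁻¹`, so the population form inherits them with `c` doubled. -/
lemma popV_form_bounds [IsProbabilityMeasure μ] (hn : 0 < n) (hX : ∀ i, HasLaw (X i) μ P) (hI : iIndepFun X P) {c : ℝ}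
    (hc : 1 ≤ c) {E : Set Ω} (hE : P Eᶜ < 2⁻¹)
    (hlow : ∀ ω ∈ E, ∀ v : Fin r → ℝ, c⁻¹ * (v ⬝ᵥ v) ≤ empMean fun i => (v ⬝ᵥ g (X i ω) θ₀) ^ 2)
    (hup : ∀ ω ∈ E, ∀ v : Fin r → ℝ, empMean (fun i => (v ⬝ᵥ g (X i ω) θ₀) ^ 2) ≤ c * (v ⬝ᵥ v))
    (hrn : (r : ℝ) ^ 2 * (8 * C * c ^ 2) ≤ n) (v : Fin r → ℝ) :
    (2 * c)⁻¹ * (v ⬝ᵥ v) ≤ v ⬝ᵥ (popV μ g θ₀ *ᵥ v) ∧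
      v ⬝ᵥ (popV μ g θ₀ *ᵥ v) ≤ 2 * c * (v ⬝ᵥ v) := by
  have hC := H.one_le
  have hn' : (0 : ℝ) < n := by exact_mod_cast hn
  have hc0 : 0 < c := by linarith
  set s : ℝ := (2 * c)⁻¹ with hs
  have hs0 : 0 < s := by positivity
  have hP := H.measure_secondMoment_le hn hX hI (t := s ^ 2) (by positivity)
  set B := {ω | s ^ 2 ≤ ∑ j, ∑ k, ((Matrix.of fun j k => empMean fun i =>
    g (X i ω) θ₀ j * g (X i ω) θ₀ k) - popV μ g θ₀) j k ^ 2} with hB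
  have hP2 : P B ≤ 2⁻¹ := by
    refine hP.trans ?_
    rw [show (2⁻¹ : ENNReal) = ENNReal.ofReal 2⁻¹ by
      rw [ENNReal.ofReal_inv_of_pos (by norm_num)]; simp]
    refine ENNReal.ofReal_le_ofReal ?_
    rw [div_div, div_le_iff₀ (by positivity), hs]
    have : 2⁻¹ * ((n : ℝ) * (2 * c)⁻¹ ^ 2) = n / (8 * c ^ 2) := by field_simp; norm_num
    rw [this, le_div_iff₀ (by positivity)]
    linarith
  obtain ⟨ω, hωE, hωB⟩ : ∃ ω, ω ∈ E ∧ ω ∉ B := by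
    by_contra hcon
    push Not at hcon
    have h1 : (Set.univ : Set Ω) ⊆ Eᶜ ∪ B := fun ω _ => by
      by_cases h : ω ∈ E
      · exact Or.inr (hcon ω h)
      · exact Or.inl h
    have h2 : (1 : ENNReal) ≤ P Eᶜ + P B := by
      rw [← measure_univ (μ := P)]; exact (measure_mono h1).trans (measure_union_le _ _)
    have h3 : P Eᶜ + P B < 2⁻¹ + 2⁻¹ := ENNReal.add_lt_add_of_lt_of_le (by simp [measure_ne_top]) hE hP2
    rw [ENNReal.inv_two_add_inv_two] at h3
    exact absurd h2 (not_le.2 h3)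
  have hfrob : ∑ j, ∑ k, ((Matrix.of fun j k => empMean fun i =>
    g (X i ω) θ₀ j * g (X i ω) θ₀ k) - popV μ g θ₀) j k ^ 2 ≤ s ^ 2 := (not_le.1 hωB).le
  have h1 := abs_dotProduct_mulVec_le _ hs0.le hfrob v v
  rw [sub_mulVec, dotProduct_sub] at h1
  have h2 : v ⬝ᵥ ((Matrix.of fun j k => empMean fun i => g (X i ω) θ₀ j * g (X i ω) θ₀ k) *ᵥ v)
      = empMean fun i => (v ⬝ᵥ g (X i ω) θ₀) ^ 2 := dotProduct_empV_mulVec (fun i => X i ω) θ₀ v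
  rw [h2, show l2 v * s * l2 v = s * l2 v ^ 2 by ring, l2_sq, abs_le] at h1
  have h3 := hlow ω hωE v
  have h4 := hup ω hωE v
  have hvv := dotProduct_self_nonneg' v
  have h5 : c⁻¹ = 2 * s := by rw [hs]; field_simp
  have h6 : s ≤ c := by
    rw [hs]; exact (inv_le_one_of_one_le₀ (by linarith)).trans hc
  rw [h5] at h3
  have h7 := mul_le_mul_of_nonneg_right h6 hvv
  constructor <;> linarith [h1.1, h1.2]

/-- The events on which the estimating equations can be linearised hold with large probability. -/
lemma measure_compl_typical_le [IsProbabilityMeasure μ] (hC₁ : 0 < C₁) (hp : 1 ≤ p) (hr : 1 ≤ r)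
    (hX : ∀ i, HasLaw (X i) μ P) (hI : iIndepFun X P) {M c T A : ℝ} (hM : 0 < M)
    (hA : 4 + √(8 * C) ≤ A) {E : Set Ω} (hE : P Eᶜ < 2⁻¹)
    (hreg : ∀ ω ∈ E, RegularSample Θ (fun i θ => g (X i ω) θ) M c T)
    (hpn : p ^ 4 ≤ n) (hMn : M ≤ n) (hC₁n : C₁ ≤ n) {m : ℕ}
    (hm : 2 * ((1 + C) / C₁) * (n : ℝ) ^ 2 < m) :
    P {ω | ¬ (ω ∈ E ∧ l2 (gbar (fun i θ => g (X i ω) θ) θ₀) ≤ A * √((r : ℝ) / n) ∧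
        ∑ j, ∑ k, (gradBar Θ (fun i θ => g (X i ω) θ) θ₀ - popGrad μ Θ g θ₀) j k ^ 2
          ≤ (A * (√p * √((r : ℝ) / n))) ^ 2 ∧
        ∑ j, ∑ k, ((Matrix.of fun j k => empMean fun i => g (X i ω) θ₀ j * g (X i ω) θ₀ k)
          - popV μ g θ₀) j k ^ 2 ≤ (A * (√r * √((r : ℝ) / n))) ^ 2 ∧
        ∀ θ ∈ Θ, ∀ j, |gbar (fun i θ => g (X i ω) θ) θ j - gbar (fun i θ => g (X i ω) θ) θ₀ j
          - popMean μ g θ j| ≤ C₁ / 2 * ‖θ - θ₀‖ + A * √((r : ℝ) / n))}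
      ≤ P Eᶜ + (ENNReal.ofReal (C / A ^ 2) + (ENNReal.ofReal (C / A ^ 2) +
        (ENNReal.ofReal (C / A ^ 2) + (P Eᶜ + ENNReal.ofReal (2 * (m ^ p) * r *
          Real.exp (-(min (C₁ ^ 2 / (128 * M)) (1 / (4 * √(2 * (16 * C)))) * √n))))))) := by
  have hn : 0 < n := lt_of_lt_of_le (pow_pos hp 4) hpn
  have hn' : (0 : ℝ) < n := by exact_mod_cast hn
  have hr' : (1 : ℝ) ≤ r := by exact_mod_cast hr
  have hp' : (1 : ℝ) ≤ p := by exact_mod_cast hp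
  have hC := H.one_le
  have hA0 : 0 < A := by linarith [Real.sqrt_nonneg (8 * C)]
  set a := √((r : ℝ) / n) with ha
  have ha0 : 0 < a := Real.sqrt_pos.2 (by positivity)
  have ha2 : a ^ 2 = r / n := Real.sq_sqrt (by positivity)
  have han : 1 / √(n : ℝ) ≤ a := by
    rw [ha, Real.sqrt_div' _ hn'.le]
    exact div_le_div_of_nonneg_right (Real.one_le_sqrt.2 hr') (Real.sqrt_nonneg _)
  have b1 := H.measure_gbar_le hn hX hI (t := (A * a) ^ 2) (by positivity)
  have b2 := H.measure_gradBar_le hn hX hI (t := (A * (√p * a)) ^ 2) (by positivity)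
  have b3 := H.measure_secondMoment_le hn hX hI (t := (A * (√r * a)) ^ 2) (by positivity)
  have b4 := measure_uniform_deviation_le hn hX hI H.meas H.memLp hM hC hC₁ H.fourth H.mem H.mean
    hE hpn hMn hC₁n (fun ω hω θ hθ θ' hθ' j => by
      have R := hreg ω hω
      refine (empMean_sq_sub_le (f := fun i θ => g (X i ω) θ j) R.convex
        (fun i => R.differentiableOn i j) (fun θ hθ k => R.grad θ hθ j k) hθ hθ').trans ?_
      exact mul_le_mul_of_nonneg_left (pow_le_pow_left₀ (l1_nonneg _) (l1_le_mul_norm _) 2) hM.le)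
    (fun θ hθ => H.norm_sub_le hC₁ hθ) hm
  have e1 : (r : ℝ) * C / n / (A * a) ^ 2 = C / A ^ 2 := by rw [mul_pow, ha2]; field_simp
  have e2 : (r : ℝ) * p * C / n / (A * (√p * a)) ^ 2 = C / A ^ 2 := by
    rw [mul_pow, mul_pow, ha2, Real.sq_sqrt (by positivity)]; field_simp
  have e3 : (r : ℝ) * r * C / n / (A * (√r * a)) ^ 2 = C / A ^ 2 := by
    rw [mul_pow, mul_pow, ha2, Real.sq_sqrt (by positivity)]; field_simp
  rw [e1] at b1; rw [e2] at b2; rw [e3] at b3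
  refine le_trans ?_ (add_le_add le_rfl (add_le_add b1 (add_le_add b2 (add_le_add b3 b4))))
  refine le_trans ?_ (add_le_add le_rfl (add_le_add le_rfl (add_le_add le_rfl
    (measure_union_le _ _))))
  refine le_trans ?_ (add_le_add le_rfl (add_le_add le_rfl (measure_union_le _ _)))
  refine le_trans ?_ (add_le_add le_rfl (measure_union_le _ _))
  refine le_trans ?_ (measure_union_le _ _)
  refine measure_mono fun ω hω => ?_
  by_contra hcon
  simp only [Set.mem_union, Set.mem_ofPred_eq, Set.mem_compl_iff, not_or, not_not, not_le] at hcon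
  obtain ⟨h0, h1, h2, h3, h4⟩ := hcon
  refine hω ⟨h0, (pow_le_pow_iff_left₀ (l2_nonneg _) (by positivity) two_ne_zero).1 h1.le, h2.le,
    h3.le, fun θ hθ j => (h4 θ hθ j).trans ?_⟩
  have : (4 + √(8 * C)) / √n ≤ A * a := by
    rw [div_eq_mul_one_div]
    exact mul_le_mul hA han (by positivity) hA0.le
  linarith

end PopulationBounds

end Typical

/-! ### Rates -/

section Rates

variable {p r : ℕ → ℕ}

lemma eventually_sq_mul_le (hp : ∀ n, 1 ≤ p n) (hpr : ∀ n, p n ≤ r n)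
    (h : Tendsto (fun n : ℕ => (r n : ℝ) ^ 3 * (p n : ℝ) ^ 2 * (n : ℝ)⁻¹) atTop (𝓝 0)) {c : ℝ}
    (hc : 0 < c) : ∀ᶠ n : ℕ in atTop, (r n : ℝ) ^ 2 * c ≤ n := by
  filter_upwards [h.eventually_le_const (show (0 : ℝ) < c⁻¹ by positivity), eventually_gt_atTop 0]
    with n hn hn0
  have hn' : (0 : ℝ) < n := by exact_mod_cast hn0
  have hp' : (1 : ℝ) ≤ p n := by exact_mod_cast hp n
  have hr' : (1 : ℝ) ≤ r n := hp'.trans (by exact_mod_cast hpr n)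
  rw [mul_inv_le_iff₀ hn', inv_mul_eq_div, le_div_iff₀ hc] at hn
  refine le_trans (mul_le_mul_of_nonneg_right ?_ hc.le) hn
  calc (r n : ℝ) ^ 2 = (r n : ℝ) ^ 2 * 1 := by ring
    _ ≤ (r n : ℝ) ^ 3 * (p n : ℝ) ^ 2 :=
      mul_le_mul (pow_le_pow_right₀ hr' (by norm_num)) (one_le_pow₀ hp') zero_le_one (by positivity)

lemma eventually_pow_four_le (hp : ∀ n, 1 ≤ p n) (hpr : ∀ n, p n ≤ r n)
    (h : Tendsto (fun n : ℕ => (r n : ℝ) ^ 3 * (p n : ℝ) ^ 2 * (n : ℝ)⁻¹) atTop (𝓝 0)) :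
    ∀ᶠ n : ℕ in atTop, p n ^ 4 ≤ n := by
  filter_upwards [h.eventually_le_const one_pos, eventually_gt_atTop 0] with n hn hn0
  have hn' : (0 : ℝ) < n := by exact_mod_cast hn0
  have hp' : (1 : ℝ) ≤ p n := by exact_mod_cast hp n
  have hr' : (p n : ℝ) ≤ r n := by exact_mod_cast hpr n
  rw [mul_inv_le_iff₀ hn', one_mul] at hn
  have : (p n : ℝ) ^ 4 ≤ n := by
    calc (p n : ℝ) ^ 4 ≤ p n ^ 5 := pow_le_pow_right₀ hp' (by norm_num)
      _ = p n ^ 3 * p n ^ 2 := by ring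
      _ ≤ r n ^ 3 * p n ^ 2 := by gcongr
      _ ≤ n := hn
  exact_mod_cast this

lemma tendsto_mul_sqrt_div
    (h : Tendsto (fun n : ℕ => (r n : ℝ) ^ 3 * (p n : ℝ) ^ 2 * (n : ℝ)⁻¹) atTop (𝓝 0)) :
    Tendsto (fun n : ℕ => (r n : ℝ) * p n * √((r n : ℝ) / n)) atTop (𝓝 0) := by
  have h1 := (Real.continuous_sqrt.tendsto 0).comp h
  rw [Real.sqrt_zero] at h1
  refine h1.congr fun n => ?_
  rw [Function.comp_apply, show (r n : ℝ) ^ 3 * (p n : ℝ) ^ 2 * (n : ℝ)⁻¹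
    = (r n * p n) ^ 2 * (r n / n) by ring, Real.sqrt_mul (by positivity),
    Real.sqrt_sq (by positivity)]

lemma tendsto_envelope_mul_sqrt {γ : ℝ} (M : NNReal)
    (h : Tendsto (fun n : ℕ => (r n : ℝ) ^ 3 * (n : ℝ) ^ (-1 + 2 / γ)) atTop (𝓝 0)) :
    Tendsto (fun n : ℕ => √(r n) * ((n : ℝ) * M) ^ γ⁻¹ * √(r n) * √((r n : ℝ) / n))
      atTop (𝓝 0) := by
  have h1 := ((Real.continuous_sqrt.tendsto 0).comp h).const_mul ((M : ℝ) ^ γ⁻¹)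
  rw [Real.sqrt_zero, mul_zero] at h1
  refine h1.congr' ?_
  filter_upwards [eventually_gt_atTop 0] with n hn0
  have hn' : (0 : ℝ) < n := by exact_mod_cast hn0
  have e : (r n : ℝ) ^ 3 * (n : ℝ) ^ (-1 + 2 / γ) = (r n * (n : ℝ) ^ γ⁻¹) ^ 2 * (r n / n) := by
    rw [Real.rpow_add hn', Real.rpow_neg_one, show 2 / γ = γ⁻¹ * (2 : ℕ) by push_cast; ring,
      Real.rpow_mul hn'.le, Real.rpow_natCast]
    ring
  have hs : √(r n : ℝ) * √(r n : ℝ) = r n := Real.mul_self_sqrt (by positivity)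
  rw [Function.comp_apply, e, Real.sqrt_mul (by positivity), Real.sqrt_sq (by positivity),
    Real.mul_rpow hn'.le M.coe_nonneg]
  calc _ = (r n : ℝ) * ((n : ℝ) ^ γ⁻¹ * (M : ℝ) ^ γ⁻¹) * √((r n : ℝ) / n) := by ring
    _ = √(r n : ℝ) * √(r n : ℝ) * ((n : ℝ) ^ γ⁻¹ * (M : ℝ) ^ γ⁻¹) * √((r n : ℝ) / n) := by rw [hs]
    _ = _ := by ring

/-- With `n³` cells per coordinate the prefactor is at most `exp (5 p log n)`. Since `p ≤ n^{1/4}`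
and `log n ≤ (κ/10) n^{1/4}` eventually, this is at most `exp (κ√n / 2)`. -/
lemma tendsto_grid_mul_exp (hp : ∀ n, 1 ≤ p n) (hpn : ∀ᶠ n : ℕ in atTop, p n ^ 4 ≤ n)
    (hrn : ∀ᶠ n : ℕ in atTop, (r n : ℝ) ≤ n) {κ : ℝ} (hκ : 0 < κ) :
    Tendsto (fun n : ℕ => 2 * (((n ^ 3 : ℕ) : ℝ) ^ p n) * r n * Real.exp (-(κ * √n)))
      atTop (𝓝 0) := by
  have hlim : Tendsto (fun n : ℕ => Real.exp (-(κ / 2 * √n))) atTop (𝓝 0) := by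
    refine Real.tendsto_exp_neg_atTop_nhds_zero.comp ?_
    exact (Real.tendsto_sqrt_atTop.comp tendsto_natCast_atTop_atTop).const_mul_atTop (by positivity)
  have hlog := ((isLittleO_log_rpow_atTop (show (0 : ℝ) < 1 / 4 by norm_num)).bound
    (show 0 < κ / 10 by positivity))
  have hlog' := tendsto_natCast_atTop_atTop.eventually hlog
  refine tendsto_of_tendsto_of_tendsto_of_le_of_le' tendsto_const_nhds hlim
    (Eventually.of_forall fun n => by positivity) ?_
  filter_upwards [hpn, hrn, hlog', eventually_ge_atTop 2] with n h1 h2 h3 hn2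
  have hn' : (2 : ℝ) ≤ n := by exact_mod_cast hn2
  have hn0 : (0 : ℝ) < n := by linarith
  have hl0 : 0 ≤ Real.log n := Real.log_nonneg (by linarith)
  set s : ℝ := (n : ℝ) ^ (1 / 4 : ℝ) with hs
  have hs0 : 0 ≤ s := Real.rpow_nonneg hn0.le _
  have hs4 : s ^ 4 = n := by
    rw [hs, ← Real.rpow_natCast, ← Real.rpow_mul hn0.le]; norm_num
  have hs2 : s ^ 2 = √n := by
    rw [← hs4, show s ^ 4 = (s ^ 2) ^ 2 by ring, Real.sqrt_sq (by positivity)]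
  have hps : (p n : ℝ) ≤ s := by
    refine (pow_le_pow_iff_left₀ (by positivity) hs0 (show 4 ≠ 0 by norm_num)).1 ?_
    rw [hs4]; exact_mod_cast h1
  rw [Real.norm_of_nonneg hl0, Real.norm_of_nonneg hs0] at h3
  have hp1 : (1 : ℝ) ≤ p n := by exact_mod_cast hp n
  have hpl : p n * Real.log n ≤ κ / 10 * √n := by
    rw [← hs2]
    calc p n * Real.log n ≤ s * (κ / 10 * s) := mul_le_mul hps h3 hl0 hs0
      _ = _ := by ring
  have hpow : (((n ^ 3 : ℕ) : ℝ) ^ p n) = Real.exp (3 * (p n * Real.log n)) := by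
    rw [show 3 * (p n * Real.log n) = ((3 * p n : ℕ) : ℝ) * Real.log n by push_cast; ring,
      Real.exp_nat_mul, Real.exp_log hn0, pow_mul]
    push_cast; rfl
  have hnn : 2 * (r n : ℝ) ≤ Real.exp (2 * (p n * Real.log n)) := by
    calc 2 * (r n : ℝ) ≤ n * n := mul_le_mul hn' h2 (by positivity) hn0.le
      _ = Real.exp (Real.log n + Real.log n) := by rw [Real.exp_add, Real.exp_log hn0]
      _ ≤ _ := Real.exp_le_exp.2 (by nlinarith)
  calc 2 * (((n ^ 3 : ℕ) : ℝ) ^ p n) * r n * Real.exp (-(κ * √n))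
      = Real.exp (3 * (p n * Real.log n)) * (2 * r n) * Real.exp (-(κ * √n)) := by rw [hpow]; ring
    _ ≤ Real.exp (3 * (p n * Real.log n)) * Real.exp (2 * (p n * Real.log n))
        * Real.exp (-(κ * √n)) := by gcongr
    _ = Real.exp (5 * (p n * Real.log n) - κ * √n) := by
        rw [← Real.exp_add, ← Real.exp_add]; congr 1; ring
    _ ≤ _ := Real.exp_le_exp.2 (by linarith)

end Rates

/-! ### Consequences of the assumptions -/

section Assumptions

lemma populationBounds_of_moments {𝒳 : Type*} [MeasurableSpace 𝒳] {μ : Measure 𝒳}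
    [IsProbabilityMeasure μ] {p r : ℕ} {Θ : Set (Fin p → ℝ)} {θ₀ : Fin p → ℝ}
    {g : 𝒳 → (Fin p → ℝ) → Fin r → ℝ} {ρ C₁ C₂ C₅ γ c₄ : ℝ} (hρ : 0 < ρ)
    (hball : {θ | ∑ k, (θ k - θ₀ k) ^ 2 ≤ ρ ^ 2} ⊆ Θ) (hmem : θ₀ ∈ Θ)
    (hg : ∀ θ ∈ Θ, Measurable fun x => g x θ) (hmean : popMean μ g θ₀ = 0) (hC₁ : 0 < C₁)
    (hsep : ∀ ε : ℝ, 0 < ε → ∀ θ ∈ Θ, ε < ‖θ - θ₀‖ → C₁ * ε ≤ ‖popMean μ g θ‖)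
    (hC₂ : 0 ≤ C₂) (hγ : 4 ≤ γ)
    (henv : ∀ j, ∫⁻ x, (⨆ θ ∈ Θ, ENNReal.ofReal (|g x θ j| ^ γ)) ∂μ ≤ ENNReal.ofReal C₂)
    (hsm : ∀ x j, ContDiffOn ℝ 2 (fun θ => g x θ j) Θ)
    (hgrad : ∀ j k, ∫⁻ x, ENNReal.ofReal ((pderivOn Θ (fun t => g x t j) k θ₀) ^ 2) ∂μ
      ≤ ENNReal.ofReal C₅)
    (hlow : ∀ v, c₄ * l2 v ≤ l2 (popGrad μ Θ g θ₀ *ᵥ v)) :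
    PopulationBounds μ Θ θ₀ g (max (1 + C₂) C₅) C₁ c₄ := by
  have hmeas : ∀ θ ∈ Θ, ∀ j, Measurable fun x => g x θ j := fun θ hθ j =>
    (measurable_pi_apply j).comp (hg θ hθ)
  have h4 : ∀ θ ∈ Θ, ∀ j, ∫⁻ x, ENNReal.ofReal (g x θ j ^ 4) ∂μ ≤ ENNReal.ofReal (1 + C₂) :=
    fun θ hθ j => lintegral_pow_four_le hγ hC₂ ((lintegral_mono fun x =>
      le_iSup₂ (f := fun θ (_ : θ ∈ Θ) => ENNReal.ofReal (|g x θ j| ^ γ)) θ hθ).trans (henv j))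
  have hD : ∀ j k, Measurable fun x => pderivOn Θ (fun t => g x t j) k θ₀ := fun j k =>
    measurable_pderivOn hρ hball (mem_nhds_of_ball_subset hρ hball) (fun θ hθ => hmeas θ hθ j)
      (fun x => (hsm x j).differentiableOn (by norm_num)) k
  have hD2 : ∀ j k, AEStronglyMeasurable (fun x => pderivOn Θ (fun t => g x t j) k θ₀ ^ 2) μ :=
    fun j k => ((hD j k).pow_const 2).aestronglyMeasurable
  have hgrad' := fun j k => (hgrad j k).trans
    (ENNReal.ofReal_le_ofReal (le_max_right (1 + C₂) C₅))
  exact {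
    mem := hmem
    one_le := le_max_of_le_left (by linarith)
    meas := hmeas
    memLp := fun θ hθ j => memLp_four_of_lintegral_le (hmeas θ hθ j) (h4 θ hθ j)
    fourth := fun θ hθ j => (integral_le_of_lintegral_le
      ((hmeas θ hθ j).pow_const 4).aestronglyMeasurable (fun x => by positivity) (by linarith)
      (h4 θ hθ j)).trans (le_max_left _ _)
    grad_meas := hD
    grad_memLp := fun j k => (memLp_two_iff_integrable_sq (hD j k).aestronglyMeasurable).2
      (integrable_of_lintegral_le (hD2 j k) (fun x => sq_nonneg _) (hgrad j k))
    grad := fun j k => integral_le_of_lintegral_le (hD2 j k) (fun x => sq_nonneg _)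
      (le_max_of_le_left (by linarith)) (hgrad' j k)
    mean := hmean
    sep := fun θ hθ => mul_norm_sub_le_of_separated hC₁ hsep hθ
    low := hlow }

/-- With large probability the sample is regular and the estimator minimises the criterion. -/
lemma exists_eventually_measure_compl_le {d p r : ℕ → ℕ} {Ω : ℕ → Type*}
    [∀ n, MeasurableSpace (Ω n)] {P : ∀ n, Measure (Ω n)}
    {X : ∀ n, Fin n → Ω n → Fin (d n) → ℝ} {Θ : ∀ n, Set (Fin (p n) → ℝ)}
    {θ₀ : ∀ n, Fin (p n) → ℝ} {g : ∀ n, (Fin (d n) → ℝ) → (Fin (p n) → ℝ) → Fin (r n) → ℝ}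
    {C₃ γ : ℝ} {V : Set ℝ} {θhat : ∀ n, Ω n → Fin (p n) → ℝ}
    (hconv : ∀ n, Convex ℝ (Θ n)) (hnhds : ∀ᶠ n in atTop, Θ n ∈ 𝓝 (θ₀ n))
    (hC₃ : 1 ≤ C₃) (hγ : 0 < γ)
    (heig : HoldsWPA1 P fun n => {ω | ∀ θ ∈ Θ n,
      C₃⁻¹ ≤ lamMin (empV (g n) (fun i => X n i ω) θ) ∧
      lamMax (empV (g n) (fun i => X n i ω) θ) ≤ C₃})
    (hsm : ∀ n x j, ContDiffOn ℝ 2 (fun θ => g n x θ j) (Θ n))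
    (hreg : IsBigOpOne P fun n ω => regSup (Θ n) (g n) γ (fun i => X n i ω))
    (hθhat : HoldsWPA1 P fun n => {ω | IsELEstimate V (Θ n) (g n) (fun i => X n i ω) (θhat n ω)})
    {ε : ℝ} (hε : 0 < ε) :
    ∃ M : NNReal, 1 ≤ M ∧ ∀ᶠ n in atTop, ∃ E : Set (Ω n), P n Eᶜ ≤ ENNReal.ofReal (3 * ε) ∧
      ∀ ω ∈ E, RegularSample (Θ n) (fun i θ => g n (X n i ω) θ) M C₃ (√(r n) * (n * M) ^ γ⁻¹) ∧
        IsELEstimate V (Θ n) (g n) (fun i => X n i ω) (θhat n ω) := by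
  have hε' : 0 < ENNReal.ofReal ε := ENNReal.ofReal_pos.2 hε
  obtain ⟨M, hM⟩ := hreg _ hε'
  refine ⟨max M 1, le_max_right _ _, ?_⟩
  filter_upwards [hM, heig.eventually_le_const hε', hθhat.eventually_le_const hε', hnhds,
    eventually_gt_atTop 0] with n h1 h2 h3 h4 hn
  set B := {ω | (M : ENNReal) < regSup (Θ n) (g n) γ (fun i => X n i ω)}
  set S := {ω | ∀ θ ∈ Θ n, C₃⁻¹ ≤ lamMin (empV (g n) (fun i => X n i ω) θ) ∧
      lamMax (empV (g n) (fun i => X n i ω) θ) ≤ C₃}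
  set R := {ω | IsELEstimate V (Θ n) (g n) (fun i => X n i ω) (θhat n ω)}
  refine ⟨(B ∪ (Sᶜ ∪ Rᶜ))ᶜ, ?_, fun ω hω => ?_⟩
  · rw [compl_compl]
    refine (measure_union_le _ _).trans ((add_le_add h1 ((measure_union_le _ _).trans
      (add_le_add h2 h3))).trans (le_of_eq ?_))
    rw [← ENNReal.ofReal_add hε.le hε.le, ← ENNReal.ofReal_add hε.le (by linarith)]
    congr 1; ring
  · simp only [Set.compl_union, compl_compl, Set.mem_inter_iff] at hω
    obtain ⟨hB, hS, hR⟩ := hω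
    have hB' : regSup (Θ n) (g n) γ (fun i => X n i ω) ≤ M := not_lt.1 hB
    refine ⟨regularSample_of_regSup_le hn (hconv n) h4 (hsm n) hC₃ hγ
      (hB'.trans ?_) hS, hR⟩
    exact_mod_cast le_max_left M 1

lemma exists_influence_sequence {p r : ℕ → ℕ} {Gm : ∀ n, Matrix (Fin (r n)) (Fin (p n)) ℝ}
    {Vm : ∀ n, Matrix (Fin (r n)) (Fin (r n)) ℝ} {c c₄ : ℝ} (hc : 0 < c) (hc₄ : 0 < c₄)
    (hVm : ∀ n, (Vm n)ᵀ = Vm n)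
    (hform : ∀ᶠ n in atTop, ∀ v, c⁻¹ * (v ⬝ᵥ v) ≤ v ⬝ᵥ (Vm n *ᵥ v) ∧
      v ⬝ᵥ (Vm n *ᵥ v) ≤ c * (v ⬝ᵥ v))
    (hGm : ∀ n v, c₄ * l2 v ≤ l2 (Gm n *ᵥ v)) {α : ∀ n, Fin (p n) → ℝ}
    (hα : ∀ n, α n ⬝ᵥ α n = 1) :
    ∃ (u : ∀ n, Fin (p n) → ℝ) (w : ∀ n, Fin (r n) → ℝ), ∀ᶠ n in atTop,
      Vm n *ᵥ w n = Gm n *ᵥ u n ∧ l2 (u n) ≤ √c / c₄ ∧ l2 (w n) ≤ √c ∧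
      w n ⬝ᵥ (Vm n *ᵥ w n) = 1 ∧
      ∀ Δ, w n ⬝ᵥ (Gm n *ᵥ Δ)
        = α n ⬝ᵥ (matSqrt (outer ((Gm n)ᵀ * (matSqrt (Vm n))⁻¹)) *ᵥ Δ) := by
  have key : ∀ n, ∃ (uw : (Fin (p n) → ℝ) × (Fin (r n) → ℝ)),
      (∀ v, c⁻¹ * (v ⬝ᵥ v) ≤ v ⬝ᵥ (Vm n *ᵥ v) ∧ v ⬝ᵥ (Vm n *ᵥ v) ≤ c * (v ⬝ᵥ v)) →
      Vm n *ᵥ uw.2 = Gm n *ᵥ uw.1 ∧ l2 uw.1 ≤ √c / c₄ ∧ l2 uw.2 ≤ √c ∧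
      uw.2 ⬝ᵥ (Vm n *ᵥ uw.2) = 1 ∧
      ∀ Δ, uw.2 ⬝ᵥ (Gm n *ᵥ Δ)
        = α n ⬝ᵥ (matSqrt (outer ((Gm n)ᵀ * (matSqrt (Vm n))⁻¹)) *ᵥ Δ) := fun n => by
    by_cases h : ∀ v, c⁻¹ * (v ⬝ᵥ v) ≤ v ⬝ᵥ (Vm n *ᵥ v) ∧ v ⬝ᵥ (Vm n *ᵥ v) ≤ c * (v ⬝ᵥ v)
    · obtain ⟨u, w, huw⟩ := exists_influence hc hc₄ (hVm n) (fun v => (h v).1) (fun v => (h v).2)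
        (hGm n) (hα n)
      exact ⟨(u, w), fun _ => huw⟩
    -- A default value, taken only for the finitely many `n` at which the form bounds fail.
    · exact ⟨0, fun h' => absurd h' h⟩
  choose uw huw using key
  exact ⟨fun n => (uw n).1, fun n => (uw n).2, hform.mono fun n hn => huw n hn⟩

end Assumptions

end EmpLik

end

/-! ### Asymptotic normality of the empirical likelihood estimator -/

theorem propositionA1
    -- dimensions of the observations, of the parameter, and number of moments
    (d p r : ℕ → ℕ)
    -- for each sample size an i.i.d. sample with common law `μ n`
    {Ω : ℕ → Type*} [∀ n, MeasurableSpace (Ω n)]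
    (P : ∀ n, Measure (Ω n)) [∀ n, IsProbabilityMeasure (P n)]
    (μ : ∀ n, Measure (Fin (d n) → ℝ))
    (X : ∀ n, Fin n → Ω n → Fin (d n) → ℝ)
    (hX_law : ∀ n i, HasLaw (X n i) (μ n) (P n))
    (hX_indep : ∀ n, iIndepFun (X n) (P n))
    [∀ n, IsProbabilityMeasure (μ n)]
    -- parameter sets, true parameters, estimating functions
    (Θ : ∀ n, Set (Fin (p n) → ℝ)) (θ₀ : ∀ n, Fin (p n) → ℝ)
    (g : ∀ n, (Fin (d n) → ℝ) → (Fin (p n) → ℝ) → Fin (r n) → ℝ)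
    (hg_meas : ∀ n, ∀ θ ∈ Θ n, Measurable fun x => g n x θ)
    (hΘ_convex : ∀ n, Convex ℝ (Θ n))
    (hθ₀_mem : ∀ n, θ₀ n ∈ Θ n)
    -- the Euclidean distance of `θ₀` to the boundary is of larger order than `√(r / n)`
    (hθ₀_int : ∃ ρ : ℕ → ℝ,
      (∀ n, {θ | ∑ k, (θ k - θ₀ n k) ^ 2 ≤ ρ n ^ 2} ⊆ Θ n) ∧
      Tendsto (fun n : ℕ => ρ n / √((r n : ℝ) / (n : ℝ))) atTop atTop)
    -- valid moments
    (hmoment : ∀ n, EmpLik.popMean (μ n) (g n) (θ₀ n) = 0)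
    -- (i)
    (C₁ : ℝ) (hC₁ : 0 < C₁)
    (hident : ∀ n, ∀ ε : ℝ, 0 < ε → ∀ θ ∈ Θ n, ε < ‖θ - θ₀ n‖ →
      C₁ * ε ≤ ‖EmpLik.popMean (μ n) (g n) θ‖)
    -- (ii)
    (C₂ C₃ γ : ℝ) (hC₂ : 0 < C₂) (hC₃ : 1 < C₃) (hγ : 4 < γ)
    (henv : ∀ n j, ∫⁻ x, (⨆ θ ∈ Θ n, ENNReal.ofReal (|g n x θ j| ^ γ)) ∂(μ n)
      ≤ ENNReal.ofReal C₂)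
    (heig : EmpLik.HoldsWPA1 P fun n => {ω | ∀ θ ∈ Θ n,
      C₃⁻¹ ≤ EmpLik.lamMin (EmpLik.empV (g n) (fun i => X n i ω) θ) ∧
      EmpLik.lamMax (EmpLik.empV (g n) (fun i => X n i ω) θ) ≤ C₃})
    -- (iii)
    (hsmooth : ∀ n x j, ContDiffOn ℝ 2 (fun θ => g n x θ j) (Θ n))
    (hreg : EmpLik.IsBigOpOne P fun n ω =>
      EmpLik.regSup (Θ n) (g n) γ (fun i => X n i ω))
    (C₅ : ℝ) (hgrad : ∀ n j k,
      ∫⁻ x, ENNReal.ofReal ((EmpLik.pderivOn (Θ n) (fun t => g n x t j) k (θ₀ n)) ^ 2) ∂(μ n)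
        ≤ ENNReal.ofReal C₅)
    -- (iv)
    (C₄ : ℝ) (hC₄ : 1 < C₄)
    (hQ : ∀ n, C₄⁻¹ < EmpLik.lamMin (EmpLik.matQ (μ n) (Θ n) (g n) (θ₀ n)) ∧
      EmpLik.lamMax (EmpLik.matQ (μ n) (Θ n) (g n) (θ₀ n)) < C₄)
    -- (v)
    (hrate₁ : Tendsto (fun n : ℕ => (r n : ℝ) ^ 3 * (n : ℝ) ^ (-1 + 2 / γ)) atTop (𝓝 0))
    (hrate₂ : Tendsto (fun n : ℕ => (r n : ℝ) ^ 3 * (p n : ℝ) ^ 2 * (n : ℝ)⁻¹) atTop (𝓝 0))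
    -- the open interval that restricts the multipliers
    (V : Set ℝ) (hV_open : IsOpen V) (hV_conn : V.OrdConnected) (hV_zero : (0 : ℝ) ∈ V)
    (hV_log : ∀ v ∈ V, -1 < v)
    -- the empirical likelihood estimator
    (θhat : ∀ n, Ω n → Fin (p n) → ℝ)
    (hθhat_meas : ∀ n, AEMeasurable (θhat n) (P n))
    (hθhat : EmpLik.HoldsWPA1 P fun n =>
      {ω | EmpLik.IsELEstimate V (Θ n) (g n) (fun i => X n i ω) (θhat n ω)})
    -- unit directions
    (α : ∀ n, Fin (p n) → ℝ) (hα : ∀ n, ∑ k, α n k ^ 2 = 1) :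
    TendstoInDistribution
      (fun (n : ℕ) ω => √(n : ℝ) *
        (α n ⬝ᵥ (EmpLik.matSqrt (EmpLik.matJ (μ n) (Θ n) (g n) (θ₀ n)) *ᵥ
          (θhat n ω - θ₀ n))))
      atTop (id : ℝ → ℝ) P (gaussianReal 0 1) := by
  have hC₃0 : 0 < C₃ := by linarith
  have hγ0 : 0 < γ := by linarith
  obtain ⟨ρ, hball, hρ⟩ := hθ₀_int
  -- dimensions
  have hp : ∀ n, 1 ≤ p n := fun n => by
    by_contra h
    have h0 : p n = 0 := by omega
    have : IsEmpty (Fin (p n)) := by rw [h0]; infer_instance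
    simpa using hα n
  set c₄ : ℝ := √C₄⁻¹ with hc₄
  have hC₄0 : 0 < C₄⁻¹ := inv_pos.2 (by linarith)
  have hc₄0 : 0 < c₄ := Real.sqrt_pos.2 hC₄0
  have hGm : ∀ n v, c₄ * EmpLik.l2 v ≤ EmpLik.l2 (EmpLik.popGrad (μ n) (Θ n) (g n) (θ₀ n) *ᵥ v) :=
    fun n v => EmpLik.mul_l2_le_of_lamMin_matQ hC₄0.le (hQ n).1.le v
  have hpr : ∀ n, p n ≤ r n := fun n => EmpLik.le_of_mul_l2_le hc₄0 (hGm n)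
  have hr : ∀ n, 1 ≤ r n := fun n => (hp n).trans (hpr n)
  have hρ0 : ∀ᶠ n in atTop, 0 < ρ n := by
    filter_upwards [hρ.eventually_gt_atTop 0] with n hn
    by_contra h
    exact absurd hn (not_lt.2 (div_nonpos_of_nonpos_of_nonneg (not_lt.1 h) (Real.sqrt_nonneg _)))
  -- population bounds
  set C : ℝ := max (1 + C₂) C₅ with hC
  have hC1 : 1 ≤ C := le_max_of_le_left (by linarith)
  have hPB : ∀ᶠ n in atTop, EmpLik.PopulationBounds (μ n) (Θ n) (θ₀ n) (g n) C C₁ c₄ :=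
    hρ0.mono fun n hn => EmpLik.populationBounds_of_moments hn (hball n) (hθ₀_mem n) (hg_meas n)
      (hmoment n) hC₁ (hident n) hC₂.le hγ.le (henv n) (hsmooth n) (hgrad n) (hGm n)
  have hnhds : ∀ᶠ n in atTop, Θ n ∈ 𝓝 (θ₀ n) :=
    hρ0.mono fun n hn => EmpLik.mem_nhds_of_ball_subset hn (hball n)
  have htyp := fun {ε : ℝ} (hε : 0 < ε) => EmpLik.exists_eventually_measure_compl_le hΘ_convex
    hnhds hC₃.le hγ0 heig hsmooth hreg hθhat hε
  have hhalf : ∀ {ε : ℝ}, ε ≤ 1 / 20 → ENNReal.ofReal (3 * ε) < 2⁻¹ := fun {ε} hε => by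
    rw [show (2⁻¹ : ENNReal) = ENNReal.ofReal 2⁻¹ by
      rw [ENNReal.ofReal_inv_of_pos (by norm_num)]; simp]
    exact (ENNReal.ofReal_lt_ofReal_iff (by norm_num)).2 (by linarith)
  have hr2 := fun {c : ℝ} (hc : 0 < c) => EmpLik.eventually_sq_mul_le hp hpr hrate₂ hc
  have hform : ∀ᶠ n in atTop, ∀ v, (2 * C₃)⁻¹ * (v ⬝ᵥ v)
      ≤ v ⬝ᵥ (EmpLik.popV (μ n) (g n) (θ₀ n) *ᵥ v) ∧
      v ⬝ᵥ (EmpLik.popV (μ n) (g n) (θ₀ n) *ᵥ v) ≤ 2 * C₃ * (v ⬝ᵥ v) := by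
    obtain ⟨M, -, hM⟩ := htyp (show (0 : ℝ) < 1 / 20 by norm_num)
    filter_upwards [hM, hPB, hr2 (show 0 < 8 * C * C₃ ^ 2 by positivity), eventually_gt_atTop 0]
      with n ⟨E, hPE, hE⟩ hB hrn hn
    exact hB.popV_form_bounds hn (hX_law n) (hX_indep n) hC₃.le (hPE.trans_lt (hhalf le_rfl))
      (fun ω hω v => (hE ω hω).1.low _ hB.mem v) (fun ω hω v => (hE ω hω).1.up _ hB.mem v) hrn
  -- the influence function
  obtain ⟨u, w, huw⟩ := EmpLik.exists_influence_sequence (show 0 < 2 * C₃ by linarith) hc₄0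
    (fun n => EmpLik.transpose_popV (μ := μ n) (g := g n) (θ₀ n)) hform hGm
    (α := α) (fun n => by simpa [dotProduct, sq] using hα n)
  set W : ℝ := √(2 * C₃) with hW
  have hW0 : 0 < W := Real.sqrt_pos.2 (by linarith)
  have hsmall := EmpLik.tendsto_mul_sqrt_div hrate₂
  -- This sequence is chosen so that `n * β²` equals the fourth-moment bound `W⁴ r² C` of the
  -- influence function.
  have hβ : Tendsto (fun n : ℕ => W ^ 2 * √C * (r n / √(n : ℝ))) atTop (𝓝 0) := by
    have h1 : Tendsto (fun n : ℕ => (r n : ℝ) / √(n : ℝ)) atTop (𝓝 0) := by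
      refine squeeze_zero (fun n => by positivity) (fun n => ?_) hsmall
      have hp' : (1 : ℝ) ≤ p n := by exact_mod_cast hp n
      have hr' : (1 : ℝ) ≤ r n := by exact_mod_cast hr n
      rw [Real.sqrt_div' _ (Nat.cast_nonneg n), ← mul_div_assoc]
      refine div_le_div_of_nonneg_right ?_ (Real.sqrt_nonneg _)
      calc (r n : ℝ) = r n * 1 * 1 := by ring
        _ ≤ r n * p n * √(r n : ℝ) := by
          gcongr
          exact Real.one_le_sqrt.2 hr'
    simpa using h1.const_mul (W ^ 2 * √C)
  refine EmpLik.tendstoInDistribution_of_asymptotically_linear hX_law hX_indep (fun n => ?_)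
    (Y := fun n x => -w n ⬝ᵥ g n x (θ₀ n)) hβ ?_ ?_
  · have hcont : Continuous fun θ : Fin (p n) → ℝ => √(n : ℝ) *
        (α n ⬝ᵥ (EmpLik.matSqrt (EmpLik.matJ (μ n) (Θ n) (g n) (θ₀ n)) *ᵥ (θ - θ₀ n))) := by
      simp only [dotProduct, mulVec, Pi.sub_apply]
      fun_prop
    exact hcont.measurable.comp_aemeasurable (hθhat_meas n)
  · filter_upwards [hPB, huw, eventually_gt_atTop 0] with n hB ⟨_, _, hwW, hw1, _⟩ hn
    have hn' : (0 : ℝ) < n := by exact_mod_cast hn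
    have hr' : (0 : ℝ) < r n := by exact_mod_cast hr n
    have h4 := hB.memLp _ hB.mem
    have h2 : ∀ j, MemLp (fun x => g n x (θ₀ n) j) 2 (μ n) := fun j =>
      (h4 j).mono_exponent (by norm_num)
    refine ⟨?_, EmpLik.memLp_dotProduct h4 _, ?_, ?_, by positivity, ?_⟩
    · exact Finset.measurable_fun_sum _ fun j _ => (hB.meas _ hB.mem j).const_mul _
    · simp only [dotProduct]
      rw [integral_finsetSum _ fun j _ => ((h2 j).integrable (by norm_num)).const_mul _]
      refine Finset.sum_eq_zero fun j _ => ?_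
      rw [integral_const_mul, show ∫ x, g n x (θ₀ n) j ∂(μ n) = 0 from congrFun hB.mean j, mul_zero]
    · rw [← hw1, EmpLik.dotProduct_popV_mulVec h2]
      exact integral_congr_ae (ae_of_all _ fun x => by simp only [neg_dotProduct]; ring)
    · refine (EmpLik.integral_dotProduct_pow_four_le h4 (hB.fourth _ hB.mem) _).trans ?_
      have e : (n : ℝ) * (W ^ 2 * √C * (r n / √(n : ℝ))) ^ 2 = W ^ 4 * (r n ^ 2 * C) := by
        rw [mul_pow, mul_pow, div_pow, Real.sq_sqrt hn'.le, Real.sq_sqrt (show 0 ≤ C by linarith)]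
        field_simp
      rw [e, EmpLik.l2_neg]
      gcongr
      exact EmpLik.l2_nonneg _
  · intro η hη ε hε
    -- The final bound consists of two copies of `3 * ε₁` and four of `ε₁`, in total `10 * ε₁`; the
    -- cap by `1` keeps `3 * ε₁` below one half.
    set ε₁ : ℝ := min ε 1 / 20 with hε₁
    have hε₁0 : 0 < ε₁ := by positivity
    have hε₁1 : ε₁ ≤ 1 / 20 := by rw [hε₁]; linarith [min_le_right ε 1]
    have hε₁ε : 10 * ε₁ ≤ ε := by rw [hε₁]; linarith [min_le_left ε 1]
    -- The moment bound `M` depends on `ε` only and is fixed before `n` grows, so the constants of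
    -- the linearisation built from it are harmless against the vanishing rates.
    obtain ⟨M, hM1, hM⟩ := htyp hε₁0
    -- The summands secure, in turn, `A ≥ 1`, the constant of the uniform law, and Chebyshev
    -- probabilities `C / A² ≤ ε₁`.
    set A : ℝ := 1 + (4 + √(8 * C)) + C / ε₁ with hA
    have hCε : 0 < C / ε₁ := by positivity
    have hs8 := Real.sqrt_nonneg (8 * C)
    have hA1 : 1 ≤ A := by linarith
    have hCA : C / A ^ 2 ≤ ε₁ := by
      rw [div_le_iff₀ (by positivity), ← div_le_iff₀' hε₁0]
      calc C / ε₁ ≤ A := by linarith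
        _ ≤ A ^ 2 := le_self_pow₀ hA1 two_ne_zero
    obtain ⟨δ₀, hδ₀, hδV⟩ := Metric.isOpen_iff.1 hV_open 0 hV_zero
    set δ : ℝ := min (δ₀ / 2) (1 / 8) with hδ
    have hδ0 : 0 < δ := by positivity
    have hδV' : ∀ x, |x| ≤ δ → x ∈ V := fun x hx => hδV (by
      rw [Metric.mem_ball, Real.dist_0_eq_abs]
      linarith [min_le_left (δ₀ / 2) (1 / 8 : ℝ)])
    obtain ⟨K, D₀, η₀, hK, hη₀, hlin⟩ := EmpLik.exists_linearisation M C₃ A c₄ (W / c₄) W C₁ δ hC₃.le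
      hA1 hc₄0 (by positivity) hW0.le hC₁ hδ0 (min_le_right _ _)
    have henvl := EmpLik.tendsto_envelope_mul_sqrt M hrate₁
    have hKlim := (henvl.add hsmall).const_mul K
    rw [add_zero, mul_zero] at hKlim
    have hMpos : (0 : ℝ) < M := lt_of_lt_of_le one_pos (by exact_mod_cast hM1)
    have hpn := EmpLik.eventually_pow_four_le hp hpr hrate₂
    have hrn : ∀ᶠ n : ℕ in atTop, (r n : ℝ) ≤ n := by
      filter_upwards [hr2 one_pos] with n hn
      have hr' : (1 : ℝ) ≤ r n := by exact_mod_cast hr n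
      nlinarith
    set κ : ℝ := min (C₁ ^ 2 / (128 * M)) (1 / (4 * √(2 * (16 * C)))) with hκ
    have hκ0 : 0 < κ := by positivity
    have hgrid := EmpLik.tendsto_grid_mul_exp hp hpn hrn hκ0
    filter_upwards [hM, hPB, huw, hpn, eventually_gt_atTop 0,
      tendsto_natCast_atTop_atTop.eventually_ge_atTop (M : ℝ),
      tendsto_natCast_atTop_atTop.eventually_ge_atTop C₁,
      tendsto_natCast_atTop_atTop.eventually_gt_atTop (2 * ((1 + C) / C₁)),
      hgrid.eventually_le_const hε₁0, henvl.eventually_le_const hη₀,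
      hsmall.eventually_le_const hη₀, hKlim.eventually_le_const hη, hρ.eventually_ge_atTop D₀]
      with n ⟨E, hPE, hE⟩ hB ⟨hVw, huU, hwW, _, hJ⟩ hpn hn hMn hC₁n hKn hgrid hη₁ hη₂ hη₃ hρn
    have hn' : (0 : ℝ) < n := by exact_mod_cast hn
    have ha0 : 0 < √((r n : ℝ) / n) := Real.sqrt_pos.2 (div_pos (by exact_mod_cast hr n) hn')
    have hm : 2 * ((1 + C) / C₁) * (n : ℝ) ^ 2 < ((n ^ 3 : ℕ) : ℝ) := by
      push_cast
      calc 2 * ((1 + C) / C₁) * (n : ℝ) ^ 2 < n * n ^ 2 := by gcongr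
        _ = _ := by ring
    have hbound := hB.measure_compl_typical_le hC₁ (hp n) (hr n) (hX_law n) (hX_indep n) hMpos
      (show 4 + √(8 * C) ≤ A by linarith) (hPE.trans_lt (hhalf hε₁1)) (fun ω hω => (hE ω hω).1)
      hpn hMn hC₁n hm
    refine (measure_mono fun ω hω => ?_).trans (hbound.trans ?_)
    · rw [Set.mem_ofPred_eq] at hω ⊢
      rintro ⟨hωE, h1, h2, h3, h4⟩
      have hmin := (hE ω hωE).2
      have h5 := hlin n (p n) (r n) (Θ n) (fun i θ => g n (X n i ω) θ) _ _ (ρ n) V (θ₀ n) (θhat n ω)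
        (EmpLik.popMean (μ n) (g n)) _ _ (hp n) (hpr n) rfl (hE ω hωE).1 hη₁ hη₂
        ((le_div_iff₀ ha0).1 hρn)
        (fun θ hθ => hball n (by
          have h0 := EmpLik.l2_nonneg (θ - θ₀ n)
          have := pow_le_pow_left₀ h0 hθ 2
          rw [EmpLik.l2_sq] at this
          simpa [dotProduct, sq] using this))
        hδV' hV_log (hmin.minimisesCriterion hn) hB.mem hmin.1 h1 h2 h3 (hGm n)
        (EmpLik.transpose_popV _) hB.sep h4 (u n) (w n) hVw huU hwW
      -- On the typical event the linearisation error is at most `η`; the sign in `Y` turns the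
      -- difference of the two statistics into the sum that was bounded.
      refine absurd (h5.trans hη₃) (not_le.2 (hω.trans_le (le_of_eq ?_)))
      have e : (EmpLik.empMean fun i => -w n ⬝ᵥ g n (X n i ω) (θ₀ n))
          = -(w n ⬝ᵥ EmpLik.gbar (fun i θ => g n (X n i ω) θ) (θ₀ n)) := by
        rw [← neg_dotProduct, ← EmpLik.dotProduct_empMean]; rfl
      rw [e, EmpLik.matJ, ← hJ, ← abs_of_nonneg (Real.sqrt_nonneg (n : ℝ)), ← abs_mul,
        abs_of_nonneg (Real.sqrt_nonneg (n : ℝ))]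
      congr 1; ring
    · have hA2 : ENNReal.ofReal (C / A ^ 2) ≤ ENNReal.ofReal ε₁ := ENNReal.ofReal_le_ofReal hCA
      refine (add_le_add hPE (add_le_add hA2 (add_le_add hA2 (add_le_add hA2 (add_le_add hPE
        (ENNReal.ofReal_le_ofReal hgrid)))))).trans ?_
      rw [← ENNReal.ofReal_add (by positivity) (by positivity),
        ← ENNReal.ofReal_add (by positivity) (by positivity),
        ← ENNReal.ofReal_add (by positivity) (by positivity),
        ← ENNReal.ofReal_add (by positivity) (by positivity),
        ← ENNReal.ofReal_add (by positivity) (by positivity)]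
      exact ENNReal.ofReal_le_ofReal (by linarith)
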